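/- \textbf{Setting.} Fix integers $P\ge 2$, $M\ge 1$, and reals $r\in(0,1]$, $\beta>0$, $\theta\in(0,1]$, and numbers $K=K_N$ with $K_N/N^{P-1}\to\alpha$ as $N\to\infty$. Put $$\beta'=\frac{2\beta}{P!},\quad \alpha=\gamma\frac{2}{P!},\quad \rho=\frac{1-r^2}{Mr^2},\quad \rho_P=\frac{1-r^{2P}}{Mr^{2P}},\quad \mathcal R=r^2(1+\rho),\quad \kappa=\frac{(1+\sqrt{\rho_P})^2}{(1+\rho)^P}.$$ Let $\xi_i$ ($i\le N$) be i.i.d. uniform on $\{-1,1\}$; given $\xi$, let the examples $\eta_i^{a}\in\{-1,1\}$ ($a\le M$) be independent with $\mathbb P(\eta_i^a=\pm\xi_i)=\frac{1\pm r}{2}$; let $\lambda_{i_1\dots i_P}$ ($i_1<\dots<i_P$) be i.i.d. standard Gaussians, independent of $(\xi,\eta)$. $\mathbb E_0$ is the average over $\xi,\eta,\lambda$. The unsupervised dense associative memory (retrieving one archetype $\xi$, the other archetypes acting as Gaussian noise), with a source $J$, has on $\sigma\in\{-1,1\}^N$ the Boltzmann factor $$\mathcal B_N(\sigma;J)=\exp\Big[J\sum_i\xi_i\sigma_i+\frac{\beta'}{2\mathcal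 R^{P/2}MN^{P-1}}\sum_{a}\Big(\sum_i\eta_i^{a}\sigma_i\Big)^P+\frac{\alpha}{\sqrt K}\frac{\beta'P!(1+\sqrt{\rho_P})}{2(1+\rho)^{P/2}}\sum_{i_1<\dots<i_P}\lambda_{i_1\dots i_P}\sigma_{i_1}\cdots\sigma_{i_P}\Big],$$ the partition function $\mathcal Z_N(J)=\sum_\sigma\mathcal B_N(\sigma;J)$, and the quenched free energy $\mathcal F_N(J)$ given by $-\beta'\mathcal F_N(J)=\frac1N\mathbb E_0\ln\mathcal Z_N(J)$. Let $m(\sigma)=\frac1N\sum_i\xi_i\sigma_i$, $n_a(\sigma)=\frac{r}{\mathcal R}\frac1N\sum_i\eta^a_i\sigma_i$, $q_{12}(\sigma,\tau)=\frac1N\sum_i\sigma_i\tau_i$. \textbf{Interpolating system.} Given numbers $\bar n,\bar q_1,\bar q_2$, put $\psi=\beta'\frac{P}{2M}(1+\rho)^{P/2}\bar n^{P-1}$, $A_1=\beta'\sqrt{\gamma\kappa\frac P2\bar q_1^{P-1}}$, $A_2=\beta'\sqrt{\gamma\kappa\frac P2(\bar q_2^{P-1}-\bar q_1^{P-1})}$.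 For $t\in[0,1]$ and independent standard Gaussian vectors $Y^{(1)},Y^{(2)}\in\mathbb R^N$ let $$\mathcal B_2(\sigma)=\exp\Big[J\sum_i\xi_i\sigma_i+\frac{t\beta'N}{2M}(1+\rho)^{P/2}\sum_an_a^P(\sigma)+\psi(1-t)N\sum_an_a(\sigma)+\sqrt{1-t}\sum_{b=1}^2A_b\sum_iY_i^{(b)}\sigma_i+\sqrt t\,\frac{\alpha}{\sqrt K}\frac{\beta'P!(1+\sqrt{\rho_P})}{2(1+\rho)^{P/2}}\sum_{i_1<\dots<i_P}\lambda_{i_1\dots i_P}\sigma_{i_1}\cdots\sigma_{i_P}\Big],$$ $\mathcal Z_2=\sum_\sigma\mathcal B_2(\sigma)$, let $\omega_t$ be the Gibbs average with weights $\mathcal B_2/\mathcal Z_2$, and $\mathcal W_{2,t}=\mathcal Z_2^\theta/\mathbb E_{Y^{(2)}}\mathcal Z_2^\theta$. Define the averages $\langle\cdot\rangle_t=\mathbb E_0\mathbb E_{Y^{(1)}}\mathbb E_{Y^{(2)}}\mathcal W_{2,t}\,\omega_t(\cdot)$ of one replica and $\langle\cdot\rangle_{t,1}=\mathbb E_0\mathbb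 E_{Y^{(1)}}[\mathbb E_{Y^{(2)}}\mathcal W_{2,t}\omega_t]^{\otimes2}(\cdot)$, $\langle\cdot\rangle_{t,2}=\mathbb E_0\mathbb E_{Y^{(1)}}\mathbb E_{Y^{(2)}}\mathcal W_{2,t}\,\omega_t^{\otimes2}(\cdot)$ of two replicas. \textbf{Assumptions.} There are $J_0>0$ and, for $J\in(0,J_0)$, numbers $\bar m(J),\bar n(J),\bar q_1(J),\bar q_2(J)$ having limits $\bar m,\bar n,\bar q_1,\bar q_2$ as $J\downarrow0$, such that for every $J\in(0,J_0)$, with the interpolating system formed with $\bar n(J),\bar q_1(J),\bar q_2(J)$, the following hold as $N\to\infty$. (i) (1RSB) Under the quenched Gibbs measure of the model with source $J$, the law of $q_{12}$ converges weakly to $\theta\delta_{\bar q_1(J)}+(1-\theta)\delta_{\bar q_2(J)}$, and $m$ and each $n_a$ are self-averaging: their laws converge weakly to $\delta_{\bar m(J)}$ and $\delta_{\bar n(J)}$. The same self-averaging of $m$ and $n_a$ holds under $\langle\cdot\rangle_t$ for every $t\in[0,1)$. (ii) For every $t\in[0,1)$, $k\ge2$ and $a=1,2$: $\langle(q_{12}-\bar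 q_a(J))^k\rangle_{t,a}\to0$. \textbf{Conclusion.} The limit $\mathcal F(J)=\lim_{N\to\infty}\mathcal F_N(J)$ exists for $J\in[0,J_0)$. Let $Y^{(1)},Y^{(2)}$ now be independent standard Gaussian variables, $\mathbb E_{\xi}\mathbb E_{(\eta|\xi)}$ the average over one entry $\xi,\eta^1,\dots,\eta^M$ of the archetype and its examples, $\hat\eta_M=\frac1{rM}\sum_a\eta^a$, and $$g=\beta'\tfrac P2\bar n^{P-1}(1+\rho)^{P/2-1}\hat\eta_M+Y^{(1)}\beta'\sqrt{\gamma\kappa\tfrac P2\bar q_1^{P-1}}+Y^{(2)}\beta'\sqrt{\gamma\kappa\tfrac P2(\bar q_2^{P-1}-\bar q_1^{P-1})}.$$ Then $$-\beta'\mathcal F(0)=\ln2+\frac1\theta\mathbb E_\xi\mathbb E_{(\eta|\xi)}\mathbb E_{Y^{(1)}}\ln\mathbb E_{Y^{(2)}}\cosh^\theta g-\frac{\beta'}2(P-1)(1+\rho)^{P/2}\bar n^P+\frac{\beta'^2}4\gamma\kappa\big[1-P\bar q_2^{P-1}+(P-1)\bar q_2^P\big]-\frac{\beta'^2}4\gamma\kappa(P-1)\theta(\bar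 q_2^P-\bar q_1^P),$$ and the order parameters satisfy $$\bar n=\frac1{1+\rho}\mathbb E_\xi\mathbb E_{(\eta|\xi)}\mathbb E_{Y^{(1)}}\Big[\frac{\mathbb E_{Y^{(2)}}\cosh^\theta g\,\tanh g}{\mathbb E_{Y^{(2)}}\cosh^\theta g}\hat\eta_M\Big],\quad \bar q_1=\mathbb E_\xi\mathbb E_{(\eta|\xi)}\mathbb E_{Y^{(1)}}\Big[\Big(\frac{\mathbb E_{Y^{(2)}}\cosh^\theta g\,\tanh g}{\mathbb E_{Y^{(2)}}\cosh^\theta g}\Big)^2\Big],\quad \bar q_2=\mathbb E_\xi\mathbb E_{(\eta|\xi)}\mathbb E_{Y^{(1)}}\Big[\frac{\mathbb E_{Y^{(2)}}\cosh^\theta g\,\tanh^2 g}{\mathbb E_{Y^{(2)}}\cosh^\theta g}\Big].$$ Furthermore $\bar m=-\beta'\,\frac{d}{dJ}\mathcal F(J)\big|_{J=0^+}$ (right derivative at $0$), and $$\bar m=\mathbb E_\xi\mathbb E_{(\eta|\xi)}\mathbb E_{Y^{(1)}}\Big[\frac{\mathbb E_{Y^{(2)}}\cosh^\theta g\,\tanh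 g}{\mathbb E_{Y^{(2)}}\cosh^\theta g}\,\xi\Big].$$ -/

import Mathlib

open MeasureTheory ProbabilityTheory Filter Topology
open scoped BoundedContinuousFunction

namespace UnsupDAM

noncomputable section

/-! ### Model -/

/-- Ising variables, with values in `{-1, 1}`. -/
abbrev Spin : Type := ℤˣ

/-- The real value `± 1` of an Ising variable. -/
def sv (s : Spin) : ℝ := ((s : ℤ) : ℝ)

/-- The control parameters: interaction order `P`, number `M` of examples per archetype,
quality `r` of the examples, inverse noise `β`, load `α`, Parisi parameter `θ`, and
the number `K N` of archetypes at size `N`. -/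
structure Model where
  P : ℕ
  M : ℕ
  r : ℝ
  β : ℝ
  α : ℝ
  θ : ℝ
  K : ℕ → ℕ

/-- Order parameters `m̄, n̄, q̄₁, q̄₂`. -/
structure OrderParams where
  m : ℝ
  n : ℝ
  q₁ : ℝ
  q₂ : ℝ

namespace Model

variable (D : Model)

/-- `β' = 2 β / P!`. -/
def β' : ℝ := 2 * D.β / (D.P.factorial : ℝ)

/-- `γ`, defined by `α = γ * 2 / P!`. -/
def γ : ℝ := D.α * (D.P.factorial : ℝ) / 2

/-- The dataset entropy `ρ = (1 - r²) / (M r²)`. -/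
def ρ : ℝ := (1 - D.r ^ 2) / (D.M * D.r ^ 2)

/-- `ρ_P = (1 - r^(2P)) / (M r^(2P))`. -/
def ρP : ℝ := (1 - D.r ^ (2 * D.P)) / (D.M * D.r ^ (2 * D.P))

/-- `𝓡 = r² (1 + ρ)`. -/
def R : ℝ := D.r ^ 2 * (1 + D.ρ)

/-- Ranges of the control parameters, and `K / N^(P-1) → α`. -/
structure Admissible : Prop where
  two_le_P : 2 ≤ D.P
  one_le_M : 1 ≤ D.M
  r_pos : 0 < D.r
  r_le_one : D.r ≤ 1
  β_pos : 0 < D.β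
  θ_pos : 0 < D.θ
  θ_le_one : D.θ ≤ 1
  load : Tendsto (fun N : ℕ => (D.K N : ℝ) / (N : ℝ) ^ (D.P - 1)) atTop (𝓝 D.α)

/-! ### Quenched disorder -/

/-- The quenched disorder at size `N`: the archetype `ξ`, its examples `η a`, and
one coupling `lam I` for each set `I = {i₁ < ⋯ < i_P}` of `P` neurons. -/
structure Disorder (N : ℕ) where
  ξ : Fin N → Spin
  η : Fin D.M → Fin N → Spin
  lam : {I : Finset (Fin N) // I.card = D.P} → ℝ

/-- `ℙ(η | ξ)` for one entry of one example. -/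
def exampleProb (e x : Spin) : ℝ :=
  (1 - D.r) / 2 * (if e = -x then 1 else 0) + (1 + D.r) / 2 * (if e = x then 1 else 0)

/-- The average `𝔼₀` over the archetype (uniform), its examples (given the archetype), and the
couplings (independent standard Gaussians). -/
def E0 {N : ℕ} (f : D.Disorder N → ℝ) : ℝ :=
  ∑ ξ : Fin N → Spin, ∑ η : Fin D.M → Fin N → Spin,
    (∏ i, (1 / 2 * ∏ a, D.exampleProb (η a i) (ξ i))) *
      ∫ lam, f ⟨ξ, η, lam⟩ ∂(Measure.pi fun _ => gaussianReal 0 1)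

/-- The average over a vector of `N` independent standard Gaussians. -/
def EY {N : ℕ} (f : (Fin N → ℝ) → ℝ) : ℝ :=
  ∫ y, f y ∂(Measure.pi fun _ => gaussianReal 0 1)

variable {D} {N : ℕ}

/-! ### Order parameters as functions of the configurations -/

/-- Mattis magnetization `m₁(σ)` of the archetype. -/
def mattis (d : D.Disorder N) (σ : Fin N → Spin) : ℝ :=
  1 / N * ∑ i, sv (d.ξ i) * sv (σ i)

/-- Mattis magnetization `n_{1,a}(σ)` of the example `a`. -/
def mattisEx (d : D.Disorder N) (a : Fin D.M) (σ : Fin N → Spin) : ℝ :=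
  D.r / D.R * (1 / N) * ∑ i, sv (d.η a i) * sv (σ i)

/-- Two-replica overlap `q₁₂`. -/
def overlap (σ τ : Fin N → Spin) : ℝ := 1 / N * ∑ i, sv (σ i) * sv (τ i)

/-- `∑_{i₁ < ⋯ < i_P} λ_{i₁ … i_P} σ_{i₁} ⋯ σ_{i_P}`. -/
def noise (d : D.Disorder N) (σ : Fin N → Spin) : ℝ :=
  ∑ I, d.lam I * ∏ i ∈ I.1, sv (σ i)

/-- The coefficient of the noise term. -/
def noiseCoeff (D : Model) (N : ℕ) : ℝ :=
  D.α / √(D.K N) *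
    (D.β' * D.P.factorial * (1 + √D.ρP) / (2 * (1 + D.ρ) ^ ((D.P : ℝ) / 2)))

/-! ### The model and its quenched free energy -/

/-- Boltzmann factor of the model, with source `J` coupled to the archetype. -/
def boltz (d : D.Disorder N) (J : ℝ) (σ : Fin N → Spin) : ℝ :=
  Real.exp (J * ∑ i, sv (d.ξ i) * sv (σ i)
    + D.β' / (2 * D.R ^ ((D.P : ℝ) / 2) * D.M * (N : ℝ) ^ (D.P - 1))
        * ∑ a, (∑ i, sv (d.η a i) * sv (σ i)) ^ D.P
    + D.noiseCoeff N * noise d σ)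

/-- Partition function of the model. -/
def Z (d : D.Disorder N) (J : ℝ) : ℝ := ∑ σ, boltz d J σ

/-- Quenched free energy at size `N`: `- β' F_N(J) = N⁻¹ 𝔼₀ ln Z_N(J)`. -/
def freeEnergy (D : Model) (N : ℕ) (J : ℝ) : ℝ :=
  -(1 / D.β') * (1 / N * D.E0 fun d : D.Disorder N => Real.log (Z d J))

/-- Quenched Gibbs average of an observable of one replica. -/
def avg (D : Model) (N : ℕ) (J : ℝ) (f : D.Disorder N → (Fin N → Spin) → ℝ) : ℝ :=
  D.E0 fun d : D.Disorder N => ∑ σ, boltz d J σ / Z d J * f d σ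

/-- Quenched Gibbs average of an observable of two replicas (sharing the disorder). -/
def avg2 (D : Model) (N : ℕ) (J : ℝ) (f : (Fin N → Spin) → (Fin N → Spin) → ℝ) : ℝ :=
  D.E0 fun d : D.Disorder N =>
    ∑ σ, ∑ τ, (boltz d J σ / Z d J) * (boltz d J τ / Z d J) * f σ τ

/-! ### The interpolating system -/

/-- The constant `ψ` of the one-body system. -/
def ψ (D : Model) (o : OrderParams) : ℝ :=
  D.β' * D.P / (2 * D.M) * (1 + D.ρ) ^ ((D.P : ℝ) / 2) * o.n ^ (D.P - 1)

/-- The constant `A₁` of the one-body system. -/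
def A₁ (D : Model) (o : OrderParams) : ℝ :=
  D.β' * √(D.γ * (D.P / 2) * ((1 + √D.ρP) ^ 2 / (1 + D.ρ) ^ D.P) * o.q₁ ^ (D.P - 1))

/-- The constant `A₂` of the one-body system. -/
def A₂ (D : Model) (o : OrderParams) : ℝ :=
  D.β' * √(D.γ * (D.P / 2) * ((1 + √D.ρP) ^ 2 / (1 + D.ρ) ^ D.P)
    * (o.q₂ ^ (D.P - 1) - o.q₁ ^ (D.P - 1)))

/-- Generalised Boltzmann factor `𝓑₂` of the interpolating system. -/
def boltzI (o : OrderParams) (J t : ℝ) (d : D.Disorder N) (Y₁ Y₂ : Fin N → ℝ)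
    (σ : Fin N → Spin) : ℝ :=
  Real.exp (J * ∑ i, sv (d.ξ i) * sv (σ i)
    + t * D.β' * N / (2 * D.M) * (1 + D.ρ) ^ ((D.P : ℝ) / 2) * ∑ a, mattisEx d a σ ^ D.P
    + D.ψ o * (1 - t) * N * ∑ a, mattisEx d a σ
    + √(1 - t) * (D.A₁ o * ∑ i, Y₁ i * sv (σ i) + D.A₂ o * ∑ i, Y₂ i * sv (σ i))
    + √t * D.noiseCoeff N * noise d σ)

/-- Interpolating partition function `𝓩₂`. -/
def Z₂ (o : OrderParams) (J t : ℝ) (d : D.Disorder N) (Y₁ Y₂ : Fin N → ℝ) : ℝ :=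
  ∑ σ, boltzI o J t d Y₁ Y₂ σ

/-- The weights of the Gibbs average `ω_t`. -/
def gibbsI (o : OrderParams) (J t : ℝ) (d : D.Disorder N) (Y₁ Y₂ : Fin N → ℝ)
    (σ : Fin N → Spin) : ℝ :=
  boltzI o J t d Y₁ Y₂ σ / Z₂ o J t d Y₁ Y₂

/-- `𝓦_{2,t} = 𝓩₂^θ / 𝔼_{Y⁽²⁾} 𝓩₂^θ`. -/
def W₂ (o : OrderParams) (J t : ℝ) (d : D.Disorder N) (Y₁ Y₂ : Fin N → ℝ) : ℝ :=
  Z₂ o J t d Y₁ Y₂ ^ D.θ / EY fun y => Z₂ o J t d Y₁ y ^ D.θ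

/-- One-replica average `⟨f⟩_t = 𝔼₀ 𝔼_{Y⁽¹⁾} 𝔼_{Y⁽²⁾} 𝓦_{2,t} ω_t(f)`. -/
def avgI (D : Model) (N : ℕ) (o : OrderParams) (J t : ℝ)
    (f : D.Disorder N → (Fin N → Spin) → ℝ) : ℝ :=
  D.E0 fun d : D.Disorder N => EY fun Y₁ => EY fun Y₂ =>
    W₂ o J t d Y₁ Y₂ * ∑ σ, gibbsI o J t d Y₁ Y₂ σ * f d σ

/-- Two-replica average `⟨f⟩_{t,1} = 𝔼₀ 𝔼_{Y⁽¹⁾} [𝔼_{Y⁽²⁾} 𝓦_{2,t} ω_t]^{⊗ 2} (f)`. -/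
def avgI₁ (D : Model) (N : ℕ) (o : OrderParams) (J t : ℝ)
    (f : (Fin N → Spin) → (Fin N → Spin) → ℝ) : ℝ :=
  D.E0 fun d : D.Disorder N => EY fun Y₁ => ∑ σ, ∑ τ,
    (EY fun Y₂ => W₂ o J t d Y₁ Y₂ * gibbsI o J t d Y₁ Y₂ σ) *
      (EY fun Y₂ => W₂ o J t d Y₁ Y₂ * gibbsI o J t d Y₁ Y₂ τ) * f σ τ

/-- Two-replica average `⟨f⟩_{t,2} = 𝔼₀ 𝔼_{Y⁽¹⁾} 𝔼_{Y⁽²⁾} 𝓦_{2,t} [ω_t]^{⊗ 2} (f)`. -/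
def avgI₂ (D : Model) (N : ℕ) (o : OrderParams) (J t : ℝ)
    (f : (Fin N → Spin) → (Fin N → Spin) → ℝ) : ℝ :=
  D.E0 fun d : D.Disorder N => EY fun Y₁ => EY fun Y₂ =>
    W₂ o J t d Y₁ Y₂ *
      ∑ σ, ∑ τ, gibbsI o J t d Y₁ Y₂ σ * gibbsI o J t d Y₁ Y₂ τ * f σ τ

/-! ### Assumptions -/

/-- One-step replica symmetry breaking at source `J`. In the model, the law of the overlap
converges weakly to `θ δ_{q̄₁} + (1 - θ) δ_{q̄₂}`, and the laws of the Mattis magnetizations to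
`δ_{m̄}` and `δ_{n̄}`; the Mattis magnetizations are self-averaging, with the same values, along
the whole interpolation that leads to the model. -/
structure OneRSB (D : Model) (o : OrderParams) (J : ℝ) : Prop where
  overlap : ∀ φ : ℝ →ᵇ ℝ,
    Tendsto (fun N => D.avg2 N J fun σ τ => φ (overlap σ τ)) atTop
      (𝓝 (D.θ * φ o.q₁ + (1 - D.θ) * φ o.q₂))
  mattis : ∀ φ : ℝ →ᵇ ℝ,
    Tendsto (fun N => D.avg N J fun d σ => φ (mattis d σ)) atTop (𝓝 (φ o.m))
  mattisEx : ∀ (a : Fin D.M) (φ : ℝ →ᵇ ℝ),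
    Tendsto (fun N => D.avg N J fun d σ => φ (mattisEx d a σ)) atTop (𝓝 (φ o.n))
  mattis_interp : ∀ t ∈ Set.Ico (0 : ℝ) 1, ∀ φ : ℝ →ᵇ ℝ,
    Tendsto (fun N => D.avgI N o J t fun d σ => φ (Model.mattis d σ)) atTop (𝓝 (φ o.m))
  mattisEx_interp : ∀ t ∈ Set.Ico (0 : ℝ) 1, ∀ (a : Fin D.M) (φ : ℝ →ᵇ ℝ),
    Tendsto (fun N => D.avgI N o J t fun d σ => φ (Model.mattisEx d a σ)) atTop (𝓝 (φ o.n))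

/-- At each level `a = 1, 2` of the hierarchy the overlap fluctuations around `q̄_a` vanish. The
endpoint `t = 1` is left out: there the two averages coincide. -/
structure OverlapConcentration (D : Model) (o : OrderParams) (J : ℝ) : Prop where
  level₁ : ∀ t ∈ Set.Ico (0 : ℝ) 1, ∀ k : ℕ, 2 ≤ k →
    Tendsto (fun N => D.avgI₁ N o J t fun σ τ => (overlap σ τ - o.q₁) ^ k) atTop (𝓝 0)
  level₂ : ∀ t ∈ Set.Ico (0 : ℝ) 1, ∀ k : ℕ, 2 ≤ k →
    Tendsto (fun N => D.avgI₂ N o J t fun σ τ => (overlap σ τ - o.q₂) ^ k) atTop (𝓝 0)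

/-! ### The one-site averages of the limiting formulas -/

/-- `𝔼_ξ 𝔼_{(η|ξ)}` over one entry of the archetype and of its `M` examples. -/
def Esite (D : Model) (f : Spin → (Fin D.M → Spin) → ℝ) : ℝ :=
  ∑ x : Spin, 1 / 2 * ∑ e : Fin D.M → Spin, (∏ a, D.exampleProb (e a) x) * f x e

/-- The average over one standard Gaussian. -/
def EG (f : ℝ → ℝ) : ℝ := ∫ y, f y ∂(gaussianReal 0 1)

/-- `η̂_M = (r M)⁻¹ ∑ₐ ηᵃ`. -/
def etaHat (D : Model) (e : Fin D.M → Spin) : ℝ := 1 / (D.r * D.M) * ∑ a, sv (e a)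

/-- The field `g`. -/
def g (D : Model) (o : OrderParams) (e : Fin D.M → Spin) (y₁ y₂ : ℝ) : ℝ :=
  D.β' * (D.P / 2) * o.n ^ (D.P - 1) * (1 + D.ρ) ^ ((D.P : ℝ) / 2 - 1) * D.etaHat e
    + y₁ * (D.β' * √(D.γ * (D.P / 2) * ((1 + √D.ρP) ^ 2 / (1 + D.ρ) ^ D.P) * o.q₁ ^ (D.P - 1)))
    + y₂ * (D.β' * √(D.γ * (D.P / 2) * ((1 + √D.ρP) ^ 2 / (1 + D.ρ) ^ D.P)
        * (o.q₂ ^ (D.P - 1) - o.q₁ ^ (D.P - 1))))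

/-- `𝔼_{Y⁽²⁾}[cosh^θ g · h(g)] / 𝔼_{Y⁽²⁾}[cosh^θ g]`, a function of `η` and `Y⁽¹⁾`. -/
def tilt (D : Model) (o : OrderParams) (h : ℝ → ℝ) (e : Fin D.M → Spin) (y₁ : ℝ) : ℝ :=
  (EG fun y₂ => Real.cosh (D.g o e y₁ y₂) ^ D.θ * h (D.g o e y₁ y₂)) /
    EG fun y₂ => Real.cosh (D.g o e y₁ y₂) ^ D.θ

end Model

end

end UnsupDAM

/-!
The proof is Guerra's interpolation with one step of replica symmetry breaking.

Fix a positive source `J`. The interpolating free energy `N⁻¹ 𝔼₀ 𝔼_{Y⁽¹⁾} θ⁻¹ ln 𝔼_{Y⁽²⁾} 𝓩₂^θ` is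
the free energy of the model at `t = 1`, where the fields `Y` have disappeared, and at `t = 0` it is
that of a one-body system, in which the sites decouple. Gaussian integration by parts in the
couplings and in both fields `Y` turns its derivative into averages of one and two replicas
(`CoeffPath.hasDerivAt_integral_log`, `hasDerivAt_interp`): the moments of `n_a`, the overlap, and
the covariance of the noise, which after normalisation differs from the `P`-th power of the overlap
by a term of order `1 / N` (`abs_sum_pow_sub_le`, `tendsto_noiseCov`). By self-averaging and by the
concentration of the overlap, the derivative converges at every `t < 1` to a constant; being
bounded, it can be integrated in the limit, and the fundamental theorem of calculus gives the limit
of the free energy (`tendsto_pressureN`).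

The interpolation is parametrised by an angle `u`, with `√t = sin u` and `√(1 - t) = cos u`. In this
parameter the exponents are smooth on all of `ℝ`, while the square roots of `t` and `1 - t` are not
differentiable at the ends of the interval.

The self-consistency equations at a positive source are the assumptions at `t = 0`: there the
averages of `m`, of `n_a` and of the overlap are one-site averages which do not depend on `N`, and
the assumptions name their limits (`m_eq`, `n_eq`, `q₁_eq`, `q₂_eq`). They also yield
`0 ≤ q̄₁ ≤ q̄₂`, so that the square roots in `A₁` and `A₂` are genuine.

It remains to let `J` decrease to `0`. The one-site averages are continuous in the parameters of the
field, hence the formulas persist. The free energies at finite size are convex in `J`, with slope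
the magnetization, which is at most `1` in absolute value (`mul_avg_mattis_le`,
`abs_avg_mattis_le`). Therefore the
limit of infinite size exists also at `J = 0` (`tendsto_pressureN_zero`), the limiting free energy
lies above its tangents of slope `m̄(J)`, and its difference quotient at `0` lies between `m̄` and
`m̄(J)`, which tends to `m̄` (`hasDerivWithinAt_pressure`).
-/

namespace UnsupDAM

noncomputable section

/-! ### Gibbs averages on a finite set -/

section Gibbs

variable {S : Type*} [Fintype S]

/-- The partition function of the exponents `x`. -/
def pf (x : S → ℝ) : ℝ := ∑ s, Real.exp (x s)

/-- The Gibbs average of `f`, with weights proportional to `exp x`. -/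
def gav (x f : S → ℝ) : ℝ := ∑ s, Real.exp (x s) / pf x * f s

/-- The Gibbs average of an observable of two independent replicas. -/
def gav2 (x : S → ℝ) (Q : S → S → ℝ) : ℝ :=
  ∑ s, ∑ t, (Real.exp (x s) / pf x) * (Real.exp (x t) / pf x) * Q s t

lemma pf_pos [Nonempty S] (x : S → ℝ) : 0 < pf x :=
  Finset.sum_pos (fun _ _ => Real.exp_pos _) Finset.univ_nonempty

lemma gav_eq_div (x f : S → ℝ) : gav x f = (∑ s, Real.exp (x s) * f s) / pf x := by
  simp only [gav, Finset.sum_div]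
  exact Finset.sum_congr rfl fun s _ => by ring

lemma gav_const [Nonempty S] (x : S → ℝ) (c : ℝ) : gav x (fun _ => c) = c := by
  rw [gav_eq_div, ← Finset.sum_mul, div_eq_iff (pf_pos x).ne', mul_comm]
  rfl

lemma gav_mono [Nonempty S] (x : S → ℝ) {f h : S → ℝ} (hfh : ∀ s, f s ≤ h s) :
    gav x f ≤ gav x h :=
  Finset.sum_le_sum fun s _ => mul_le_mul_of_nonneg_left (hfh s)
    (div_nonneg (Real.exp_pos _).le (pf_pos x).le)

lemma abs_gav_le [Nonempty S] (x : S → ℝ) {f : S → ℝ} {B : ℝ} (hf : ∀ s, |f s| ≤ B) :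
    |gav x f| ≤ B := by
  rw [abs_le]
  constructor
  · simpa [gav_const] using gav_mono x (f := fun _ => -B) (h := f) fun s => (abs_le.1 (hf s)).1
  · simpa [gav_const] using gav_mono x (f := f) (h := fun _ => B) fun s => (abs_le.1 (hf s)).2

lemma gav_add (x f h : S → ℝ) : gav x (fun s => f s + h s) = gav x f + gav x h := by
  simp [gav, mul_add, Finset.sum_add_distrib]

lemma gav_const_mul (x : S → ℝ) (c : ℝ) (f : S → ℝ) :
    gav x (fun s => c * f s) = c * gav x f := by
  simp only [gav, Finset.mul_sum]
  exact Finset.sum_congr rfl fun s _ => by ring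

lemma gav_sum {ι : Type*} (I : Finset ι) (x : S → ℝ) (f : ι → S → ℝ) :
    gav x (fun s => ∑ i ∈ I, f i s) = ∑ i ∈ I, gav x (f i) := by
  simp only [gav, Finset.mul_sum]
  exact Finset.sum_comm

lemma gav2_mul (x f h : S → ℝ) : gav2 x (fun s t => f s * h t) = gav x f * gav x h := by
  simp only [gav2, gav, Finset.sum_mul_sum]
  exact Finset.sum_congr rfl fun s _ => Finset.sum_congr rfl fun t _ => by ring

lemma abs_gav2_le [Nonempty S] (x : S → ℝ) {Q : S → S → ℝ} {B : ℝ} (hQ : ∀ s t, |Q s t| ≤ B) :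
    |gav2 x Q| ≤ B := by
  have : gav2 x Q = gav x (fun s => gav x (Q s)) := by
    simp only [gav2, gav, Finset.mul_sum]
    exact Finset.sum_congr rfl fun s _ => Finset.sum_congr rfl fun t _ => by ring
  rw [this]
  exact abs_gav_le x fun s => abs_gav_le x (hQ s)

lemma exp_le_pf (x : S → ℝ) (s : S) : Real.exp (x s) ≤ pf x :=
  Finset.single_le_sum (f := fun s => Real.exp (x s)) (fun _ _ => (Real.exp_pos _).le)
    (Finset.mem_univ s)

lemma pf_le (x : S → ℝ) {B : ℝ} (hx : ∀ s, x s ≤ B) : pf x ≤ Fintype.card S * Real.exp B := by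
  refine (Finset.sum_le_card_nsmul _ _ _ fun s _ => Real.exp_le_exp.2 (hx s)).trans ?_
  simp

lemma hasDerivAt_sum_exp {x : ℝ → S → ℝ} {x' : S → ℝ} {u : ℝ}
    (hx : ∀ s, HasDerivAt (fun v => x v s) (x' s) u) (f : S → ℝ) :
    HasDerivAt (fun v => ∑ s, Real.exp (x v s) * f s)
      (∑ s, Real.exp (x u s) * (f s * x' s)) u := by
  refine (HasDerivAt.fun_sum fun s _ => ((hx s).exp.mul_const (f s))).congr_deriv ?_
  exact Finset.sum_congr rfl fun s _ => by ring

lemma hasDerivAt_pf [Nonempty S] {x : ℝ → S → ℝ} {x' : S → ℝ} {u : ℝ}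
    (hx : ∀ s, HasDerivAt (fun v => x v s) (x' s) u) :
    HasDerivAt (fun v => pf (x v)) (pf (x u) * gav (x u) x') u := by
  have := hasDerivAt_sum_exp hx (fun _ => 1)
  simp only [mul_one, one_mul] at this
  refine this.congr_deriv ?_
  rw [gav_eq_div, mul_div_cancel₀ _ (pf_pos _).ne']

lemma hasDerivAt_gav [Nonempty S] {x : ℝ → S → ℝ} {x' : S → ℝ} {u : ℝ}
    (hx : ∀ s, HasDerivAt (fun v => x v s) (x' s) u) (f : S → ℝ) :
    HasDerivAt (fun v => gav (x v) f)
      (gav (x u) (fun s => f s * x' s) - gav (x u) f * gav (x u) x') u := by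
  have h := (hasDerivAt_sum_exp hx f).div (hasDerivAt_pf hx) (pf_pos _).ne'
  simp only [gav_eq_div] at h ⊢
  refine h.congr_deriv ?_
  have := (pf_pos (x u)).ne'
  field_simp

/-- Derivative of `Z ^ θ ω(f)` along a path of exponents. -/
lemma hasDerivAt_pf_rpow_mul_gav [Nonempty S] {x : ℝ → S → ℝ} {x' : S → ℝ} {u : ℝ}
    (hx : ∀ s, HasDerivAt (fun v => x v s) (x' s) u) (θ : ℝ) (f : S → ℝ) :
    HasDerivAt (fun v => pf (x v) ^ θ * gav (x v) f)
      (pf (x u) ^ θ * (gav (x u) (fun s => f s * x' s)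
        - (1 - θ) * (gav (x u) f * gav (x u) x'))) u := by
  have h := ((hasDerivAt_pf hx).rpow_const (p := θ) (Or.inl (pf_pos _).ne')).mul
    (hasDerivAt_gav hx f)
  refine h.congr_deriv ?_
  rw [Real.rpow_sub_one (pf_pos _).ne']
  have := (pf_pos (x u)).ne'
  field_simp
  ring

lemma pf_rpow_le [Nonempty S] {θ : ℝ} (h0 : 0 ≤ θ) (h1 : θ ≤ 1) (x : S → ℝ) {B : ℝ} (hB : 0 ≤ B)
    (hx : ∀ s, x s ≤ B) : pf x ^ θ ≤ Fintype.card S * Real.exp B := by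
  have h1' : (1 : ℝ) ≤ Fintype.card S * Real.exp B := by
    have : (1 : ℝ) ≤ Fintype.card S := by exact_mod_cast Fintype.card_pos
    nlinarith [Real.one_le_exp hB]
  refine (Real.rpow_le_rpow (pf_pos x).le (pf_le x hx) h0).trans ?_
  exact (Real.rpow_le_rpow_of_exponent_le h1' h1).trans (by rw [Real.rpow_one])

lemma measurable_pf {Ω : Type*} [MeasurableSpace Ω] {x : Ω → S → ℝ} (hx : Measurable x) :
    Measurable fun ω => pf (x ω) := by
  unfold pf; fun_prop

lemma measurable_gav {Ω : Type*} [MeasurableSpace Ω] {x f : Ω → S → ℝ} (hx : Measurable x)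
    (hf : Measurable f) : Measurable fun ω => gav (x ω) (f ω) := by
  have := measurable_pf hx
  unfold gav; fun_prop

lemma measurable_gav2 {Ω : Type*} [MeasurableSpace Ω] {x : Ω → S → ℝ} (hx : Measurable x)
    (Q : S → S → ℝ) : Measurable fun ω => gav2 (x ω) Q := by
  have := measurable_pf hx
  unfold gav2; fun_prop

end Gibbs

/-! ### Standard Gaussian vectors -/

section Gauss

/-- The law of a vector of independent standard Gaussians indexed by `ι`. -/
abbrev stdG (ι : Type*) [Fintype ι] : Measure (ι → ℝ) := Measure.pi fun _ => gaussianReal 0 1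

variable {ι : Type*} [Fintype ι]

lemma integrable_exp_abs_gaussian (c : ℝ) :
    Integrable (fun y : ℝ => Real.exp (c * |y|)) (gaussianReal 0 1) := by
  refine ((integrable_exp_mul_gaussianReal c).add (integrable_exp_mul_gaussianReal (-c))).mono'
    (by fun_prop) (ae_of_all _ fun y => ?_)
  rw [Real.norm_eq_abs, Real.abs_exp, Pi.add_apply]
  rcases abs_cases y with ⟨h, _⟩ | ⟨h, _⟩ <;> rw [h]
  · linarith [Real.exp_pos (-c * y)]
  · rw [mul_neg, ← neg_mul]
    linarith [Real.exp_pos (c * y)]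

lemma integrable_exp_sum_abs (c : ℝ) :
    Integrable (fun y : ι → ℝ => Real.exp (c * ∑ i, |y i|)) (stdG ι) := by
  have := Integrable.fintype_prod (μ := fun _ : ι => gaussianReal 0 1)
    (f := fun _ y => Real.exp (c * |y|)) fun _ => integrable_exp_abs_gaussian c
  simpa only [← Real.exp_sum, ← Finset.mul_sum] using this

/-- Functions dominated by `C exp (C ∑ |yᵢ|)` are integrable. -/
lemma integrable_of_le_exp {f : (ι → ℝ) → ℝ} (hf : AEStronglyMeasurable f (stdG ι)) {C c : ℝ}
    (h : ∀ y, |f y| ≤ C * Real.exp (c * ∑ i, |y i|)) : Integrable f (stdG ι) :=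
  ((integrable_exp_sum_abs c).const_mul C).mono' hf (ae_of_all _ h)

lemma one_add_le_exp_sum (y : ι → ℝ) : 1 + ∑ i, |y i| ≤ Real.exp (1 * ∑ i, |y i|) := by
  rw [one_mul, add_comm]; exact Real.add_one_le_exp _

lemma integrable_of_le_linear {f : (ι → ℝ) → ℝ} (hf : AEStronglyMeasurable f (stdG ι)) {C : ℝ}
    (h : ∀ y, |f y| ≤ C * (1 + ∑ i, |y i|)) : Integrable f (stdG ι) := by
  have hC : 0 ≤ C := by
    have := (abs_nonneg _).trans (h 0)
    simpa using this
  exact integrable_of_le_exp hf fun y =>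
    (h y).trans (mul_le_mul_of_nonneg_left (one_add_le_exp_sum y) hC)

lemma integrable_one_add_sum_abs : Integrable (fun y : ι → ℝ => 1 + ∑ i, |y i|) (stdG ι) := by
  refine integrable_of_le_linear (C := 1)
    (by fun_prop : Continuous fun y : ι → ℝ => 1 + ∑ i, |y i|).aestronglyMeasurable fun y => ?_
  rw [one_mul, abs_of_nonneg]
  positivity

lemma integrable_of_bounded {α : Type*} [MeasurableSpace α] {μ : Measure α} [IsFiniteMeasure μ]
    {f : α → ℝ} (hf : AEStronglyMeasurable f μ) {C : ℝ} (h : ∀ y, |f y| ≤ C) : Integrable f μ :=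
  (integrable_const C).mono' hf (ae_of_all _ h)

/-- Gaussian integration by parts in one variable. -/
lemma integral_id_mul_gaussian {f f' : ℝ → ℝ} (hf : ∀ s, HasDerivAt f (f' s) s)
    (hi : Integrable f (gaussianReal 0 1)) (hi' : Integrable f' (gaussianReal 0 1))
    (him : Integrable (fun s => s * f s) (gaussianReal 0 1)) :
    ∫ s, s * f s ∂(gaussianReal 0 1) = ∫ s, f' s ∂(gaussianReal 0 1) := by
  have h1 : (1 : NNReal) ≠ 0 := one_ne_zero
  set φ := gaussianPDFReal 0 1 with hφ
  have hφd : ∀ s, HasDerivAt φ (-s * φ s) s := by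
    intro s
    have : φ = fun x => (√(2 * Real.pi))⁻¹ * Real.exp (-x ^ 2 / 2) := by
      ext x; simp [hφ, gaussianPDFReal]
    rw [this]
    have h := (((hasDerivAt_pow 2 s).neg.div_const 2).exp).const_mul (√(2 * Real.pi))⁻¹
    refine h.congr_deriv ?_
    simp only [Pi.neg_apply]
    push_cast; ring
  have key : ∀ g : ℝ → ℝ, Integrable g (gaussianReal 0 1) → Integrable (fun s => g s * φ s) := by
    intro g hg
    rw [gaussianReal_of_var_ne_zero _ h1] at hg
    rw [integrable_withDensity_iff (measurable_gaussianPDF 0 1)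
      (ae_of_all _ fun _ => ENNReal.ofReal_lt_top)] at hg
    refine hg.congr (ae_of_all _ fun s => ?_)
    simp [hφ]
  rw [integral_gaussianReal_eq_integral_smul h1, integral_gaussianReal_eq_integral_smul h1]
  have := integral_mul_deriv_eq_deriv_mul_of_integrable (u := f) (v := φ) (u' := f')
    (v' := fun s => -s * φ s) (fun s _ => hf s) (fun s _ => hφd s)
    ((key _ him).neg.congr (ae_of_all _ fun s => by simp; ring)) (key _ hi') (key _ hi)
  simp only [smul_eq_mul]
  rw [← hφ]
  have e1 : ∫ s, φ s * (s * f s) = - ∫ s, f s * (-s * φ s) := by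
    rw [← integral_neg]; congr 1; ext s; ring
  rw [e1, this, neg_neg]
  congr 1; ext s; ring

variable [DecidableEq ι]

/-- Resampling one coordinate does not change the law of a Gaussian vector. -/
lemma measurePreserving_update (i : ι) :
    MeasurePreserving (fun p : (ι → ℝ) × ℝ => Function.update p.1 i p.2)
      ((stdG ι).prod (gaussianReal 0 1)) (stdG ι) := by
  have hm : Measurable fun p : (ι → ℝ) × ℝ => Function.update p.1 i p.2 := by
    refine measurable_pi_iff.2 fun j => ?_
    by_cases h : j = i
    · subst h; simpa using measurable_snd
    · simp only [Function.update_of_ne h]; fun_prop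
  refine ⟨hm, (Measure.pi_eq fun s hs => ?_).symm⟩
  rw [Measure.map_apply hm (MeasurableSet.univ_pi hs)]
  have : (fun p : (ι → ℝ) × ℝ => Function.update p.1 i p.2) ⁻¹' (Set.univ.pi s)
      = (Set.univ.pi (Function.update s i Set.univ)) ×ˢ s i := by
    ext p
    simp only [Set.mem_preimage, Set.mem_pi, Set.mem_univ, true_implies, Set.mem_prod]
    constructor
    · refine fun h => ⟨fun j => ?_, by simpa using h i⟩
      by_cases hj : j = i
      · subst hj; simp
      · simpa [hj] using h j
    · rintro ⟨h, hi⟩ j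
      by_cases hj : j = i
      · subst hj; simpa using hi
      · simpa [hj] using h j
  rw [this, Measure.prod_prod, Measure.pi_pi, ← Finset.mul_prod_erase _ _ (Finset.mem_univ i),
    ← Finset.mul_prod_erase (s := Finset.univ) (a := i) (h := Finset.mem_univ i)
      (fun j => (gaussianReal 0 1) (s j))]
  simp only [Function.update_self, measure_univ, one_mul]
  rw [mul_comm]
  congr 1
  exact Finset.prod_congr rfl fun j hj => by rw [Function.update_of_ne (Finset.ne_of_mem_erase hj)]

/-- Gaussian integration by parts in one coordinate of a Gaussian vector. -/
lemma integral_coord_mul (i : ι) {f f' : (ι → ℝ) → ℝ}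
    (hf : ∀ y, HasDerivAt (fun s => f (Function.update y i s)) (f' y) (y i))
    (hi : Integrable f (stdG ι)) (hi' : Integrable f' (stdG ι))
    (him : Integrable (fun y => y i * f y) (stdG ι)) :
    ∫ y, y i * f y ∂(stdG ι) = ∫ y, f' y ∂(stdG ι) := by
  have hp := measurePreserving_update i
  have tr : ∀ g : (ι → ℝ) → ℝ, Integrable g (stdG ι) →
      Integrable (fun p : (ι → ℝ) × ℝ => g (Function.update p.1 i p.2))
        ((stdG ι).prod (gaussianReal 0 1)) ∧
      ∫ y, g y ∂(stdG ι) = ∫ y, ∫ s, g (Function.update y i s) ∂(gaussianReal 0 1) ∂(stdG ι) := by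
    intro g hg
    have hg' : Integrable (fun p : (ι → ℝ) × ℝ => g (Function.update p.1 i p.2))
        ((stdG ι).prod (gaussianReal 0 1)) := hp.integrable_comp_of_integrable hg
    refine ⟨hg', ?_⟩
    have h := integral_map (μ := (stdG ι).prod (gaussianReal 0 1)) hp.measurable.aemeasurable
      (f := g) (by rw [hp.map_eq]; exact hg.aestronglyMeasurable)
    rw [hp.map_eq] at h
    rw [h, integral_prod _ hg']
  obtain ⟨h1, -⟩ := tr _ hi
  obtain ⟨h2, e2⟩ := tr _ hi'
  obtain ⟨h3, e3⟩ := tr _ him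
  rw [e2, e3]
  refine integral_congr_ae ?_
  filter_upwards [h1.prod_right_ae, h2.prod_right_ae, h3.prod_right_ae] with y k1 k2 k3
  simp only [Function.update_self] at k3 ⊢
  refine integral_id_mul_gaussian (fun s => ?_) k1 k2 k3
  have := hf (Function.update y i s)
  simpa using this

end Gauss


/-! ### Averages tilted by a power of the partition function -/

section Tilted

variable {S κ : Type*} [Fintype κ]

/-- Random exponents that grow at most linearly in the Gaussian vector. -/
structure LinGrowth (C : ℝ) (x : (κ → ℝ) → S → ℝ) : Prop where
  measurable : Measurable x
  bound : ∀ y s, |x y s| ≤ C * (1 + ∑ k, |y k|)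

/-- A family of random exponents, differentiable in its parameter with derivative `x'`; near `u₀`
both have linear growth, uniformly in the parameter. -/
structure SmoothFamily (C u₀ : ℝ) (x x' : ℝ → (κ → ℝ) → S → ℝ) : Prop where
  hasDerivAt : ∀ u y s, HasDerivAt (fun v => x v y s) (x' u y s) u
  growth : ∀ u ∈ Metric.ball u₀ 1, LinGrowth C (x u)
  growth' : ∀ u ∈ Metric.ball u₀ 1, LinGrowth C (x' u)

lemma LinGrowth.nonneg [Nonempty S] {C : ℝ} {x : (κ → ℝ) → S → ℝ}
    (hx : LinGrowth C x) : 0 ≤ C := by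
  have := (abs_nonneg _).trans (hx.bound 0 (Classical.arbitrary S))
  simpa using this

lemma hasDerivAt_affine_update [DecidableEq κ] (p : S → ℝ) (b : κ → S → ℝ) (k : κ) (s : S)
    (y : κ → ℝ) (r : ℝ) :
    HasDerivAt (fun v => p s + ∑ j, b j s * Function.update y k v j) (b k s) r := by
  have h : (fun v => p s + ∑ j, b j s * Function.update y k v j)
      = fun v => (p s + ∑ j ∈ Finset.univ.erase k, b j s * y j) + b k s * v := by
    ext v
    rw [← Finset.add_sum_erase _ _ (Finset.mem_univ k)]
    have : ∑ j ∈ Finset.univ.erase k, b j s * Function.update y k v j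
        = ∑ j ∈ Finset.univ.erase k, b j s * y j :=
      Finset.sum_congr rfl fun j hj => by rw [Function.update_of_ne (Finset.ne_of_mem_erase hj)]
    rw [this]
    simp; ring
  rw [h]
  exact (((hasDerivAt_id r).const_mul (b k s)).congr_deriv (mul_one _)).const_add
    (p s + ∑ j ∈ Finset.univ.erase k, b j s * y j)

variable [Fintype S]

/-- The average over a Gaussian vector of the power `θ` of the partition function of the random
exponents `x`. -/
def avgPow (θ : ℝ) (x : (κ → ℝ) → S → ℝ) : ℝ := ∫ y, pf (x y) ^ θ ∂(stdG κ)

/-- The Gaussian average of `F` tilted by the normalised weight `pf x ^ θ / 𝔼 (pf x ^ θ)`. -/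
def tavg (θ : ℝ) (x : (κ → ℝ) → S → ℝ) (F : (κ → ℝ) → ℝ) : ℝ :=
  ∫ y, pf (x y) ^ θ / avgPow θ x * F y ∂(stdG κ)

lemma tavg_eq_div (θ : ℝ) (x : (κ → ℝ) → S → ℝ) (F : (κ → ℝ) → ℝ) :
    tavg θ x F = (∫ y, pf (x y) ^ θ * F y ∂(stdG κ)) / avgPow θ x := by
  rw [tavg, ← integral_div]
  congr 1; ext y; ring

lemma tavg_const_mul (θ : ℝ) (x : (κ → ℝ) → S → ℝ) (c : ℝ) (F : (κ → ℝ) → ℝ) :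
    tavg θ x (fun y => c * F y) = c * tavg θ x F := by
  simp only [tavg, ← integral_const_mul]
  congr 1; ext y; ring

variable {C θ : ℝ} {x : (κ → ℝ) → S → ℝ}

variable [Nonempty S]

lemma LinGrowth.abs_pf_rpow_mul_le (hx : LinGrowth C x) (h0 : 0 ≤ θ) (h1 : θ ≤ 1)
    {F : ℝ} {B : ℝ} {y : κ → ℝ} (hF : |F| ≤ B * (1 + ∑ k, |y k|)) :
    |pf (x y) ^ θ * F| ≤
      (Fintype.card S * Real.exp C * B) * Real.exp ((C + 1) * ∑ k, |y k|) := by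
  have hC := hx.nonneg
  have hs : 0 ≤ ∑ k, |y k| := by positivity
  have hB : 0 ≤ B := by
    have := (abs_nonneg _).trans hF
    by_contra h
    push Not at h
    nlinarith
  rw [abs_mul, abs_of_pos (Real.rpow_pos_of_pos (pf_pos _) _)]
  have e1 := pf_rpow_le h0 h1 (x y) (B := C * (1 + ∑ k, |y k|)) (by positivity)
    fun s => (le_abs_self _).trans (hx.bound y s)
  refine (mul_le_mul e1 (hF.trans (mul_le_mul_of_nonneg_left (one_add_le_exp_sum y) hB))
    (abs_nonneg _) (by positivity)).trans (le_of_eq ?_)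
  rw [show (C + 1) * ∑ k, |y k| = C * ∑ k, |y k| + 1 * ∑ k, |y k| by ring, Real.exp_add, mul_add,
    Real.exp_add, mul_one]
  ring

lemma LinGrowth.integrable (hx : LinGrowth C x) (h0 : 0 ≤ θ) (h1 : θ ≤ 1) {F : (κ → ℝ) → ℝ}
    (hF : Measurable F) {B : ℝ} (hFB : ∀ y, |F y| ≤ B * (1 + ∑ k, |y k|)) :
    Integrable (fun y => pf (x y) ^ θ * F y) (stdG κ) := by
  have := measurable_pf hx.measurable
  exact integrable_of_le_exp (by fun_prop) fun y => hx.abs_pf_rpow_mul_le h0 h1 (hFB y)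

lemma le_mul_one_add_sum {B : ℝ} (hB : 0 ≤ B) (y : κ → ℝ) : B ≤ B * (1 + ∑ k, |y k|) := by
  have : 0 ≤ ∑ k, |y k| := by positivity
  nlinarith

lemma LinGrowth.integrable_of_bounded (hx : LinGrowth C x) (h0 : 0 ≤ θ) (h1 : θ ≤ 1)
    {F : (κ → ℝ) → ℝ} (hF : Measurable F) {B : ℝ} (hFB : ∀ y, |F y| ≤ B) :
    Integrable (fun y => pf (x y) ^ θ * F y) (stdG κ) :=
  hx.integrable h0 h1 hF fun y =>
    (hFB y).trans (le_mul_one_add_sum ((abs_nonneg _).trans (hFB 0)) y)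

lemma LinGrowth.integrable_pf_rpow (hx : LinGrowth C x) (h0 : 0 ≤ θ) (h1 : θ ≤ 1) :
    Integrable (fun y => pf (x y) ^ θ) (stdG κ) := by
  simpa using hx.integrable_of_bounded h0 h1 (F := fun _ => 1) measurable_const (B := 1) (by simp)

lemma avgPow_pos (hx : LinGrowth C x) (h0 : 0 ≤ θ) (h1 : θ ≤ 1) : 0 < avgPow θ x := by
  have hpos : ∀ y, 0 < pf (x y) ^ θ := fun y => Real.rpow_pos_of_pos (pf_pos _) _
  rw [avgPow, integral_pos_iff_support_of_nonneg (fun y => (hpos y).le)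
    (hx.integrable_pf_rpow h0 h1)]
  have : Function.support (fun y => pf (x y) ^ θ) = Set.univ :=
    Set.eq_univ_of_forall fun y => (hpos y).ne'
  simp [this]

lemma tavg_const (hx : LinGrowth C x) (h0 : 0 ≤ θ) (h1 : θ ≤ 1) (c : ℝ) :
    tavg θ x (fun _ => c) = c := by
  rw [tavg_eq_div, integral_mul_const, div_eq_iff (avgPow_pos hx h0 h1).ne', mul_comm]
  rfl

lemma tavg_add (hx : LinGrowth C x) (h0 : 0 ≤ θ) (h1 : θ ≤ 1) {F G : (κ → ℝ) → ℝ}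
    (hF : Measurable F) {B : ℝ} (hFB : ∀ y, |F y| ≤ B * (1 + ∑ k, |y k|))
    (hG : Measurable G) {B' : ℝ} (hGB : ∀ y, |G y| ≤ B' * (1 + ∑ k, |y k|)) :
    tavg θ x (fun y => F y + G y) = tavg θ x F + tavg θ x G := by
  simp only [tavg_eq_div, mul_add]
  rw [integral_add (hx.integrable h0 h1 hF hFB) (hx.integrable h0 h1 hG hGB), add_div]

lemma tavg_sum {ι : Type*} (I : Finset ι) (hx : LinGrowth C x) (h0 : 0 ≤ θ) (h1 : θ ≤ 1)
    {F : ι → (κ → ℝ) → ℝ} (hF : ∀ i, Measurable (F i)) {B : ℝ}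
    (hFB : ∀ i y, |F i y| ≤ B * (1 + ∑ k, |y k|)) :
    tavg θ x (fun y => ∑ i ∈ I, F i y) = ∑ i ∈ I, tavg θ x (F i) := by
  simp only [tavg_eq_div, Finset.mul_sum]
  rw [integral_finsetSum _ fun i _ => hx.integrable h0 h1 (hF i) (hFB i), Finset.sum_div]

lemma tavg_nonneg (hx : LinGrowth C x) (h0 : 0 ≤ θ) (h1 : θ ≤ 1) {F : (κ → ℝ) → ℝ}
    (hF : ∀ y, 0 ≤ F y) : 0 ≤ tavg θ x F :=
  integral_nonneg fun y => mul_nonneg (div_nonneg (Real.rpow_pos_of_pos (pf_pos _) _).le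
    (avgPow_pos hx h0 h1).le) (hF y)

/-! ### Differentiation of tilted averages -/

variable {u₀ : ℝ} {x x' : ℝ → (κ → ℝ) → S → ℝ}

lemma SmoothFamily.hasDerivAt_integral (h : SmoothFamily C u₀ x x') (h0 : 0 ≤ θ) (h1 : θ ≤ 1)
    (f : S → ℝ) :
    HasDerivAt (fun u => ∫ y, pf (x u y) ^ θ * gav (x u y) f ∂(stdG κ))
      (∫ y, pf (x u₀ y) ^ θ * (gav (x u₀ y) (fun s => f s * x' u₀ y s)
        - (1 - θ) * (gav (x u₀ y) f * gav (x u₀ y) (x' u₀ y))) ∂(stdG κ)) u₀ := by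
  have hmem : u₀ ∈ Metric.ball u₀ 1 := Metric.mem_ball_self one_pos
  have hnhd : Metric.ball u₀ 1 ∈ 𝓝 u₀ := Metric.ball_mem_nhds _ one_pos
  set B := ∑ s, |f s| with hB
  have hfB : ∀ s, |f s| ≤ B := fun s =>
    Finset.single_le_sum (f := fun s => |f s|) (fun _ _ => abs_nonneg _) (Finset.mem_univ s)
  have hB0 : 0 ≤ B := Finset.sum_nonneg fun _ _ => abs_nonneg _
  have hm0 := (h.growth u₀ hmem).measurable
  have hm0' := (h.growth' u₀ hmem).measurable
  refine (hasDerivAt_integral_of_dominated_loc_of_deriv_le (μ := stdG κ) (s := Metric.ball u₀ 1)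
    (bound := fun y => (Fintype.card S * Real.exp C * (2 * B * C)) *
      Real.exp ((C + 1) * ∑ k, |y k|)) (F' := fun u y => pf (x u y) ^ θ *
        (gav (x u y) (fun s => f s * x' u y s)
          - (1 - θ) * (gav (x u y) f * gav (x u y) (x' u y))))
    hnhd ?_ ?_ ?_ ?_ ?_ ?_).2
  · filter_upwards [hnhd] with u hu
    have := measurable_pf (h.growth u hu).measurable
    have := measurable_gav (h.growth u hu).measurable (f := fun _ => f) measurable_const
    fun_prop
  · exact (h.growth u₀ hmem).integrable_of_bounded h0 h1
      (measurable_gav hm0 measurable_const) fun y => abs_gav_le _ hfB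
  · have := measurable_pf hm0
    have := measurable_gav hm0 (f := fun _ => f) measurable_const
    have := measurable_gav hm0 hm0'
    have := measurable_gav hm0 (f := fun y s => f s * x' u₀ y s) (by fun_prop)
    fun_prop
  · refine ae_of_all _ fun y u hu => ?_
    refine (h.growth u hu).abs_pf_rpow_mul_le h0 h1 ?_
    set E := 1 + ∑ k, |y k|
    have hE : 0 ≤ E := by positivity
    have hx' := (h.growth' u hu).bound y
    have b1 : |gav (x u y) (fun s => f s * x' u y s)| ≤ B * (C * E) :=
      abs_gav_le _ fun s => by
        rw [abs_mul]; exact mul_le_mul (hfB s) (hx' s) (abs_nonneg _) hB0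
    have b2 : |(1 - θ) * (gav (x u y) f * gav (x u y) (x' u y))| ≤ 1 * (B * (C * E)) := by
      rw [abs_mul, abs_mul]
      have hC := (h.growth u hu).nonneg
      refine mul_le_mul (by rw [abs_of_nonneg] <;> linarith) ?_ (by positivity) zero_le_one
      exact mul_le_mul (abs_gav_le _ hfB) (abs_gav_le _ hx') (abs_nonneg _) hB0
    calc _ ≤ _ := abs_sub _ _
      _ ≤ B * (C * E) + 1 * (B * (C * E)) := add_le_add b1 b2
      _ = 2 * B * C * E := by ring
  · exact (integrable_exp_sum_abs _).const_mul _
  · exact ae_of_all _ fun y u _ => hasDerivAt_pf_rpow_mul_gav (h.hasDerivAt u y) θ f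

lemma SmoothFamily.hasDerivAt_avgPow (h : SmoothFamily C u₀ x x') (h0 : 0 ≤ θ) (h1 : θ ≤ 1) :
    HasDerivAt (fun u => avgPow θ (x u))
      (θ * ∫ y, pf (x u₀ y) ^ θ * gav (x u₀ y) (x' u₀ y) ∂(stdG κ)) u₀ := by
  have := h.hasDerivAt_integral h0 h1 (fun _ => 1)
  simp only [gav_const, mul_one, one_mul] at this
  refine this.congr_deriv ?_
  rw [← integral_const_mul]
  congr 1; ext y; ring

lemma SmoothFamily.hasDerivAt_log_avgPow (h : SmoothFamily C u₀ x x') (h0 : 0 ≤ θ)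
    (h1 : θ ≤ 1) :
    HasDerivAt (fun u => Real.log (avgPow θ (x u)))
      (θ * tavg θ (x u₀) fun y => gav (x u₀ y) (x' u₀ y)) u₀ := by
  have hV := avgPow_pos (h.growth u₀ (Metric.mem_ball_self one_pos)) h0 h1
  refine ((h.hasDerivAt_avgPow h0 h1).log hV.ne').congr_deriv ?_
  rw [tavg_eq_div, mul_div_assoc]

lemma SmoothFamily.hasDerivAt_tavg_gav (h : SmoothFamily C u₀ x x') (h0 : 0 ≤ θ)
    (h1 : θ ≤ 1) (f : S → ℝ) :
    HasDerivAt (fun u => tavg θ (x u) fun y => gav (x u y) f)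
      ((tavg θ (x u₀) fun y => gav (x u₀ y) (fun s => f s * x' u₀ y s)
          - (1 - θ) * (gav (x u₀ y) f * gav (x u₀ y) (x' u₀ y)))
        - θ * ((tavg θ (x u₀) fun y => gav (x u₀ y) f)
            * tavg θ (x u₀) fun y => gav (x u₀ y) (x' u₀ y))) u₀ := by
  have hV := avgPow_pos (h.growth u₀ (Metric.mem_ball_self one_pos)) h0 h1
  have := (h.hasDerivAt_integral h0 h1 f).div (h.hasDerivAt_avgPow h0 h1) hV.ne'
  simp only [tavg_eq_div]
  refine this.congr_deriv ?_
  have := hV.ne'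
  field_simp

/-! ### Integration by parts in the tilting field -/

variable [DecidableEq κ]

/-- Gaussian integration by parts for a tilted Gibbs average whose exponents are affine in the
Gaussian vector. -/
lemma tavg_coord_mul_gav {C : ℝ} {p : S → ℝ} {b : κ → S → ℝ}
    (hx : LinGrowth C fun y s => p s + ∑ k, b k s * y k) (h0 : 0 ≤ θ) (h1 : θ ≤ 1)
    (k : κ) (f : S → ℝ) :
    (tavg θ (fun y s => p s + ∑ k, b k s * y k) fun y =>
        y k * gav (fun s => p s + ∑ k, b k s * y k) f)
      = tavg θ (fun y s => p s + ∑ k, b k s * y k) fun y =>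
        gav (fun s => p s + ∑ k, b k s * y k) (fun s => f s * b k s)
          - (1 - θ) * (gav (fun s => p s + ∑ k, b k s * y k) f
            * gav (fun s => p s + ∑ k, b k s * y k) (b k)) := by
  rw [tavg_eq_div, tavg_eq_div]
  congr 1
  set X : (κ → ℝ) → S → ℝ := fun y s => p s + ∑ k, b k s * y k with hX
  set B := ∑ s, |f s| with hB
  have hfB : ∀ s, |f s| ≤ B := fun s =>
    Finset.single_le_sum (f := fun s => |f s|) (fun _ _ => abs_nonneg _) (Finset.mem_univ s)
  have hB0 : 0 ≤ B := Finset.sum_nonneg fun _ _ => abs_nonneg _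
  set B' := ∑ s, |b k s| with hB'
  have hbB : ∀ s, |b k s| ≤ B' := fun s =>
    Finset.single_le_sum (f := fun s => |b k s|) (fun _ _ => abs_nonneg _) (Finset.mem_univ s)
  have hmf := measurable_gav hx.measurable (f := fun _ => f) measurable_const
  have hmb := measurable_gav hx.measurable (f := fun _ => b k) measurable_const
  have hmfb := measurable_gav hx.measurable (f := fun _ s => f s * b k s) measurable_const
  have key := integral_coord_mul (ι := κ) k (f := fun y => pf (X y) ^ θ * gav (X y) f)
    (f' := fun y => pf (X y) ^ θ * (gav (X y) (fun s => f s * b k s)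
      - (1 - θ) * (gav (X y) f * gav (X y) (b k)))) ?_ ?_ ?_ ?_
  · rw [← key]
    congr 1; ext y; simp only [hX]; ring
  · intro y
    have := hasDerivAt_pf_rpow_mul_gav (x := fun v => X (Function.update y k v)) (x' := b k)
      (u := y k) (fun s => hasDerivAt_affine_update p b k s y (y k)) θ f
    simpa using this
  · exact hx.integrable_of_bounded h0 h1 hmf fun y => abs_gav_le _ hfB
  · refine hx.integrable_of_bounded h0 h1 (hmfb.sub ((hmf.mul hmb).const_mul _))
      (B := B * B' + |1 - θ| * (B * B')) fun y => ?_
    refine (abs_sub _ _).trans (add_le_add ?_ ?_)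
    · exact abs_gav_le _ fun s => by
        rw [abs_mul]; exact mul_le_mul (hfB s) (hbB s) (abs_nonneg _) hB0
    · rw [abs_mul, abs_mul]
      exact mul_le_mul_of_nonneg_left (mul_le_mul (abs_gav_le _ hfB) (abs_gav_le _ hbB)
        (abs_nonneg _) hB0) (abs_nonneg _)
  · have := hx.integrable h0 h1 (F := fun y => y k * gav (X y) f)
      ((measurable_pi_apply k).mul hmf) (B := B) fun y => by
        rw [abs_mul, mul_comm]
        refine mul_le_mul (abs_gav_le _ hfB) ?_ (abs_nonneg _) hB0
        have := Finset.single_le_sum (f := fun k => |y k|) (fun _ _ => abs_nonneg _)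
          (Finset.mem_univ k)
        linarith
    refine this.congr (ae_of_all _ fun y => ?_)
    simp only; ring

end Tilted


/-! ### Replica averages over an outer Gaussian field -/

section Outer

variable {S ι κ : Type*} [Fintype S] [Fintype ι] [Fintype κ]

/-- Random exponents, jointly measurable in an outer field `w` and an inner field `y`, and of linear
growth in the inner one. -/
structure Regular (X : (ι → ℝ) → (κ → ℝ) → S → ℝ) : Prop where
  measurable : Measurable fun q : (ι → ℝ) × (κ → ℝ) => X q.1 q.2
  growth : ∀ w, ∃ C, LinGrowth C (X w)

/-- The observable `Q` of two replicas that share the outer field only. -/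
def tpair (θ : ℝ) (x : (κ → ℝ) → S → ℝ) (Q : S → S → ℝ) : ℝ :=
  ∑ s, ∑ t, (tavg θ x fun y => Real.exp (x y s) / pf (x y)) *
    (tavg θ x fun y => Real.exp (x y t) / pf (x y)) * Q s t

/-- The average of an observable of one replica. -/
def rep (θ : ℝ) (X : (ι → ℝ) → (κ → ℝ) → S → ℝ) (f : S → ℝ) : ℝ :=
  ∫ w, tavg θ (X w) (fun y => gav (X w y) f) ∂(stdG ι)

/-- The average of an observable of two replicas that share the outer field only. -/
def rep₁ (θ : ℝ) (X : (ι → ℝ) → (κ → ℝ) → S → ℝ) (Q : S → S → ℝ) : ℝ :=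
  ∫ w, tpair θ (X w) Q ∂(stdG ι)

/-- The average of an observable of two replicas that share both Gaussian fields. -/
def rep₂ (θ : ℝ) (X : (ι → ℝ) → (κ → ℝ) → S → ℝ) (Q : S → S → ℝ) : ℝ :=
  ∫ w, tavg θ (X w) (fun y => gav2 (X w y) Q) ∂(stdG ι)

/-- A positive, normalised linear functional. -/
structure IsAverage {T : Type*} (Φ : (T → ℝ) → ℝ) : Prop where
  map_add : ∀ f h, Φ (fun s => f s + h s) = Φ f + Φ h
  map_const_mul : ∀ (c : ℝ) f, Φ (fun s => c * f s) = c * Φ f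
  nonneg : ∀ f, (∀ s, 0 ≤ f s) → 0 ≤ Φ f
  map_one : Φ (fun _ => 1) = 1

namespace IsAverage

variable {T : Type*} {Φ : (T → ℝ) → ℝ}

lemma map_sub (h : IsAverage Φ) (f k : T → ℝ) : Φ (fun s => f s - k s) = Φ f - Φ k := by
  have := h.map_add f (fun s => (-1) * k s)
  rw [h.map_const_mul] at this
  simpa [sub_eq_add_neg] using this

lemma map_sum (h : IsAverage Φ) {α : Type*} (I : Finset α) (f : α → T → ℝ) :
    Φ (fun s => ∑ i ∈ I, f i s) = ∑ i ∈ I, Φ (f i) := by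
  classical
  induction I using Finset.induction_on with
  | empty => simpa using h.map_const_mul 0 (fun _ => 0)
  | insert a I ha ih => simp only [Finset.sum_insert ha, h.map_add, ih]

lemma map_const (h : IsAverage Φ) (c : ℝ) : Φ (fun _ => c) = c := by
  simpa [h.map_one] using h.map_const_mul c (fun _ => 1)

lemma mono (h : IsAverage Φ) {f k : T → ℝ} (hfk : ∀ s, f s ≤ k s) : Φ f ≤ Φ k := by
  have := h.nonneg (fun s => k s - f s) fun s => sub_nonneg.2 (hfk s)
  rw [h.map_sub] at this
  linarith

lemma abs_le (h : IsAverage Φ) {f : T → ℝ} {B : ℝ} (hf : ∀ s, |f s| ≤ B) : |Φ f| ≤ B := by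
  rw [_root_.abs_le]
  constructor
  · simpa [h.map_const] using h.mono (f := fun _ => -B) fun s => (_root_.abs_le.1 (hf s)).1
  · simpa [h.map_const] using h.mono (k := fun _ => B) fun s => (_root_.abs_le.1 (hf s)).2

/-- Averages of averages are averages. -/
lemma weighted_sum {α : Type*} (I : Finset α) {c : α → ℝ} (hc : ∀ i, 0 ≤ c i)
    (hc1 : ∑ i ∈ I, c i = 1) {Ψ : α → (T → ℝ) → ℝ} (h : ∀ i, IsAverage (Ψ i)) :
    IsAverage fun f => ∑ i ∈ I, c i * Ψ i f where
  map_add f k := by simp only [(h _).map_add, mul_add, Finset.sum_add_distrib]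
  map_const_mul a f := by
    simp only [(h _).map_const_mul, Finset.mul_sum]
    exact Finset.sum_congr rfl fun i _ => by ring
  nonneg f hf := Finset.sum_nonneg fun i _ => mul_nonneg (hc i) ((h i).nonneg f hf)
  map_one := by simp [(h _).map_one, hc1]

/-- Averages over a probability space of uniformly bounded averages are averages. -/
lemma integral {Ω : Type*} [MeasurableSpace Ω] {μ : Measure Ω} [IsProbabilityMeasure μ]
    {Ψ : Ω → (T → ℝ) → ℝ} [Finite T] (h : ∀ ω, IsAverage (Ψ ω))
    (hm : ∀ f, Measurable fun ω => Ψ ω f) :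
    IsAverage fun f => ∫ ω, Ψ ω f ∂μ := by
  have := Fintype.ofFinite T
  have hi : ∀ f, Integrable (fun ω => Ψ ω f) μ := fun f =>
    integrable_of_bounded (hm f).aestronglyMeasurable (C := ∑ s, |f s|) fun ω =>
      (h ω).abs_le fun s => Finset.single_le_sum (f := fun s => |f s|)
        (fun _ _ => abs_nonneg _) (Finset.mem_univ s)
  refine ⟨fun f k => ?_, fun c f => ?_, fun f hf => integral_nonneg fun ω => (h ω).nonneg f hf, ?_⟩
  · simp only [(h _).map_add]
    exact integral_add (hi f) (hi k)
  · simp only [(h _).map_const_mul]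
    exact integral_const_mul _ _
  · simp [(h _).map_one]

end IsAverage

section Measurability

variable {ι : Type*} {θ : ℝ} {X : (ι → ℝ) → (κ → ℝ) → S → ℝ}

lemma measurable_exp_div_pf {Ω : Type*} [MeasurableSpace Ω] {x : Ω → S → ℝ} (hx : Measurable x)
    (s : S) : Measurable fun ω => Real.exp (x ω s) / pf (x ω) := by
  have := measurable_pf hx
  fun_prop

lemma Regular.measurable_avgPow (hX : Regular X) : Measurable fun w => avgPow θ (X w) := by
  have hp := measurable_pf hX.measurable
  exact (StronglyMeasurable.integral_prod_right' (ν := stdG κ)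
      (f := fun q : (ι → ℝ) × (κ → ℝ) => pf (X q.1 q.2) ^ θ)
      (by fun_prop : Measurable _).stronglyMeasurable).measurable

lemma Regular.measurable_tavg (hX : Regular X) {G : (ι → ℝ) → (κ → ℝ) → ℝ}
    (hG : Measurable fun q : (ι → ℝ) × (κ → ℝ) => G q.1 q.2) :
    Measurable fun w => tavg θ (X w) (G w) := by
  have hp := measurable_pf hX.measurable
  have h : Measurable fun w => ∫ y, pf (X w y) ^ θ * G w y ∂(stdG κ) :=
    (StronglyMeasurable.integral_prod_right' (ν := stdG κ)
      (f := fun q : (ι → ℝ) × (κ → ℝ) => pf (X q.1 q.2) ^ θ * G q.1 q.2)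
      (by fun_prop : Measurable _).stronglyMeasurable).measurable
  simp only [tavg_eq_div]
  exact h.div hX.measurable_avgPow

lemma Regular.measurable_gav (hX : Regular X) (f : S → ℝ) :
    Measurable fun q : (ι → ℝ) × (κ → ℝ) => gav (X q.1 q.2) f :=
  UnsupDAM.measurable_gav hX.measurable measurable_const

lemma Regular.measurable_tpair (hX : Regular X) (Q : S → S → ℝ) :
    Measurable fun w => tpair θ (X w) Q := by
  have : ∀ s, Measurable fun w => tavg θ (X w) fun y => Real.exp (X w y s) / pf (X w y) :=
    fun s => hX.measurable_tavg (measurable_exp_div_pf hX.measurable s)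
  unfold tpair
  fun_prop

end Measurability

variable [Nonempty S]

lemma exp_div_pf_nonneg (x : S → ℝ) (s : S) : 0 ≤ Real.exp (x s) / pf x :=
  div_nonneg (Real.exp_pos _).le (pf_pos x).le

lemma abs_exp_div_pf_le (x : S → ℝ) (s : S) : |Real.exp (x s) / pf x| ≤ 1 := by
  rw [abs_of_nonneg (exp_div_pf_nonneg x s), div_le_one (pf_pos x)]
  exact exp_le_pf x s

lemma abs_le_sum_abs {T : Type*} [Fintype T] (f : T → ℝ) (s : T) : |f s| ≤ ∑ s, |f s| :=
  Finset.single_le_sum (f := fun s => |f s|) (fun _ _ => abs_nonneg _) (Finset.mem_univ s)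

section Inner

variable {θ C : ℝ} {x : (κ → ℝ) → S → ℝ}

lemma tavg_gav (hx : LinGrowth C x) (h0 : 0 ≤ θ) (h1 : θ ≤ 1) (f : S → ℝ) :
    tavg θ x (fun y => gav (x y) f)
      = ∑ s, (tavg θ x fun y => Real.exp (x y s) / pf (x y)) * f s := by
  simp only [gav]
  rw [tavg_sum Finset.univ hx h0 h1 (B := ∑ s, |f s|)
    (fun s => (measurable_exp_div_pf hx.measurable s).mul_const _)]
  · refine Finset.sum_congr rfl fun s _ => ?_
    rw [mul_comm, ← tavg_const_mul]
    congr 1; ext y; ring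
  · intro s y
    refine le_trans ?_ (le_mul_one_add_sum (Finset.sum_nonneg fun s _ => abs_nonneg (f s)) y)
    rw [abs_mul]
    exact (mul_le_of_le_one_left (abs_nonneg _) (abs_exp_div_pf_le _ s)).trans (abs_le_sum_abs f s)

lemma tpair_mul (hx : LinGrowth C x) (h0 : 0 ≤ θ) (h1 : θ ≤ 1) (f h : S → ℝ) :
    tpair θ x (fun s t => f s * h t)
      = tavg θ x (fun y => gav (x y) f) * tavg θ x (fun y => gav (x y) h) := by
  rw [tavg_gav hx h0 h1, tavg_gav hx h0 h1, Finset.sum_mul_sum]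
  exact Finset.sum_congr rfl fun s _ => Finset.sum_congr rfl fun t _ => by ring

lemma isAverage_tavg_gav (hx : LinGrowth C x) (h0 : 0 ≤ θ) (h1 : θ ≤ 1) :
    IsAverage fun f : S → ℝ => tavg θ x fun y => gav (x y) f where
  map_add f k := by
    simp only [tavg_gav hx h0 h1, mul_add, Finset.sum_add_distrib]
  map_const_mul c f := by simp only [gav_const_mul, tavg_const_mul]
  nonneg f hf := tavg_nonneg hx h0 h1 fun y => Finset.sum_nonneg fun s _ =>
    mul_nonneg (exp_div_pf_nonneg _ s) (hf s)
  map_one := by simp only [gav_const, tavg_const hx h0 h1]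

lemma isAverage_tavg_gav2 (hx : LinGrowth C x) (h0 : 0 ≤ θ) (h1 : θ ≤ 1) :
    IsAverage fun Q : S × S → ℝ => tavg θ x fun y => gav2 (x y) fun s t => Q (s, t) where
  map_add f k := by
    have hb : ∀ Q : S × S → ℝ, ∀ y, |gav2 (x y) fun s t => Q (s, t)|
        ≤ (∑ p, |Q p|) * (1 + ∑ k, |y k|) := fun Q y =>
      (abs_gav2_le _ fun s t => abs_le_sum_abs Q (s, t)).trans
        (le_mul_one_add_sum (Finset.sum_nonneg fun _ _ => abs_nonneg _) y)
    rw [← tavg_add hx h0 h1 (measurable_gav2 hx.measurable _) (hb f)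
      (measurable_gav2 hx.measurable _) (hb k)]
    simp only [gav2, mul_add, Finset.sum_add_distrib]
  map_const_mul c f := by
    rw [← tavg_const_mul]
    simp only [gav2, Finset.mul_sum]
    congr 1; ext y
    exact Finset.sum_congr rfl fun s _ => Finset.sum_congr rfl fun t _ => by ring
  nonneg f hf := tavg_nonneg hx h0 h1 fun y => Finset.sum_nonneg fun s _ =>
    Finset.sum_nonneg fun t _ => mul_nonneg (mul_nonneg (exp_div_pf_nonneg _ s)
      (exp_div_pf_nonneg _ t)) (hf (s, t))
  map_one := by
    have := gav2_mul (S := S) (f := fun _ => 1) (h := fun _ => 1)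
    simp only [mul_one] at this
    simp only [this, gav_const, mul_one, tavg_const hx h0 h1]

lemma isAverage_tpair (hx : LinGrowth C x) (h0 : 0 ≤ θ) (h1 : θ ≤ 1) :
    IsAverage fun Q : S × S → ℝ => tpair θ x fun s t => Q (s, t) where
  map_add f k := by simp only [tpair, mul_add, Finset.sum_add_distrib]
  map_const_mul c f := by
    simp only [tpair, Finset.mul_sum]
    exact Finset.sum_congr rfl fun s _ => Finset.sum_congr rfl fun t _ => by ring
  nonneg f hf := by
    have : ∀ s, 0 ≤ tavg θ x fun y => Real.exp (x y s) / pf (x y) := fun s =>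
      tavg_nonneg hx h0 h1 fun y => exp_div_pf_nonneg _ s
    exact Finset.sum_nonneg fun s _ => Finset.sum_nonneg fun t _ =>
      mul_nonneg (mul_nonneg (this s) (this t)) (hf _)
  map_one := by
    have := tpair_mul hx h0 h1 (fun _ => 1) (fun _ => 1)
    simpa only [mul_one, gav_const, tavg_const hx h0 h1] using this

lemma tavg_gav_sub (hx : LinGrowth C x) (h0 : 0 ≤ θ) (h1 : θ ≤ 1) (c : ℝ) (f g h : S → ℝ) :
    (tavg θ x fun y => gav (x y) f - c * (gav (x y) g * gav (x y) h))
      = (tavg θ x fun y => gav (x y) f)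
        - c * tavg θ x fun y => gav2 (x y) fun s t => g s * h t := by
  have hm : ∀ f, Measurable fun y => gav (x y) f := fun f =>
    measurable_gav hx.measurable measurable_const
  have hb : ∀ f y, |gav (x y) f| ≤ ∑ s, |f s| := fun f y =>
    abs_gav_le _ fun s => abs_le_sum_abs f s
  have := tavg_add hx h0 h1 (hm f)
    (fun y => (hb f y).trans (le_mul_one_add_sum (by positivity) y))
    (G := fun y => -c * (gav (x y) g * gav (x y) h)) (((hm g).mul (hm h)).const_mul _)
    (B' := |-c| * ((∑ s, |g s|) * ∑ s, |h s|)) fun y => by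
      refine le_trans ?_ (le_mul_one_add_sum (by positivity) y)
      rw [abs_mul, abs_mul]
      exact mul_le_mul_of_nonneg_left (mul_le_mul (hb g y) (hb h y) (abs_nonneg _)
        (by positivity)) (abs_nonneg _)
  rw [tavg_const_mul] at this
  simp only [gav2_mul]
  rw [sub_eq_add_neg, ← neg_mul c, ← this]
  congr 1; ext y; ring

end Inner

section Field

variable {θ : ℝ} {X : (ι → ℝ) → (κ → ℝ) → S → ℝ}

lemma isAverage_rep (hX : Regular X) (h0 : 0 ≤ θ) (h1 : θ ≤ 1) : IsAverage (rep θ X) :=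
  IsAverage.integral (fun w => isAverage_tavg_gav (hX.growth w).choose_spec h0 h1)
    fun f => hX.measurable_tavg (hX.measurable_gav f)

lemma isAverage_rep₂ (hX : Regular X) (h0 : 0 ≤ θ) (h1 : θ ≤ 1) :
    IsAverage fun Q : S × S → ℝ => rep₂ θ X fun s t => Q (s, t) :=
  IsAverage.integral (fun w => isAverage_tavg_gav2 (hX.growth w).choose_spec h0 h1)
    fun _ => hX.measurable_tavg (measurable_gav2 hX.measurable _)

lemma isAverage_rep₁ (hX : Regular X) (h0 : 0 ≤ θ) (h1 : θ ≤ 1) :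
    IsAverage fun Q : S × S → ℝ => rep₁ θ X fun s t => Q (s, t) :=
  IsAverage.integral (fun w => isAverage_tpair (hX.growth w).choose_spec h0 h1)
    fun _ => hX.measurable_tpair _

end Field

end Outer

/-! ### Interpolation between affine Gaussian exponents -/

section Affine

variable {S ι κ : Type*} [Fintype ι] [Fintype κ]

/-- Exponents that are affine in the outer field `w` and in the inner field `y`. -/
def expo (p : S → ℝ) (a : ι → S → ℝ) (b : κ → S → ℝ) (w : ι → ℝ) (y : κ → ℝ) (s : S) : ℝ :=
  (p s + ∑ i, a i s * w i) + ∑ k, b k s * y k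

variable {p : S → ℝ} {a : ι → S → ℝ} {b : κ → S → ℝ} {C : ℝ}

lemma abs_expo_le (hp : ∀ s, |p s| ≤ C) (ha : ∀ i s, |a i s| ≤ C)
    (hb : ∀ k s, |b k s| ≤ C) (w : ι → ℝ) (y : κ → ℝ) (s : S) :
    |expo p a b w y s| ≤ C * (1 + ∑ i, |w i|) + C * ∑ k, |y k| := by
  have h1 : |∑ i, a i s * w i| ≤ C * ∑ i, |w i| := by
    rw [Finset.mul_sum]
    refine (Finset.abs_sum_le_sum_abs _ _).trans (Finset.sum_le_sum fun i _ => ?_)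
    rw [abs_mul]; exact mul_le_mul_of_nonneg_right (ha i s) (abs_nonneg _)
  have h2 : |∑ k, b k s * y k| ≤ C * ∑ k, |y k| := by
    rw [Finset.mul_sum]
    refine (Finset.abs_sum_le_sum_abs _ _).trans (Finset.sum_le_sum fun i _ => ?_)
    rw [abs_mul]; exact mul_le_mul_of_nonneg_right (hb i s) (abs_nonneg _)
  have h3 := hp s
  have h4 := abs_add_le (p s + ∑ i, a i s * w i) (∑ k, b k s * y k)
  have h5 := abs_add_le (p s) (∑ i, a i s * w i)
  unfold expo
  linarith

lemma linGrowth_expo (hC : 0 ≤ C) (hp : ∀ s, |p s| ≤ C) (ha : ∀ i s, |a i s| ≤ C)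
    (hb : ∀ k s, |b k s| ≤ C) (w : ι → ℝ) {D : ℝ} (hD : 1 + ∑ i, |w i| ≤ D) :
    LinGrowth (C * D) (expo p a b w) := by
  refine ⟨by unfold expo; fun_prop, fun y s => (abs_expo_le hp ha hb w y s).trans ?_⟩
  have e1 : 0 ≤ ∑ i, |w i| := by positivity
  have e2 : 0 ≤ ∑ k, |y k| := by positivity
  have e3 : C * (1 + ∑ i, |w i|) ≤ C * D := mul_le_mul_of_nonneg_left hD hC
  have e4 : C * ∑ k, |y k| ≤ C * D * ∑ k, |y k| := by
    refine mul_le_mul_of_nonneg_right ?_ e2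
    nlinarith
  linarith [mul_add (C * D) 1 (∑ k, |y k|), mul_one (C * D)]

lemma exists_coeff_bound [Finite S] (p : S → ℝ) (a : ι → S → ℝ) (b : κ → S → ℝ) :
    ∃ C, 0 ≤ C ∧ (∀ s, |p s| ≤ C) ∧ (∀ i s, |a i s| ≤ C) ∧ ∀ k s, |b k s| ≤ C := by
  have := Fintype.ofFinite S
  have e1 : 0 ≤ ∑ s, |p s| := by positivity
  have e2 : 0 ≤ ∑ i, ∑ s, |a i s| := by positivity
  have e3 : 0 ≤ ∑ k, ∑ s, |b k s| := by positivity
  refine ⟨∑ s, |p s| + ∑ i, ∑ s, |a i s| + ∑ k, ∑ s, |b k s|, by positivity, fun s => ?_,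
    fun i s => ?_, fun k s => ?_⟩
  · linarith [abs_le_sum_abs p s]
  · have h1 := abs_le_sum_abs (a i) s
    have h2 := Finset.single_le_sum (f := fun i => ∑ s, |a i s|) (fun _ _ => by positivity)
      (Finset.mem_univ i)
    linarith
  · have h1 := abs_le_sum_abs (b k) s
    have h2 := Finset.single_le_sum (f := fun i => ∑ s, |b i s|) (fun _ _ => by positivity)
      (Finset.mem_univ k)
    linarith

lemma regular_expo [Finite S] (p : S → ℝ) (a : ι → S → ℝ) (b : κ → S → ℝ) :
    Regular (expo p a b) := by
  obtain ⟨C, hC, hp, ha, hb⟩ := exists_coeff_bound p a b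
  exact ⟨by unfold expo; fun_prop, fun w => ⟨_, linGrowth_expo hC hp ha hb w le_rfl⟩⟩

lemma smoothFamily_expo_update [DecidableEq ι] (hC : 0 ≤ C) (hp : ∀ s, |p s| ≤ C)
    (ha : ∀ i s, |a i s| ≤ C) (hb : ∀ k s, |b k s| ≤ C) (w : ι → ℝ) (i : ι) :
    SmoothFamily (C * (2 + ∑ j, |w j| + |w i|)) (w i)
      (fun u => expo p a b (Function.update w i u)) (fun _ _ => a i) where
  hasDerivAt u y s := by
    unfold expo
    exact (hasDerivAt_affine_update p a i s w u).add_const _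
  growth u hu := by
    refine linGrowth_expo hC hp ha hb _ ?_
    have h1 : |u| ≤ |w i| + 1 := by
      have h := (Metric.mem_ball.1 hu).le
      rw [Real.dist_eq] at h
      linarith [abs_sub_abs_le_abs_sub u (w i)]
    have h2 : ∑ j, |Function.update w i u j| ≤ ∑ j, |w j| + |u| := by
      rw [← Finset.add_sum_erase _ _ (Finset.mem_univ i),
        ← Finset.add_sum_erase (a := i) (h := Finset.mem_univ i) (f := fun j => |w j|)]
      have : ∑ j ∈ Finset.univ.erase i, |Function.update w i u j|
          = ∑ j ∈ Finset.univ.erase i, |w j| :=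
        Finset.sum_congr rfl fun j hj => by
          rw [Function.update_of_ne (Finset.ne_of_mem_erase hj)]
      rw [this, Function.update_self]
      linarith [abs_nonneg (w i)]
    linarith
  growth' u _ := by
    refine ⟨measurable_const, fun y s => (ha i s).trans ?_⟩
    have e1 : 0 ≤ ∑ j, |w j| := by positivity
    have e2 : 0 ≤ ∑ k, |y k| := by positivity
    have e3 : C ≤ C * (2 + ∑ j, |w j| + |w i|) := by nlinarith [abs_nonneg (w i)]
    exact e3.trans (le_mul_one_add_sum (by positivity) y)

/-- Differentiable curves of coefficients of affine exponents, with bounded derivatives. -/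
structure CoeffPath (C : ℝ) (p p' : ℝ → S → ℝ) (a a' : ℝ → ι → S → ℝ) (b b' : ℝ → κ → S → ℝ) :
    Prop where
  nonneg : 0 ≤ C
  hasDerivAt_p : ∀ u s, HasDerivAt (fun v => p v s) (p' u s) u
  hasDerivAt_a : ∀ u i s, HasDerivAt (fun v => a v i s) (a' u i s) u
  hasDerivAt_b : ∀ u k s, HasDerivAt (fun v => b v k s) (b' u k s) u
  p_le : ∀ u s, |p u s| ≤ C
  a_le : ∀ u i s, |a u i s| ≤ C
  b_le : ∀ u k s, |b u k s| ≤ C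
  p'_le : ∀ u s, |p' u s| ≤ C
  a'_le : ∀ u i s, |a' u i s| ≤ C
  b'_le : ∀ u k s, |b' u k s| ≤ C

section

variable {p p' : ℝ → S → ℝ} {a a' : ℝ → ι → S → ℝ} {b b' : ℝ → κ → S → ℝ}

lemma CoeffPath.smoothFamily (h : CoeffPath C p p' a a' b b') (w : ι → ℝ) (u : ℝ) :
    SmoothFamily (C * (1 + ∑ i, |w i|)) u (fun v => expo (p v) (a v) (b v) w)
      (fun v => expo (p' v) (a' v) (b' v) w) where
  hasDerivAt u y s := ((h.hasDerivAt_p u s).add (HasDerivAt.fun_sum fun i _ =>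
    (h.hasDerivAt_a u i s).mul_const (w i))).add (HasDerivAt.fun_sum fun k _ =>
    (h.hasDerivAt_b u k s).mul_const (y k))
  growth v _ := linGrowth_expo h.nonneg (h.p_le v) (h.a_le v) (h.b_le v) w le_rfl
  growth' v _ := linGrowth_expo h.nonneg (h.p'_le v) (h.a'_le v) (h.b'_le v) w le_rfl

end

variable [Fintype S] [Nonempty S] {θ : ℝ}

/-- Gaussian integration by parts in the outer field, for a tilted Gibbs average. -/
lemma integral_coord_mul_tavg [DecidableEq ι] (h0 : 0 ≤ θ) (h1 : θ ≤ 1) (i : ι) (f : S → ℝ) :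
    ∫ w, w i * tavg θ (expo p a b w) (fun y => gav (expo p a b w y) f) ∂(stdG ι)
      = rep θ (expo p a b) (fun s => f s * a i s)
        - (1 - θ) * rep₂ θ (expo p a b) (fun s t => f s * a i t)
        - θ * rep₁ θ (expo p a b) (fun s t => f s * a i t) := by
  obtain ⟨C, hC, hp, ha, hb⟩ := exists_coeff_bound p a b
  have hX := regular_expo p a b
  have hg : ∀ w, LinGrowth (C * (1 + ∑ i, |w i|)) (expo p a b w) := fun w =>
    linGrowth_expo hC hp ha hb w le_rfl
  have hm1 : ∀ f, Measurable fun w => tavg θ (expo p a b w) fun y => gav (expo p a b w y) f :=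
    fun f => hX.measurable_tavg (hX.measurable_gav f)
  have hb1 : ∀ f w, |tavg θ (expo p a b w) fun y => gav (expo p a b w y) f| ≤ ∑ s, |f s| :=
    fun f w => (isAverage_tavg_gav (hg w) h0 h1).abs_le fun s => abs_le_sum_abs f s
  have hi1 : ∀ f, Integrable (fun w => tavg θ (expo p a b w) fun y => gav (expo p a b w y) f)
      (stdG ι) := fun f => integrable_of_bounded (hm1 f).aestronglyMeasurable (hb1 f)
  have hi2 : ∀ Q : S → S → ℝ, Integrable (fun w => tavg θ (expo p a b w) fun y =>
      gav2 (expo p a b w y) Q) (stdG ι) := fun Q =>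
    integrable_of_bounded
      (hX.measurable_tavg (measurable_gav2 hX.measurable Q)).aestronglyMeasurable
      fun w => (isAverage_tavg_gav2 (hg w) h0 h1).abs_le (f := fun p => Q p.1 p.2)
        fun s => abs_le_sum_abs (fun p : S × S => Q p.1 p.2) s
  have hi3 : ∀ Q : S → S → ℝ, Integrable (fun w => tpair θ (expo p a b w) Q) (stdG ι) := fun Q =>
    integrable_of_bounded (hX.measurable_tpair Q).aestronglyMeasurable
      fun w => (isAverage_tpair (hg w) h0 h1).abs_le (f := fun p => Q p.1 p.2)
        fun s => abs_le_sum_abs (fun p : S × S => Q p.1 p.2) s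
  have hI := ((hi1 fun s => f s * a i s).sub ((hi2 fun s t => f s * a i t).const_mul (1 - θ))).sub
    ((hi3 fun s t => f s * a i t).const_mul θ)
  simp only [Pi.sub_def] at hI
  rw [integral_coord_mul i (f := fun w => tavg θ (expo p a b w) fun y => gav (expo p a b w y) f)
    (f' := fun w => (tavg θ (expo p a b w) fun y => gav (expo p a b w y) fun s => f s * a i s)
      - (1 - θ) * (tavg θ (expo p a b w) fun y => gav2 (expo p a b w y) fun s t => f s * a i t)
      - θ * tpair θ (expo p a b w) fun s t => f s * a i t) ?_ (hi1 f) hI ?_]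
  · rw [integral_sub, integral_sub, integral_const_mul, integral_const_mul]
    · rfl
    · exact hi1 _
    · exact (hi2 _).const_mul _
    · exact (hi1 _).sub ((hi2 _).const_mul _)
    · exact (hi3 _).const_mul _
  · intro w
    have h := (smoothFamily_expo_update hC hp ha hb w i).hasDerivAt_tavg_gav h0 h1 f
    simp only [Function.update_eq_self] at h
    refine h.congr_deriv ?_
    rw [tpair_mul (hg w) h0 h1, tavg_gav_sub (hg w) h0 h1]
  · refine integrable_of_le_linear (C := ∑ s, |f s|)
      ((measurable_pi_apply i).mul (hm1 f)).aestronglyMeasurable fun w => ?_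
    rw [abs_mul, mul_comm]
    refine mul_le_mul (hb1 f w) ?_ (abs_nonneg _) (by positivity)
    have := abs_le_sum_abs w i
    linarith

/-- Gaussian integration by parts in the inner field, for a tilted Gibbs average. -/
lemma tavg_gav_expo [DecidableEq κ] (h0 : 0 ≤ θ) (h1 : θ ≤ 1) (p' : S → ℝ) (a' : ι → S → ℝ)
    (b' : κ → S → ℝ) (w : ι → ℝ) :
    (tavg θ (expo p a b w) fun y => gav (expo p a b w y) (expo p' a' b' w y))
      = (tavg θ (expo p a b w) fun y => gav (expo p a b w y) p')
        + ∑ i, w i * (tavg θ (expo p a b w) fun y => gav (expo p a b w y) (a' i))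
        + ∑ k, ((tavg θ (expo p a b w) fun y => gav (expo p a b w y) fun s => b' k s * b k s)
            - (1 - θ) * tavg θ (expo p a b w) fun y =>
                gav2 (expo p a b w y) fun s t => b' k s * b k t) := by
  obtain ⟨C, hC, hp, ha, hb⟩ := exists_coeff_bound p a b
  have hg := linGrowth_expo hC hp ha hb w le_rfl
  have hA := isAverage_tavg_gav hg h0 h1
  have hm : ∀ f, Measurable fun y => gav (expo p a b w y) f := fun f =>
    measurable_gav hg.measurable measurable_const
  have hbd : ∀ f y, |gav (expo p a b w y) f| ≤ ∑ s, |f s| := fun f y =>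
    abs_gav_le _ fun s => abs_le_sum_abs f s
  have e1 : (fun y => gav (expo p a b w y) (expo p' a' b' w y)) = fun y =>
      gav (expo p a b w y) (fun s => p' s + ∑ i, w i * a' i s)
        + ∑ k, y k * gav (expo p a b w y) (b' k) := by
    ext y
    simp only [← gav_const_mul, ← gav_sum, ← gav_add]
    congr 1; ext s
    simp only [expo, mul_comm]
  have hk : ∀ k y, |y k * gav (expo p a b w y) (b' k)|
      ≤ (∑ k, ∑ s, |b' k s|) * (1 + ∑ k, |y k|) := fun k y => by
    rw [abs_mul, mul_comm]
    refine mul_le_mul ((hbd _ y).trans ?_) ?_ (abs_nonneg _) (by positivity)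
    · exact Finset.single_le_sum (f := fun k => ∑ s, |b' k s|) (fun _ _ => by positivity)
        (Finset.mem_univ k)
    · linarith [abs_le_sum_abs y k]
  rw [e1, tavg_add hg h0 h1 (hm _)
    (fun y => (hbd _ y).trans (le_mul_one_add_sum (by positivity) y))
    (G := fun y => ∑ k, y k * gav (expo p a b w y) (b' k))
    (Finset.measurable_sum _ fun k _ => (measurable_pi_apply k).mul (hm _))
    (B' := ∑ _k : κ, ∑ k, ∑ s, |b' k s|) (fun y => by
      rw [Finset.sum_mul]
      exact (Finset.abs_sum_le_sum_abs _ _).trans (Finset.sum_le_sum fun k _ => hk k y)),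
    tavg_sum (F := fun k y => y k * gav (expo p a b w y) (b' k)) _ hg h0 h1
      (fun k => (measurable_pi_apply k).mul (hm _)) hk,
    hA.map_add, hA.map_sum]
  simp only [hA.map_const_mul]
  congr 1
  refine Finset.sum_congr rfl fun k _ => ?_
  have := tavg_coord_mul_gav (p := fun s => p s + ∑ i, a i s * w i) (b := b) hg h0 h1 k (b' k)
  rw [← tavg_gav_sub hg h0 h1]
  exact this

/-- The logarithm of the averaged power of the partition function grows at most linearly in the
outer field. -/
lemma abs_log_avgPow_expo_le (h0 : 0 ≤ θ) (h1 : θ ≤ 1) (p : S → ℝ) (a : ι → S → ℝ)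
    (b : κ → S → ℝ) :
    ∃ B, ∀ w, |Real.log (avgPow θ (expo p a b w))| ≤ B * (1 + ∑ i, |w i|) := by
  obtain ⟨C, hC, hp, ha, hb⟩ := exists_coeff_bound p a b
  set K := ∫ y : κ → ℝ, Real.exp (C * ∑ k, |y k|) ∂(stdG κ)
  set K' := ∫ y : κ → ℝ, Real.exp (-C * ∑ k, |y k|) ∂(stdG κ)
  have hK : 0 < K := integral_exp_pos (integrable_exp_sum_abs C)
  have hK' : 0 < K' := integral_exp_pos (integrable_exp_sum_abs (-C))
  have hS : (0 : ℝ) < Fintype.card S := by exact_mod_cast Fintype.card_pos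
  refine ⟨|Real.log (Fintype.card S * K)| + |Real.log K'| + C, fun w => ?_⟩
  set E := 1 + ∑ i, |w i| with hE
  have hE1 : 1 ≤ E := by
    have : 0 ≤ ∑ i, |w i| := by positivity
    linarith
  have hg := linGrowth_expo hC hp ha hb w le_rfl
  have hi := hg.integrable_pf_rpow h0 h1
  have hV := avgPow_pos hg h0 h1
  have hub : avgPow θ (expo p a b w) ≤ (Fintype.card S * K) * Real.exp (C * E) := by
    have : ∀ y, pf (expo p a b w y) ^ θ
        ≤ (Fintype.card S * Real.exp (C * E)) * Real.exp (C * ∑ k, |y k|) := fun y => by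
      refine (pf_rpow_le h0 h1 _ (B := C * E + C * ∑ k, |y k|) (by positivity) fun s =>
        (le_abs_self _).trans (abs_expo_le hp ha hb w y s)).trans (le_of_eq ?_)
      rw [Real.exp_add, mul_assoc]
    refine (integral_mono hi ((integrable_exp_sum_abs C).const_mul _) this).trans (le_of_eq ?_)
    rw [integral_const_mul]; ring
  have hlb : K' * Real.exp (-(C * E)) ≤ avgPow θ (expo p a b w) := by
    have : ∀ y, Real.exp (-(C * E)) * Real.exp (-C * ∑ k, |y k|) ≤ pf (expo p a b w y) ^ θ := by
      intro y
      have s := Classical.arbitrary S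
      have h2 := abs_expo_le hp ha hb w y s
      have h3 : Real.exp (-(C * E + C * ∑ k, |y k|)) ≤ pf (expo p a b w y) :=
        (Real.exp_le_exp.2 (by linarith [neg_abs_le (expo p a b w y s)])).trans (exp_le_pf _ s)
      refine le_trans ?_ (Real.rpow_le_rpow (Real.exp_pos _).le h3 h0)
      rw [← Real.exp_add, ← Real.exp_mul, Real.exp_le_exp]
      have : 0 ≤ C * E + C * ∑ k, |y k| := by positivity
      nlinarith
    refine le_trans (le_of_eq ?_)
      (integral_mono ((integrable_exp_sum_abs (-C)).const_mul _) hi this)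
    rw [integral_const_mul]; ring
  have l1 := Real.log_le_log hV hub
  have l2 := Real.log_le_log (by positivity) hlb
  rw [Real.log_mul (by positivity) (Real.exp_pos _).ne', Real.log_exp] at l1 l2
  have k1 := le_abs_self (Real.log (Fintype.card S * K))
  have k2 := neg_abs_le (Real.log K')
  have k3 := abs_nonneg (Real.log (Fintype.card S * K))
  have k4 := abs_nonneg (Real.log K')
  rw [abs_le]
  constructor <;> nlinarith

section Path

variable {C : ℝ} {p p' : ℝ → S → ℝ} {a a' : ℝ → ι → S → ℝ} {b b' : ℝ → κ → S → ℝ}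

/-- **Derivative of the interpolating free energy.** After Gaussian integration by parts in both
fields, only averages of one and two replicas remain. -/
theorem CoeffPath.hasDerivAt_integral_log [DecidableEq ι] [DecidableEq κ]
    (h : CoeffPath C p p' a a' b b') (h0 : 0 ≤ θ) (h1 : θ ≤ 1) (u : ℝ) :
    HasDerivAt (fun v => ∫ w, Real.log (avgPow θ (expo (p v) (a v) (b v) w)) ∂(stdG ι))
      (θ * (rep θ (expo (p u) (a u) (b u)) (p' u)
        + ∑ i, (rep θ (expo (p u) (a u) (b u)) (fun s => a' u i s * a u i s)
          - (1 - θ) * rep₂ θ (expo (p u) (a u) (b u)) (fun s t => a' u i s * a u i t)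
          - θ * rep₁ θ (expo (p u) (a u) (b u)) (fun s t => a' u i s * a u i t))
        + ∑ k, (rep θ (expo (p u) (a u) (b u)) (fun s => b' u k s * b u k s)
          - (1 - θ) * rep₂ θ (expo (p u) (a u) (b u)) (fun s t => b' u k s * b u k t)))) u := by
  set X : ℝ → (ι → ℝ) → (κ → ℝ) → S → ℝ := fun v => expo (p v) (a v) (b v) with hX
  have hR : ∀ v, Regular (X v) := fun v => regular_expo _ _ _
  have hg : ∀ v w, LinGrowth (C * (1 + ∑ i, |w i|)) (X v w) := fun v w =>
    linGrowth_expo h.nonneg (h.p_le v) (h.a_le v) (h.b_le v) w le_rfl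
  have hmt : ∀ v f, Measurable fun w => tavg θ (X v w) fun y => gav (X v w y) f :=
    fun v f => (hR v).measurable_tavg ((hR v).measurable_gav f)
  have hm2 : ∀ v Q, Measurable fun w => tavg θ (X v w) fun y => gav2 (X v w y) Q :=
    fun v Q => (hR v).measurable_tavg (measurable_gav2 (hR v).measurable Q)
  have hbt : ∀ v (f : S → ℝ) B, (∀ s, |f s| ≤ B) → ∀ w,
      |tavg θ (X v w) fun y => gav (X v w y) f| ≤ B :=
    fun v f B hf w => (isAverage_tavg_gav (hg v w) h0 h1).abs_le hf
  have hb2 : ∀ v (Q : S → S → ℝ) B, (∀ s t, |Q s t| ≤ B) → ∀ w,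
      |tavg θ (X v w) fun y => gav2 (X v w y) Q| ≤ B :=
    fun v Q B hQ w => (isAverage_tavg_gav2 (hg v w) h0 h1).abs_le (f := fun q => Q q.1 q.2)
      fun q => hQ _ _
  have key := hasDerivAt_integral_of_dominated_loc_of_deriv_le (μ := stdG ι) (s := Set.univ)
    (x₀ := u) (F := fun v w => Real.log (avgPow θ (X v w)))
    (F' := fun v w => θ * ((tavg θ (X v w) fun y => gav (X v w y) (p' v))
        + ∑ i, w i * (tavg θ (X v w) fun y => gav (X v w y) (a' v i))
        + ∑ k, ((tavg θ (X v w) fun y => gav (X v w y) fun s => b' v k s * b v k s)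
            - (1 - θ) * tavg θ (X v w) fun y => gav2 (X v w y) fun s t => b' v k s * b v k t)))
    (bound := fun w => (C + ∑ _k : κ, 2 * (C * C)) * (1 + ∑ i, |w i|))
    univ_mem ?_ ?_ ?_ ?_ ?_ ?_
  · refine key.2.congr_deriv ?_
    rw [integral_const_mul]
    congr 1
    have i1 : ∀ f, Integrable (fun w => tavg θ (X u w) fun y => gav (X u w y) f) (stdG ι) :=
      fun f => integrable_of_bounded (hmt u f).aestronglyMeasurable
        (hbt u f _ fun s => abs_le_sum_abs f s)
    have i2 : ∀ Q : S → S → ℝ,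
        Integrable (fun w => tavg θ (X u w) fun y => gav2 (X u w y) Q) (stdG ι) :=
      fun Q => integrable_of_bounded (hm2 u Q).aestronglyMeasurable
        (hb2 u Q _ fun s t => abs_le_sum_abs (fun q : S × S => Q q.1 q.2) (s, t))
    have i3 : ∀ i f, Integrable (fun w => w i * tavg θ (X u w) fun y => gav (X u w y) f)
        (stdG ι) := fun i f => by
      refine integrable_of_le_linear (C := ∑ s, |f s|)
        ((measurable_pi_apply i).mul (hmt u f)).aestronglyMeasurable fun w => ?_
      rw [abs_mul, mul_comm]
      refine mul_le_mul (hbt u f _ (fun s => abs_le_sum_abs f s) w) ?_ (abs_nonneg _)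
        (by positivity)
      have := abs_le_sum_abs w i
      linarith
    rw [integral_add, integral_add, integral_finsetSum, integral_finsetSum]
    · congr 1
      · congr 1
        exact Finset.sum_congr rfl fun i _ => integral_coord_mul_tavg h0 h1 i (a' u i)
      · refine Finset.sum_congr rfl fun k _ => ?_
        rw [integral_sub (i1 _) ((i2 _).const_mul _), integral_const_mul]
        rfl
    · exact fun k _ => (i1 _).sub ((i2 _).const_mul _)
    · exact fun i _ => i3 i _
    · exact i1 _
    · exact integrable_finsetSum _ fun i _ => i3 i _
    · exact (i1 _).add (integrable_finsetSum _ fun i _ => i3 i _)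
    · exact integrable_finsetSum _ fun k _ => (i1 _).sub ((i2 _).const_mul _)
  · exact Eventually.of_forall fun v => ((hR v).measurable_avgPow.log).aestronglyMeasurable
  · obtain ⟨B, hB⟩ := abs_log_avgPow_expo_le h0 h1 (p u) (a u) (b u)
    exact integrable_of_le_linear ((hR u).measurable_avgPow.log).aestronglyMeasurable hB
  · refine Measurable.aestronglyMeasurable (Measurable.const_mul ?_ _)
    refine ((hmt u _).add (Finset.measurable_sum _ fun i _ =>
      (measurable_pi_apply i).mul (hmt u _))).add (Finset.measurable_sum _ fun k _ =>
        (hmt u _).sub ((hm2 u _).const_mul _))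
  · refine ae_of_all _ fun w v _ => ?_
    have hC := h.nonneg
    have e1 := hbt v _ _ (h.p'_le v) w
    have e2 : |∑ i, w i * (tavg θ (X v w) fun y => gav (X v w y) (a' v i))|
        ≤ C * ∑ i, |w i| := by
      rw [Finset.mul_sum]
      refine (Finset.abs_sum_le_sum_abs _ _).trans (Finset.sum_le_sum fun i _ => ?_)
      rw [abs_mul, mul_comm]
      exact mul_le_mul_of_nonneg_right (hbt v _ _ (h.a'_le v i) w) (abs_nonneg _)
    have e3 : |∑ k, ((tavg θ (X v w) fun y => gav (X v w y) fun s => b' v k s * b v k s)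
        - (1 - θ) * tavg θ (X v w) fun y => gav2 (X v w y) fun s t => b' v k s * b v k t)|
        ≤ ∑ _k : κ, 2 * (C * C) := by
      refine (Finset.abs_sum_le_sum_abs _ _).trans (Finset.sum_le_sum fun k _ => ?_)
      have f1 := hbt v (fun s => b' v k s * b v k s) (C * C) (fun s => by
        rw [abs_mul]; exact mul_le_mul (h.b'_le v k s) (h.b_le v k s) (abs_nonneg _) hC) w
      have f2 := hb2 v (fun s t => b' v k s * b v k t) (C * C) (fun s t => by
        rw [abs_mul]; exact mul_le_mul (h.b'_le v k s) (h.b_le v k t) (abs_nonneg _) hC) w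
      refine (abs_sub _ _).trans ?_
      rw [abs_mul, abs_of_nonneg (by linarith : 0 ≤ 1 - θ)]
      nlinarith [abs_nonneg (tavg θ (X v w) fun y => gav2 (X v w y) fun s t => b' v k s * b v k t)]
    set T := ∑ _k : κ, 2 * (C * C) with hT
    have hT0 : 0 ≤ T := by positivity
    have hs : 0 ≤ ∑ i, |w i| := by positivity
    rw [Real.norm_eq_abs, abs_mul, abs_of_nonneg h0]
    refine (mul_le_of_le_one_left (abs_nonneg _) h1).trans ?_
    refine (abs_add_le _ _).trans ?_
    have := abs_add_le (tavg θ (X v w) fun y => gav (X v w y) (p' v))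
      (∑ i, w i * (tavg θ (X v w) fun y => gav (X v w y) (a' v i)))
    nlinarith
  · exact integrable_one_add_sum_abs.const_mul _
  · refine ae_of_all _ fun w v _ => ?_
    refine ((h.smoothFamily w v).hasDerivAt_log_avgPow h0 h1).congr_deriv ?_
    rw [tavg_gav_expo h0 h1]

end Path

end Affine

/-! ### The interpolating system along an angle -/

lemma sv_one : sv 1 = 1 := by simp [sv]

lemma sv_neg_one : sv (-1) = -1 := by simp [sv]

lemma sv_mul_self (s : Spin) : sv s * sv s = 1 := by
  rcases Int.units_eq_one_or s with rfl | rfl <;> simp [sv]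

lemma abs_sv (s : Spin) : |sv s| = 1 := by
  rcases Int.units_eq_one_or s with rfl | rfl <;> simp [sv]

lemma sum_spin (f : Spin → ℝ) : ∑ s, f s = f 1 + f (-1) := by
  rw [show (Finset.univ : Finset Spin) = {1, -1} from rfl, Finset.sum_pair (by decide)]

namespace Model

section Interp

variable (D : Model) {N : ℕ}

/-- The discrete part of the quenched disorder: an archetype and its examples. -/
abbrev Data (N : ℕ) : Type := (Fin N → Spin) × (Fin D.M → Fin N → Spin)

/-- The sets of interacting neurons. -/
abbrev Cpl (N : ℕ) : Type := {I : Finset (Fin N) // I.card = D.P}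

/-- The probability of an archetype together with its examples. -/
def wt (z : D.Data N) : ℝ := ∏ i, (1 / 2 * ∏ a, D.exampleProb (z.2 a i) (z.1 i))

/-- The disorder with vanishing couplings. -/
abbrev base (z : D.Data N) : D.Disorder N := ⟨z.1, z.2, 0⟩

/-- The product of the spins in `I`. -/
def spinProd (I : Finset (Fin N)) (σ : Fin N → Spin) : ℝ := ∏ i ∈ I, sv (σ i)

variable (o : OrderParams) (J : ℝ)

/-- The interaction of the spins with the examples. -/
def signal (z : D.Data N) (σ : Fin N → Spin) : ℝ :=
  D.β' * N / (2 * D.M) * (1 + D.ρ) ^ ((D.P : ℝ) / 2) * ∑ a, mattisEx (D.base z) a σ ^ D.P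

/-- The one-body substitute for the interaction of the spins with the examples. -/
def signal₀ (z : D.Data N) (σ : Fin N → Spin) : ℝ :=
  D.ψ o * N * ∑ a, mattisEx (D.base z) a σ

/-- The Gaussian-free part of the interpolating exponent at time `t = sin² u`. -/
def detPart (z : D.Data N) (u : ℝ) (σ : Fin N → Spin) : ℝ :=
  J * ∑ i, sv (z.1 i) * sv (σ i)
    + (Real.sin u ^ 2 * D.signal z σ + Real.cos u ^ 2 * D.signal₀ o z σ)

/-- The coefficients of the couplings and of `Y⁽¹⁾`, with `f, g` in the place of `√t, √(1 - t)`. -/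
def outCoeff (f g : ℝ) : D.Cpl N ⊕ Fin N → (Fin N → Spin) → ℝ
  | .inl I, σ => f * D.noiseCoeff N * spinProd I.1 σ
  | .inr i, σ => g * D.A₁ o * sv (σ i)

/-- The coefficients of `Y⁽²⁾`, with `g` in the place of `√(1 - t)`. -/
def inCoeff (g : ℝ) (k : Fin N) (σ : Fin N → Spin) : ℝ := g * D.A₂ o * sv (σ k)

/-- The interpolating exponent at time `t = sin² u`. In terms of the angle `u` it is smooth up to
both ends of the interpolation. -/
def angleExpo (z : D.Data N) (u : ℝ) :
    (D.Cpl N ⊕ Fin N → ℝ) → (Fin N → ℝ) → (Fin N → Spin) → ℝ :=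
  expo (D.detPart o J z u) (D.outCoeff o (Real.sin u) (Real.cos u)) (D.inCoeff o (Real.cos u))

/-- The one-replica average at the angle `u`. -/
def mean (N : ℕ) (u : ℝ) (F : D.Data N → (Fin N → Spin) → ℝ) : ℝ :=
  ∑ z, D.wt z * rep D.θ (D.angleExpo o J z u) (F z)

/-- The average over two replicas with common disorder and `Y⁽¹⁾`, at the angle `u`. -/
def mean₁ (N : ℕ) (u : ℝ) (Q : (Fin N → Spin) → (Fin N → Spin) → ℝ) : ℝ :=
  ∑ z : D.Data N, D.wt z * rep₁ D.θ (D.angleExpo o J z u) Q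

/-- The average over two replicas with common disorder, `Y⁽¹⁾` and `Y⁽²⁾`, at the angle `u`. -/
def mean₂ (N : ℕ) (u : ℝ) (Q : (Fin N → Spin) → (Fin N → Spin) → ℝ) : ℝ :=
  ∑ z : D.Data N, D.wt z * rep₂ D.θ (D.angleExpo o J z u) Q

/-- The interpolating free energy `θ A_N`, not divided by the size. -/
def interp (N : ℕ) (u : ℝ) : ℝ :=
  ∑ z : D.Data N, D.wt z * ∫ w, Real.log (avgPow D.θ (D.angleExpo o J z u w)) ∂(stdG _)

variable {D o J}

lemma abs_spinProd (I : Finset (Fin N)) (σ : Fin N → Spin) : |spinProd I σ| = 1 := by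
  simp [spinProd, Finset.abs_prod, abs_sv]

lemma spinProd_mul_self (I : Finset (Fin N)) (σ : Fin N → Spin) :
    spinProd I σ * spinProd I σ = 1 := by
  simp [spinProd, ← Finset.prod_mul_distrib, sv_mul_self]

lemma regular_angleExpo (z : D.Data N) (u : ℝ) : Regular (D.angleExpo o J z u) :=
  regular_expo _ _ _

/-! #### Identification with the averages of the interpolating system -/

lemma exp_angleExpo {u : ℝ} (hs : 0 ≤ Real.sin u) (hc : 0 ≤ Real.cos u) (z : D.Data N)
    (lam : D.Cpl N → ℝ) (Y₁ Y₂ : Fin N → ℝ) (σ : Fin N → Spin) :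
    Real.exp (D.angleExpo o J z u (Sum.elim lam Y₁) Y₂ σ)
      = boltzI o J (Real.sin u ^ 2) ⟨z.1, z.2, lam⟩ Y₁ Y₂ σ := by
  have h1 : √(Real.sin u ^ 2) = Real.sin u := Real.sqrt_sq hs
  have h3 : 1 - Real.sin u ^ 2 = Real.cos u ^ 2 := by rw [Real.cos_sq']
  have h2 : √(1 - Real.sin u ^ 2) = Real.cos u := by rw [h3, Real.sqrt_sq hc]
  rw [boltzI, h1, h2, h3]
  congr 1
  simp only [angleExpo, expo, Fintype.sum_sum_type, outCoeff, inCoeff, Sum.elim_inl, Sum.elim_inr,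
    detPart, signal, signal₀, noise, spinProd]
  have e1 : ∑ I : D.Cpl N, Real.sin u * D.noiseCoeff N * (∏ i ∈ I.1, sv (σ i)) * lam I
      = Real.sin u * D.noiseCoeff N * ∑ I : D.Cpl N, lam I * ∏ i ∈ I.1, sv (σ i) := by
    rw [Finset.mul_sum]; exact Finset.sum_congr rfl fun I _ => by ring
  have e2 : ∑ i, Real.cos u * D.A₁ o * sv (σ i) * Y₁ i
      = Real.cos u * (D.A₁ o * ∑ i, Y₁ i * sv (σ i)) := by
    rw [Finset.mul_sum, Finset.mul_sum]; exact Finset.sum_congr rfl fun I _ => by ring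
  have e3 : ∑ i, Real.cos u * D.A₂ o * sv (σ i) * Y₂ i
      = Real.cos u * (D.A₂ o * ∑ i, Y₂ i * sv (σ i)) := by
    rw [Finset.mul_sum, Finset.mul_sum]; exact Finset.sum_congr rfl fun I _ => by ring
  have e4 : ∀ a, mattisEx (D.base z) a σ = mattisEx (⟨z.1, z.2, lam⟩ : D.Disorder N) a σ :=
    fun _ => rfl
  rw [e1, e2, e3]
  simp only [e4]
  ring

lemma pf_angleExpo {u : ℝ} (hs : 0 ≤ Real.sin u) (hc : 0 ≤ Real.cos u) (z : D.Data N)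
    (lam : D.Cpl N → ℝ) (Y₁ Y₂ : Fin N → ℝ) :
    pf (D.angleExpo o J z u (Sum.elim lam Y₁) Y₂)
      = Z₂ o J (Real.sin u ^ 2) ⟨z.1, z.2, lam⟩ Y₁ Y₂ :=
  Finset.sum_congr rfl fun σ _ => exp_angleExpo hs hc z lam Y₁ Y₂ σ

/-- The Gaussian integral over a disjoint union of index sets is an iterated integral. -/
lemma integral_sumElim {α β : Type*} [Fintype α] [Fintype β] {G : (α ⊕ β → ℝ) → ℝ}
    (hG : Integrable G (stdG (α ⊕ β))) :
    ∫ x, ∫ y, G (Sum.elim x y) ∂(stdG β) ∂(stdG α) = ∫ w, G w ∂(stdG (α ⊕ β)) := by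
  have hp := measurePreserving_sumPiEquivProdPi_symm (fun _ : α ⊕ β => gaussianReal 0 1)
  have he : ∀ q : (α → ℝ) × (β → ℝ),
      (MeasurableEquiv.sumPiEquivProdPi fun _ : α ⊕ β => ℝ).symm q = Sum.elim q.1 q.2 := by
    intro q; ext i; cases i <;> rfl
  have hi := (hp.integrable_comp_emb (MeasurableEquiv.measurableEmbedding _)).2 hG
  rw [← hp.integral_comp (MeasurableEquiv.measurableEmbedding _)]
  have := integral_prod _ hi
  simp only [Function.comp_apply, he] at this
  simp only [he]
  exact this.symm

lemma E0_eq (f : D.Disorder N → ℝ) :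
    D.E0 f = ∑ z : D.Data N, D.wt z * ∫ lam, f ⟨z.1, z.2, lam⟩ ∂(stdG (D.Cpl N)) := by
  rw [Fintype.sum_prod_type]
  rfl

/-- The quenched average over couplings and `Y⁽¹⁾` as one Gaussian integral. -/
lemma E0_EY_eq {f : D.Disorder N → (Fin N → ℝ) → ℝ} {G : D.Data N → (D.Cpl N ⊕ Fin N → ℝ) → ℝ}
    (hf : ∀ z lam Y, f ⟨z.1, z.2, lam⟩ Y = G z (Sum.elim lam Y))
    (hG : ∀ z, Integrable (G z) (stdG _)) :
    (D.E0 fun d => EY (f d)) = ∑ z : D.Data N, D.wt z * ∫ w, G z w ∂(stdG _) := by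
  rw [E0_eq]
  refine Finset.sum_congr rfl fun z _ => ?_
  rw [← integral_sumElim (hG z)]
  simp only [EY, hf]

variable {u : ℝ}

lemma avgI_eq_mean (h0 : 0 ≤ D.θ) (h1 : D.θ ≤ 1) (hs : 0 ≤ Real.sin u) (hc : 0 ≤ Real.cos u)
    (F : D.Data N → (Fin N → Spin) → ℝ) :
    D.avgI N o J (Real.sin u ^ 2) (fun d σ => F (d.ξ, d.η) σ) = D.mean o J N u F := by
  refine E0_EY_eq (G := fun z w => tavg D.θ (D.angleExpo o J z u w) fun y =>
    gav (D.angleExpo o J z u w y) (F z)) (fun z lam Y₁ => ?_) fun z => ?_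
  · simp only [W₂, gibbsI, ← pf_angleExpo hs hc, ← exp_angleExpo hs hc]
    rfl
  · have hX := regular_angleExpo (o := o) (J := J) z u
    exact integrable_of_bounded (hX.measurable_tavg (hX.measurable_gav _)).aestronglyMeasurable
      fun w => (isAverage_tavg_gav (hX.growth w).choose_spec h0 h1).abs_le
        fun s => abs_le_sum_abs (F z) s

lemma avgI₂_eq_mean₂ (h0 : 0 ≤ D.θ) (h1 : D.θ ≤ 1) (hs : 0 ≤ Real.sin u) (hc : 0 ≤ Real.cos u)
    (Q : (Fin N → Spin) → (Fin N → Spin) → ℝ) :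
    D.avgI₂ N o J (Real.sin u ^ 2) Q = D.mean₂ o J N u Q := by
  refine E0_EY_eq (G := fun z w => tavg D.θ (D.angleExpo o J z u w) fun y =>
    gav2 (D.angleExpo o J z u w y) Q) (fun z lam Y₁ => ?_) fun z => ?_
  · simp only [W₂, gibbsI, ← pf_angleExpo hs hc, ← exp_angleExpo hs hc]
    rfl
  · have hX := regular_angleExpo (o := o) (J := J) z u
    exact integrable_of_bounded
      (hX.measurable_tavg (measurable_gav2 hX.measurable Q)).aestronglyMeasurable
      fun w => (isAverage_tavg_gav2 (hX.growth w).choose_spec h0 h1).abs_le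
        (f := fun q => Q q.1 q.2) fun s => abs_le_sum_abs (fun q : _ × _ => Q q.1 q.2) s

lemma avgI₁_eq_mean₁ (h0 : 0 ≤ D.θ) (h1 : D.θ ≤ 1) (hs : 0 ≤ Real.sin u) (hc : 0 ≤ Real.cos u)
    (Q : (Fin N → Spin) → (Fin N → Spin) → ℝ) :
    D.avgI₁ N o J (Real.sin u ^ 2) Q = D.mean₁ o J N u Q := by
  refine E0_EY_eq (G := fun z w => tpair D.θ (D.angleExpo o J z u w) Q)
    (fun z lam Y₁ => ?_) fun z => ?_
  · simp only [W₂, gibbsI, ← pf_angleExpo hs hc, ← exp_angleExpo hs hc]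
    rfl
  · have hX := regular_angleExpo (o := o) (J := J) z u
    exact integrable_of_bounded (hX.measurable_tpair Q).aestronglyMeasurable
      fun w => (isAverage_tpair (hX.growth w).choose_spec h0 h1).abs_le
        (f := fun q => Q q.1 q.2) fun s => abs_le_sum_abs (fun q : _ × _ => Q q.1 q.2) s

/-! #### The weights of archetypes and examples -/

lemma exampleProb_nonneg (hr : 0 < D.r) (hr1 : D.r ≤ 1) (e x : Spin) : 0 ≤ D.exampleProb e x := by
  unfold exampleProb
  refine add_nonneg (mul_nonneg (by linarith) ?_) (mul_nonneg (by linarith) ?_) <;> split_ifs <;>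
    norm_num

lemma sum_exampleProb (x : Spin) : ∑ e, D.exampleProb e x = 1 := by
  rw [sum_spin]
  rcases Int.units_eq_one_or x with rfl | rfl <;> simp [exampleProb] <;> ring

lemma wt_nonneg (hr : 0 < D.r) (hr1 : D.r ≤ 1) (z : D.Data N) : 0 ≤ D.wt z :=
  Finset.prod_nonneg fun _ _ => mul_nonneg (by norm_num) (Finset.prod_nonneg fun _ _ =>
    exampleProb_nonneg hr hr1 _ _)

/-- The one-site probability of an entry of the archetype and of its examples. -/
def siteWt (D : Model) (q : Spin × (Fin D.M → Spin)) : ℝ := 1 / 2 * ∏ a, D.exampleProb (q.2 a) q.1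

lemma Esite_eq (f : Spin → (Fin D.M → Spin) → ℝ) :
    D.Esite f = ∑ q : Spin × (Fin D.M → Spin), siteWt D q * f q.1 q.2 := by
  rw [Fintype.sum_prod_type]
  simp only [Esite, siteWt, Finset.mul_sum, mul_assoc]

lemma sum_siteWt : ∑ q, siteWt D q = 1 := by
  rw [Fintype.sum_prod_type]
  simp only [siteWt, ← Finset.mul_sum]
  have : ∀ x : Spin, ∑ e : Fin D.M → Spin, ∏ a, D.exampleProb (e a) x = 1 := fun x => by
    have h := Finset.prod_univ_sum (fun _ : Fin D.M => (Finset.univ : Finset Spin))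
      fun _ e => D.exampleProb e x
    rw [Fintype.piFinset_univ] at h
    rw [← h]
    exact Finset.prod_eq_one fun _ _ => sum_exampleProb x
  simp [this]

/-- Sums over archetypes and examples, rearranged site by site. -/
lemma sum_data (f : (Fin N → Spin × (Fin D.M → Spin)) → ℝ) :
    ∑ z : D.Data N, f (fun i => (z.1 i, fun a => z.2 a i)) = ∑ q, f q :=
  Fintype.sum_equiv
    { toFun := fun z i => (z.1 i, fun a => z.2 a i)
      invFun := fun q => (fun i => (q i).1, fun a i => (q i).2 a)
      left_inv := fun _ => rfl
      right_inv := fun _ => rfl } _ _ fun _ => rfl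

/-- Sites are independent: the average of a product of one-site functions. -/
lemma sum_wt_mul_prod (f : Fin N → Spin × (Fin D.M → Spin) → ℝ) :
    ∑ z : D.Data N, D.wt z * ∏ i, f i (z.1 i, fun a => z.2 a i)
      = ∏ i, ∑ q, siteWt D q * f i q := by
  rw [Finset.prod_univ_sum, Fintype.piFinset_univ,
    ← sum_data fun q => ∏ i, siteWt D (q i) * f i (q i)]
  refine Finset.sum_congr rfl fun z _ => ?_
  rw [wt, ← Finset.prod_mul_distrib]
  rfl

lemma sum_wt : ∑ z : D.Data N, D.wt z = 1 := by
  have := sum_wt_mul_prod (D := D) (N := N) fun _ _ => 1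
  simpa [sum_siteWt] using this

/-- The average of a function of one site. -/
lemma sum_wt_mul_site (j : Fin N) (f : Spin → (Fin D.M → Spin) → ℝ) :
    ∑ z : D.Data N, D.wt z * f (z.1 j) (fun a => z.2 a j) = D.Esite f := by
  have := sum_wt_mul_prod (D := D) (N := N) fun i q => if i = j then f q.1 q.2 else 1
  simp only [Finset.prod_ite_eq', Finset.mem_univ, if_true] at this
  rw [this, Esite_eq, ← Finset.mul_prod_erase _ _ (Finset.mem_univ j)]
  simp only [if_true]
  rw [Finset.prod_eq_one, mul_one]
  intro i hi
  simp [Finset.ne_of_mem_erase hi, sum_siteWt]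

lemma isAverage_mean₁ (hD : D.Admissible) (u : ℝ) :
    IsAverage fun Q : (Fin N → Spin) × (Fin N → Spin) → ℝ => D.mean₁ o J N u fun s t => Q (s, t) :=
  IsAverage.weighted_sum Finset.univ (wt_nonneg hD.r_pos hD.r_le_one) sum_wt fun z =>
    isAverage_rep₁ (regular_angleExpo z u) hD.θ_pos.le hD.θ_le_one

lemma isAverage_mean₂ (hD : D.Admissible) (u : ℝ) :
    IsAverage fun Q : (Fin N → Spin) × (Fin N → Spin) → ℝ => D.mean₂ o J N u fun s t => Q (s, t) :=
  IsAverage.weighted_sum Finset.univ (wt_nonneg hD.r_pos hD.r_le_one) sum_wt fun z =>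
    isAverage_rep₂ (regular_angleExpo z u) hD.θ_pos.le hD.θ_le_one

lemma isAverage_mean (hD : D.Admissible) (u : ℝ) :
    IsAverage fun F : D.Data N × (Fin N → Spin) → ℝ => D.mean o J N u fun z s => F (z, s) where
  map_add f k := by
    simp only [mean, (isAverage_rep (regular_angleExpo _ u) hD.θ_pos.le hD.θ_le_one).map_add,
      mul_add, Finset.sum_add_distrib]
  map_const_mul c f := by
    simp only [mean, (isAverage_rep (regular_angleExpo _ u) hD.θ_pos.le hD.θ_le_one).map_const_mul,
      Finset.mul_sum]
    exact Finset.sum_congr rfl fun _ _ => by ring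
  nonneg f hf := Finset.sum_nonneg fun z _ => mul_nonneg (wt_nonneg hD.r_pos hD.r_le_one z)
    ((isAverage_rep (regular_angleExpo _ u) hD.θ_pos.le hD.θ_le_one).nonneg _ fun s => hf _)
  map_one := by
    simp only [mean, (isAverage_rep (regular_angleExpo _ u) hD.θ_pos.le hD.θ_le_one).map_one,
      mul_one, sum_wt]

end Interp

/-! ### Derivative of the interpolating free energy -/

section Derivative

variable {D : Model} {N : ℕ} {o : OrderParams} {J : ℝ}

variable (D) in
/-- The overlap `∑_{i₁ < ⋯ < i_P} σ_{i₁} τ_{i₁} ⋯ σ_{i_P} τ_{i_P}`, which is the covariance of the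
noise. -/
def noiseCov (σ τ : Fin N → Spin) : ℝ := ∑ I : D.Cpl N, spinProd I.1 σ * spinProd I.1 τ

lemma exists_coeffPath (z : D.Data N) :
    ∃ C, CoeffPath C (D.detPart o J z)
      (fun u σ => 2 * (Real.sin u * Real.cos u) * (D.signal z σ - D.signal₀ o z σ))
      (fun u => D.outCoeff o (Real.sin u) (Real.cos u))
      (fun u => D.outCoeff o (Real.cos u) (-Real.sin u))
      (fun u => D.inCoeff o (Real.cos u)) (fun u => D.inCoeff o (-Real.sin u)) := by
  set E₀ := ∑ σ : Fin N → Spin, |J * ∑ i, sv (z.1 i) * sv (σ i)| with hE₀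
  set E₁ := ∑ σ, |D.signal z σ| with hE₁
  set E₂ := ∑ σ, |D.signal₀ o z σ| with hE₂
  have p₀ : 0 ≤ E₀ := by positivity
  have p₁ : 0 ≤ E₁ := by positivity
  have p₂ : 0 ≤ E₂ := by positivity
  have b₀ : ∀ σ, _ ≤ E₀ := abs_le_sum_abs fun σ : Fin N → Spin => J * ∑ i, sv (z.1 i) * sv (σ i)
  have b₁ : ∀ σ, |D.signal z σ| ≤ E₁ := abs_le_sum_abs (D.signal z)
  have b₂ : ∀ σ, |D.signal₀ o z σ| ≤ E₂ := abs_le_sum_abs (D.signal₀ o z)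
  have hs : ∀ v, |Real.sin v| ≤ 1 := Real.abs_sin_le_one
  have hc : ∀ v, |Real.cos v| ≤ 1 := Real.abs_cos_le_one
  have n1 := abs_nonneg (D.noiseCoeff N)
  have n2 := abs_nonneg (D.A₁ o)
  have n3 := abs_nonneg (D.A₂ o)
  have hout : ∀ f g : ℝ, |f| ≤ 1 → |g| ≤ 1 → ∀ i (σ : Fin N → Spin), |D.outCoeff o f g i σ|
      ≤ E₀ + 2 * E₁ + 2 * E₂ + |D.noiseCoeff N| + |D.A₁ o| + |D.A₂ o| := by
    rintro f g hf hg (I | i) σ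
    · simp only [outCoeff, abs_mul, abs_spinProd, mul_one]
      nlinarith
    · simp only [outCoeff, abs_mul, abs_sv, mul_one]
      nlinarith
  have hin : ∀ g : ℝ, |g| ≤ 1 → ∀ i (σ : Fin N → Spin), |D.inCoeff o g i σ|
      ≤ E₀ + 2 * E₁ + 2 * E₂ + |D.noiseCoeff N| + |D.A₁ o| + |D.A₂ o| := by
    intro g hg i σ
    simp only [inCoeff, abs_mul, abs_sv, mul_one]
    nlinarith
  refine ⟨E₀ + 2 * E₁ + 2 * E₂ + |D.noiseCoeff N| + |D.A₁ o| + |D.A₂ o|, by positivity, ?_, ?_, ?_,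
    ?_, fun u => hout _ _ (hs u) (hc u), fun u => hin _ (hc u), ?_,
    fun u => hout _ _ (hc u) (by rw [abs_neg]; exact hs u),
    fun u => hin _ (by rw [abs_neg]; exact hs u)⟩
  · intro u σ
    have h1 := ((Real.hasDerivAt_sin u).pow 2).mul_const (D.signal z σ)
    have h2 := ((Real.hasDerivAt_cos u).pow 2).mul_const (D.signal₀ o z σ)
    refine ((h1.add h2).const_add _).congr_deriv ?_
    simp only [Nat.cast_ofNat]
    ring
  · rintro u (I | i) σ
    · exact ((Real.hasDerivAt_sin u).mul_const _).mul_const _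
    · exact ((Real.hasDerivAt_cos u).mul_const _).mul_const _
  · intro u k σ
    exact ((Real.hasDerivAt_cos u).mul_const _).mul_const _
  · intro u σ
    have e1 : Real.sin u ^ 2 ≤ 1 := Real.sin_sq_le_one u
    have e2 : Real.cos u ^ 2 ≤ 1 := Real.cos_sq_le_one u
    refine (abs_add_le _ _).trans ?_
    have h1 := abs_add_le (Real.sin u ^ 2 * D.signal z σ) (Real.cos u ^ 2 * D.signal₀ o z σ)
    rw [abs_mul, abs_mul, abs_of_nonneg (sq_nonneg (Real.sin u)),
      abs_of_nonneg (sq_nonneg (Real.cos u))] at h1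
    have h2 := mul_le_mul e1 (b₁ σ) (abs_nonneg _) zero_le_one
    have h3 := mul_le_mul e2 (b₂ σ) (abs_nonneg _) zero_le_one
    have h4 := b₀ σ
    linarith
  · intro u σ
    have h1 : |2 * (Real.sin u * Real.cos u)| ≤ 2 := by
      rw [abs_mul, abs_mul, abs_two]
      nlinarith [hs u, hc u, abs_nonneg (Real.sin u), abs_nonneg (Real.cos u)]
    have h2 := (abs_sub (D.signal z σ) (D.signal₀ o z σ)).trans (add_le_add (b₁ σ) (b₂ σ))
    rw [abs_mul]
    have := mul_le_mul h1 h2 (abs_nonneg _) zero_le_two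
    linarith

lemma natCast_mul_overlap (hN : N ≠ 0) (σ τ : Fin N → Spin) :
    N * overlap σ τ = ∑ i, sv (σ i) * sv (τ i) := by
  have : (N : ℝ) ≠ 0 := by exact_mod_cast hN
  rw [overlap]
  field_simp

lemma hasDerivAt_log_angleExpo (hD : D.Admissible) (hN : N ≠ 0) (z : D.Data N) (u : ℝ) :
    HasDerivAt (fun v => ∫ w, Real.log (avgPow D.θ (D.angleExpo o J z v w)) ∂(stdG _))
      (D.θ * (Real.sin u * Real.cos u * (
        2 * (rep D.θ (D.angleExpo o J z u) (D.signal z)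
          - rep D.θ (D.angleExpo o J z u) (D.signal₀ o z))
        + D.noiseCoeff N ^ 2 * (Fintype.card (D.Cpl N)
          - (1 - D.θ) * rep₂ D.θ (D.angleExpo o J z u) D.noiseCov
          - D.θ * rep₁ D.θ (D.angleExpo o J z u) D.noiseCov)
        - N * D.A₁ o ^ 2 * (1 - (1 - D.θ) * rep₂ D.θ (D.angleExpo o J z u) overlap
          - D.θ * rep₁ D.θ (D.angleExpo o J z u) overlap)
        - N * D.A₂ o ^ 2 * (1 - (1 - D.θ) * rep₂ D.θ (D.angleExpo o J z u) overlap)))) u := by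
  obtain ⟨C, hC⟩ := exists_coeffPath (o := o) (J := J) z
  have hX := regular_angleExpo (o := o) (J := J) z u
  have a0 := isAverage_rep hX hD.θ_pos.le hD.θ_le_one
  have a1 := isAverage_rep₁ hX hD.θ_pos.le hD.θ_le_one
  have a2 := isAverage_rep₂ hX hD.θ_pos.le hD.θ_le_one
  refine (hC.hasDerivAt_integral_log hD.θ_pos.le hD.θ_le_one u).congr_deriv ?_
  change D.θ * (rep D.θ (D.angleExpo o J z u) _ + ∑ i, (rep D.θ (D.angleExpo o J z u) _
    - (1 - D.θ) * rep₂ D.θ (D.angleExpo o J z u) _ - D.θ * rep₁ D.θ (D.angleExpo o J z u) _)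
    + ∑ k, (rep D.θ (D.angleExpo o J z u) _
      - (1 - D.θ) * rep₂ D.θ (D.angleExpo o J z u) _)) = _
  rw [Fintype.sum_sum_type]
  set X := D.angleExpo o J z u
  set sc := Real.sin u * Real.cos u with hsc
  -- the diagonal terms are constants, since `σᵢ² = 1`
  have d1 : ∀ I : D.Cpl N, rep D.θ X (fun s =>
      D.outCoeff o (Real.cos u) (-Real.sin u) (.inl I) s
        * D.outCoeff o (Real.sin u) (Real.cos u) (.inl I) s) = sc * D.noiseCoeff N ^ 2 := by
    intro I
    rw [← a0.map_const (sc * D.noiseCoeff N ^ 2)]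
    congr 1; ext s
    simp only [outCoeff]
    linear_combination (sc * D.noiseCoeff N ^ 2) * spinProd_mul_self I.1 s
  have d2 : ∀ i : Fin N, rep D.θ X (fun s =>
      D.outCoeff o (Real.cos u) (-Real.sin u) (.inr i) s
        * D.outCoeff o (Real.sin u) (Real.cos u) (.inr i) s) = -sc * D.A₁ o ^ 2 := by
    intro i
    rw [← a0.map_const (-sc * D.A₁ o ^ 2)]
    congr 1; ext s
    simp only [outCoeff]
    linear_combination (-sc * D.A₁ o ^ 2) * sv_mul_self (s i)
  have d3 : ∀ i : Fin N, rep D.θ X (fun s =>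
      D.inCoeff o (-Real.sin u) i s * D.inCoeff o (Real.cos u) i s) = -sc * D.A₂ o ^ 2 := by
    intro i
    rw [← a0.map_const (-sc * D.A₂ o ^ 2)]
    congr 1; ext s
    simp only [inCoeff]
    linear_combination (-sc * D.A₂ o ^ 2) * sv_mul_self (s i)
  have key : ∀ Φ : ((Fin N → Spin) → (Fin N → Spin) → ℝ) → ℝ,
      (IsAverage fun Q : (Fin N → Spin) × (Fin N → Spin) → ℝ => Φ fun s t => Q (s, t)) →
      ∑ I : D.Cpl N, Φ (fun s t => D.outCoeff o (Real.cos u) (-Real.sin u) (.inl I) s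
        * D.outCoeff o (Real.sin u) (Real.cos u) (.inl I) t)
          = sc * D.noiseCoeff N ^ 2 * Φ D.noiseCov ∧
      ∑ i : Fin N, Φ (fun s t => D.outCoeff o (Real.cos u) (-Real.sin u) (.inr i) s
        * D.outCoeff o (Real.sin u) (Real.cos u) (.inr i) t)
          = -sc * D.A₁ o ^ 2 * N * Φ overlap ∧
      ∑ i : Fin N, Φ (fun s t => D.inCoeff o (-Real.sin u) i s * D.inCoeff o (Real.cos u) i t)
          = -sc * D.A₂ o ^ 2 * N * Φ overlap := by
    intro Φ hΦ
    refine ⟨?_, ?_, ?_⟩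
    · rw [← hΦ.map_sum Finset.univ fun (I : D.Cpl N) (q : (Fin N → Spin) × (Fin N → Spin)) =>
        D.outCoeff o (Real.cos u) (-Real.sin u) (.inl I) q.1
        * D.outCoeff o (Real.sin u) (Real.cos u) (.inl I) q.2,
        ← hΦ.map_const_mul _ fun q => D.noiseCov q.1 q.2]
      congr 1; ext s t
      simp only [outCoeff, noiseCov, Finset.mul_sum, hsc]
      exact Finset.sum_congr rfl fun I _ => by ring
    · rw [← hΦ.map_sum Finset.univ fun (i : Fin N) (q : (Fin N → Spin) × (Fin N → Spin)) =>
        D.outCoeff o (Real.cos u) (-Real.sin u) (.inr i) q.1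
        * D.outCoeff o (Real.sin u) (Real.cos u) (.inr i) q.2,
        ← hΦ.map_const_mul _ fun q => overlap q.1 q.2]
      congr 1; ext s t
      simp only [outCoeff, mul_assoc _ (N : ℝ), natCast_mul_overlap hN, Finset.mul_sum, hsc]
      exact Finset.sum_congr rfl fun I _ => by ring
    · rw [← hΦ.map_sum Finset.univ fun (i : Fin N) (q : (Fin N → Spin) × (Fin N → Spin)) =>
        D.inCoeff o (-Real.sin u) i q.1 * D.inCoeff o (Real.cos u) i q.2,
        ← hΦ.map_const_mul _ fun q => overlap q.1 q.2]
      congr 1; ext s t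
      simp only [inCoeff, mul_assoc _ (N : ℝ), natCast_mul_overlap hN, Finset.mul_sum, hsc]
      exact Finset.sum_congr rfl fun I _ => by ring
  obtain ⟨k1, k2, -⟩ := key _ a1
  obtain ⟨l1, l2, l3⟩ := key _ a2
  simp only [Finset.sum_sub_distrib, ← Finset.mul_sum, d1, d2, d3, k1, k2, l1, l2, l3,
    a0.map_const_mul, a0.map_sub, Finset.sum_const, Finset.card_univ, nsmul_eq_mul,
    Fintype.card_fin]
  ring

lemma hasDerivAt_interp (hD : D.Admissible) (hN : N ≠ 0) (u : ℝ) :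
    HasDerivAt (fun v => D.interp o J N v)
      (D.θ * (Real.sin u * Real.cos u * (
        2 * (D.mean o J N u D.signal - D.mean o J N u (D.signal₀ o))
        + D.noiseCoeff N ^ 2 * (Fintype.card (D.Cpl N)
          - (1 - D.θ) * D.mean₂ o J N u D.noiseCov - D.θ * D.mean₁ o J N u D.noiseCov)
        - N * D.A₁ o ^ 2 * (1 - (1 - D.θ) * D.mean₂ o J N u overlap
          - D.θ * D.mean₁ o J N u overlap)
        - N * D.A₂ o ^ 2 * (1 - (1 - D.θ) * D.mean₂ o J N u overlap)))) u := by
  refine (HasDerivAt.fun_sum fun z _ =>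
    (hasDerivAt_log_angleExpo hD hN z u).const_mul (D.wt z)).congr_deriv ?_
  have h1 := sum_wt (D := D) (N := N)
  simp only [mean, mean₁, mean₂]
  set sc := Real.sin u * Real.cos u
  have e1 : (Fintype.card (D.Cpl N) : ℝ) = ∑ z : D.Data N, D.wt z * Fintype.card (D.Cpl N) := by
    rw [← Finset.sum_mul, h1, one_mul]
  have e2 : (1 : ℝ) = ∑ z : D.Data N, D.wt z * 1 := by
    rw [← Finset.sum_mul, h1, one_mul]
  conv_rhs => enter [2, 2, 1, 1, 2, 2, 1, 1]; rw [e1]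
  conv_rhs => enter [2, 2, 1, 2, 2, 1, 1]; rw [e2]
  conv_rhs => enter [2, 2, 2, 2, 1]; rw [e2]
  simp only [Finset.mul_sum, ← Finset.sum_sub_distrib, ← Finset.sum_add_distrib]
  exact Finset.sum_congr rfl fun z _ => by ring

end Derivative

/-! ### One-site averages -/

section OneSite

lemma continuous_real_tanh : Continuous Real.tanh := by
  have : Real.tanh = fun x => Real.sinh x / Real.cosh x := funext Real.tanh_eq_sinh_div_cosh
  rw [this]
  exact Real.continuous_sinh.div Real.continuous_cosh fun x => (Real.cosh_pos x).ne'

lemma abs_real_tanh_le_one (x : ℝ) : |Real.tanh x| ≤ 1 := by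
  rw [Real.tanh_eq_sinh_div_cosh, abs_div, abs_of_pos (Real.cosh_pos x),
    div_le_one (Real.cosh_pos x), abs_le]
  constructor <;> rw [Real.sinh_eq, Real.cosh_eq] <;>
    linarith [Real.exp_pos x, Real.exp_pos (-x)]

lemma cosh_le_exp_abs (x : ℝ) : Real.cosh x ≤ Real.exp |x| := by
  rw [Real.cosh_eq]
  linarith [Real.exp_le_exp.2 (le_abs_self x), Real.exp_le_exp.2 (neg_le_abs x)]

/-- `𝔼 cosh^θ (μ + y₁ a + y₂ b)`, with the average over the Gaussian `y₂`. -/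
def cpow (θ μ a b y₁ : ℝ) : ℝ := EG fun y₂ => Real.cosh (μ + y₁ * a + y₂ * b) ^ θ

/-- The average of `h` over the Gaussian `y₂`, tilted by `cosh^θ`, at the field `μ + y₁ a + y₂ b`. -/
def ctilt (θ : ℝ) (h : ℝ → ℝ) (μ a b y₁ : ℝ) : ℝ :=
  (EG fun y₂ => Real.cosh (μ + y₁ * a + y₂ * b) ^ θ * h (μ + y₁ * a + y₂ * b)) / cpow θ μ a b y₁

variable {θ : ℝ} {h : ℝ → ℝ}

lemma cosh_rpow_pos (θ x : ℝ) : 0 < Real.cosh x ^ θ := Real.rpow_pos_of_pos (Real.cosh_pos x) _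

lemma continuous_cosh_rpow (θ : ℝ) : Continuous fun x => Real.cosh x ^ θ :=
  Real.continuous_cosh.rpow_const fun x => Or.inl (Real.cosh_pos x).ne'

lemma one_le_cosh_rpow (h0 : 0 ≤ θ) (x : ℝ) : 1 ≤ Real.cosh x ^ θ :=
  Real.one_le_rpow (Real.one_le_cosh x) h0

lemma cosh_rpow_le (h1 : θ ≤ 1) {A B : ℝ} (μ a b y₁ y₂ : ℝ) (hA : |μ + y₁ * a| ≤ A)
    (hB : |b| ≤ B) :
    Real.cosh (μ + y₁ * a + y₂ * b) ^ θ ≤ Real.exp A * Real.exp (B * |y₂|) := by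
  have e1 : Real.cosh (μ + y₁ * a + y₂ * b) ^ θ ≤ Real.cosh (μ + y₁ * a + y₂ * b) := by
    simpa using Real.rpow_le_rpow_of_exponent_le (Real.one_le_cosh _) h1
  refine e1.trans ((cosh_le_exp_abs _).trans ?_)
  rw [← Real.exp_add, Real.exp_le_exp]
  refine (abs_add_le _ _).trans (add_le_add hA ?_)
  rw [abs_mul, mul_comm]
  exact mul_le_mul_of_nonneg_right hB (abs_nonneg _)

lemma integrable_cosh_rpow_mul (h1 : θ ≤ 1) (hh : Measurable h) {B : ℝ} (hB : ∀ x, |h x| ≤ B)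
    (μ a b y₁ : ℝ) :
    Integrable (fun y₂ => Real.cosh (μ + y₁ * a + y₂ * b) ^ θ * h (μ + y₁ * a + y₂ * b))
      (gaussianReal 0 1) := by
  have hB0 : 0 ≤ B := (abs_nonneg _).trans (hB 0)
  have := (continuous_cosh_rpow θ).measurable
  refine ((integrable_exp_abs_gaussian |b|).const_mul (Real.exp |μ + y₁ * a| * B)).mono'
    (by fun_prop) (ae_of_all _ fun y₂ => ?_)
  rw [Real.norm_eq_abs, abs_mul, abs_of_pos (cosh_rpow_pos _ _), mul_right_comm]
  exact mul_le_mul (cosh_rpow_le h1 μ a b y₁ y₂ le_rfl le_rfl) (hB _) (abs_nonneg _)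
    (by positivity)

lemma integrable_cosh_rpow (h1 : θ ≤ 1) (μ a b y₁ : ℝ) :
    Integrable (fun y₂ => Real.cosh (μ + y₁ * a + y₂ * b) ^ θ) (gaussianReal 0 1) := by
  simpa using integrable_cosh_rpow_mul h1 (h := fun _ => 1) measurable_const (B := 1) (by simp)
    μ a b y₁

lemma one_le_cpow (h0 : 0 ≤ θ) (h1 : θ ≤ 1) (μ a b y₁ : ℝ) : 1 ≤ cpow θ μ a b y₁ := by
  have := integral_mono (μ := gaussianReal 0 1) (integrable_const 1)
    (integrable_cosh_rpow h1 μ a b y₁) fun y₂ => one_le_cosh_rpow h0 _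
  simpa [cpow, EG] using this

lemma cpow_pos (h0 : 0 ≤ θ) (h1 : θ ≤ 1) (μ a b y₁ : ℝ) : 0 < cpow θ μ a b y₁ :=
  one_pos.trans_le (one_le_cpow h0 h1 μ a b y₁)

lemma measurable_cpow (θ μ a b : ℝ) : Measurable (cpow θ μ a b) := by
  have := (continuous_cosh_rpow θ).measurable
  exact (StronglyMeasurable.integral_prod_right' (ν := gaussianReal 0 1)
    (f := fun q : ℝ × ℝ => Real.cosh (μ + q.1 * a + q.2 * b) ^ θ)
    (by fun_prop : Measurable _).stronglyMeasurable).measurable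

lemma measurable_ctilt (θ : ℝ) (hh : Measurable h) (μ a b : ℝ) :
    Measurable (ctilt θ h μ a b) := by
  have := (continuous_cosh_rpow θ).measurable
  exact (StronglyMeasurable.integral_prod_right' (ν := gaussianReal 0 1)
    (f := fun q : ℝ × ℝ => Real.cosh (μ + q.1 * a + q.2 * b) ^ θ * h (μ + q.1 * a + q.2 * b))
    (by fun_prop : Measurable _).stronglyMeasurable).measurable.div (measurable_cpow θ μ a b)

lemma abs_ctilt_le (h0 : 0 ≤ θ) (h1 : θ ≤ 1) {B : ℝ} (hB : ∀ x, |h x| ≤ B) (μ a b y₁ : ℝ) :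
    |ctilt θ h μ a b y₁| ≤ B := by
  have hp := cpow_pos h0 h1 μ a b y₁
  rw [ctilt, abs_div, abs_of_pos hp, div_le_iff₀ hp, cpow, EG, EG, ← integral_const_mul,
    ← Real.norm_eq_abs]
  refine norm_integral_le_of_norm_le ((integrable_cosh_rpow h1 μ a b y₁).const_mul B)
    (ae_of_all _ fun y => ?_)
  rw [Real.norm_eq_abs, abs_mul, abs_of_pos (cosh_rpow_pos _ _), mul_comm]
  exact mul_le_mul_of_nonneg_right (hB _) (cosh_rpow_pos _ _).le

/-- The tilted average has nonnegative variance. -/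
lemma ctilt_tanh_sq_le (h0 : 0 ≤ θ) (h1 : θ ≤ 1) (μ a b y₁ : ℝ) :
    ctilt θ Real.tanh μ a b y₁ ^ 2 ≤ ctilt θ (fun x => Real.tanh x ^ 2) μ a b y₁ := by
  have hp := cpow_pos h0 h1 μ a b y₁
  set m := ctilt θ Real.tanh μ a b y₁ with hm
  have i0 := integrable_cosh_rpow h1 μ a b y₁
  have i1 := integrable_cosh_rpow_mul h1 continuous_real_tanh.measurable abs_real_tanh_le_one
    μ a b y₁
  have i2 := integrable_cosh_rpow_mul h1 (h := fun x => Real.tanh x ^ 2)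
    (continuous_real_tanh.pow 2).measurable (B := 1) (fun x => by
      rw [abs_pow]; exact pow_le_one₀ (abs_nonneg _) (abs_real_tanh_le_one x)) μ a b y₁
  have hnn : 0 ≤ ∫ y₂, Real.cosh (μ + y₁ * a + y₂ * b) ^ θ
      * (Real.tanh (μ + y₁ * a + y₂ * b) - m) ^ 2 ∂(gaussianReal 0 1) :=
    integral_nonneg fun y => mul_nonneg (cosh_rpow_pos _ _).le (sq_nonneg _)
  have hexp : ∫ y₂, Real.cosh (μ + y₁ * a + y₂ * b) ^ θ
      * (Real.tanh (μ + y₁ * a + y₂ * b) - m) ^ 2 ∂(gaussianReal 0 1)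
      = ctilt θ (fun x => Real.tanh x ^ 2) μ a b y₁ * cpow θ μ a b y₁
        - 2 * m * (m * cpow θ μ a b y₁) + m ^ 2 * cpow θ μ a b y₁ := by
    have e1 : m * cpow θ μ a b y₁ = EG fun y₂ => Real.cosh (μ + y₁ * a + y₂ * b) ^ θ
        * Real.tanh (μ + y₁ * a + y₂ * b) := by rw [hm, ctilt, div_mul_cancel₀ _ hp.ne']
    rw [e1, ctilt, div_mul_cancel₀ _ hp.ne', cpow, EG, EG, EG, ← integral_const_mul,
      ← integral_const_mul, ← integral_sub i2 (i1.const_mul _)]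
    have h3 := integral_add (i2.sub (i1.const_mul (2 * m))) (i0.const_mul (m ^ 2))
    simp only [Pi.sub_apply] at h3
    rw [← h3]
    congr 1; ext y; ring
  rw [hexp] at hnn
  have : 0 ≤ (ctilt θ (fun x => Real.tanh x ^ 2) μ a b y₁ - m ^ 2) * cpow θ μ a b y₁ := by
    linarith
  have := nonneg_of_mul_nonneg_left this hp
  linarith

/-! #### Continuity in the parameters of the field -/

section Continuity

variable {T : Type*} {l : Filter T} {μs as bs : T → ℝ} {μ a b : ℝ}

lemma eventually_abs_le (hμ : Tendsto μs l (𝓝 μ)) : ∀ᶠ t in l, |μs t| ≤ |μ| + 1 :=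
  (hμ.abs.eventually_lt_const (lt_add_one _)).mono fun _ h => h.le

variable [l.IsCountablyGenerated]

lemma tendsto_EG_cosh_mul (h1 : θ ≤ 1) (hh : Continuous h) {B : ℝ} (hB : ∀ x, |h x| ≤ B)
    (hμ : Tendsto μs l (𝓝 μ)) (ha : Tendsto as l (𝓝 a)) (hb : Tendsto bs l (𝓝 b)) (y₁ : ℝ) :
    Tendsto (fun t => EG fun y₂ => Real.cosh (μs t + y₁ * as t + y₂ * bs t) ^ θ
        * h (μs t + y₁ * as t + y₂ * bs t)) l
      (𝓝 (EG fun y₂ => Real.cosh (μ + y₁ * a + y₂ * b) ^ θ * h (μ + y₁ * a + y₂ * b))) := by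
  have hB0 : 0 ≤ B := (abs_nonneg _).trans (hB 0)
  have hc := continuous_cosh_rpow θ
  have hcm := hc.measurable
  have hhm := hh.measurable
  refine tendsto_integral_filter_of_dominated_convergence
    (fun y₂ => Real.exp (|μ| + 1 + |y₁| * (|a| + 1)) * Real.exp ((|b| + 1) * |y₂|) * B)
    (Eventually.of_forall fun t => by fun_prop) ?_
    (((integrable_exp_abs_gaussian _).const_mul _).mul_const _) (ae_of_all _ fun y₂ => ?_)
  · filter_upwards [eventually_abs_le hμ, eventually_abs_le ha, eventually_abs_le hb]
      with t e1 e2 e3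
    refine ae_of_all _ fun y₂ => ?_
    rw [Real.norm_eq_abs, abs_mul, abs_of_pos (cosh_rpow_pos _ _)]
    refine mul_le_mul (cosh_rpow_le h1 _ _ _ _ _ ?_ e3) (hB _) (abs_nonneg _) (by positivity)
    refine (abs_add_le _ _).trans (add_le_add e1 ?_)
    rw [abs_mul]
    exact mul_le_mul_of_nonneg_left e2 (abs_nonneg _)
  · have ht : Tendsto (fun t => μs t + y₁ * as t + y₂ * bs t) l (𝓝 (μ + y₁ * a + y₂ * b)) :=
      (hμ.add (ha.const_mul _)).add (hb.const_mul _)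
    exact ((hc.tendsto _).comp ht).mul ((hh.tendsto _).comp ht)

lemma tendsto_cpow (h1 : θ ≤ 1) (hμ : Tendsto μs l (𝓝 μ)) (ha : Tendsto as l (𝓝 a))
    (hb : Tendsto bs l (𝓝 b)) (y₁ : ℝ) :
    Tendsto (fun t => cpow θ (μs t) (as t) (bs t) y₁) l (𝓝 (cpow θ μ a b y₁)) := by
  simpa [cpow] using tendsto_EG_cosh_mul h1 (h := fun _ => 1) continuous_const (B := 1) (by simp)
    hμ ha hb y₁

lemma tendsto_ctilt (h0 : 0 ≤ θ) (h1 : θ ≤ 1) (hh : Continuous h) {B : ℝ} (hB : ∀ x, |h x| ≤ B)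
    (hμ : Tendsto μs l (𝓝 μ)) (ha : Tendsto as l (𝓝 a)) (hb : Tendsto bs l (𝓝 b)) (y₁ : ℝ) :
    Tendsto (fun t => ctilt θ h (μs t) (as t) (bs t) y₁) l (𝓝 (ctilt θ h μ a b y₁)) :=
  (tendsto_EG_cosh_mul h1 hh hB hμ ha hb y₁).div (tendsto_cpow h1 hμ ha hb y₁)
    (cpow_pos h0 h1 _ _ _ _).ne'

lemma tendsto_EG_ctilt_pow (h0 : 0 ≤ θ) (h1 : θ ≤ 1) (hh : Continuous h) (hB : ∀ x, |h x| ≤ 1)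
    (hμ : Tendsto μs l (𝓝 μ)) (ha : Tendsto as l (𝓝 a)) (hb : Tendsto bs l (𝓝 b)) (k : ℕ) :
    Tendsto (fun t => EG fun y₁ => ctilt θ h (μs t) (as t) (bs t) y₁ ^ k) l
      (𝓝 (EG fun y₁ => ctilt θ h μ a b y₁ ^ k)) := by
  refine tendsto_integral_filter_of_dominated_convergence (fun _ => 1)
    (Eventually.of_forall fun t =>
      ((measurable_ctilt θ hh.measurable _ _ _).pow_const k).aestronglyMeasurable)
    (Eventually.of_forall fun t => ae_of_all _ fun y₁ => ?_) (integrable_const _)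
    (ae_of_all _ fun y₁ => (tendsto_ctilt h0 h1 hh hB hμ ha hb y₁).pow k)
  rw [Real.norm_eq_abs, abs_pow]
  exact pow_le_one₀ (abs_nonneg _) (abs_ctilt_le h0 h1 hB _ _ _ _)

lemma abs_log_cpow_le (h0 : 0 ≤ θ) (h1 : θ ≤ 1) {A₀ A B : ℝ} (hμ : |μ| ≤ A₀) (ha : |a| ≤ A)
    (hb : |b| ≤ B) (y₁ : ℝ) :
    |Real.log (cpow θ μ a b y₁)|
      ≤ A₀ + A * |y₁| + Real.log (EG fun y₂ => Real.exp (B * |y₂|)) := by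
  have hK : 0 < EG fun y₂ => Real.exp (B * |y₂|) := integral_exp_pos (integrable_exp_abs_gaussian B)
  rw [abs_of_nonneg (Real.log_nonneg (one_le_cpow h0 h1 _ _ _ _))]
  have : cpow θ μ a b y₁ ≤ Real.exp (A₀ + A * |y₁|) * EG fun y₂ => Real.exp (B * |y₂|) := by
    rw [cpow, EG, EG, ← integral_const_mul]
    refine integral_mono (integrable_cosh_rpow h1 _ _ _ _)
      ((integrable_exp_abs_gaussian B).const_mul _) fun y₂ => ?_
    refine cosh_rpow_le h1 _ _ _ _ _ ((abs_add_le _ _).trans (add_le_add hμ ?_)) hb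
    rw [abs_mul, mul_comm]
    exact mul_le_mul_of_nonneg_right ha (abs_nonneg _)
  have := Real.log_le_log (cpow_pos h0 h1 _ _ _ _) this
  rwa [Real.log_mul (Real.exp_pos _).ne' hK.ne', Real.log_exp] at this

lemma integrable_abs_gaussian : Integrable (fun y : ℝ => |y|) (gaussianReal 0 1) := by
  refine (integrable_exp_abs_gaussian 1).mono' (by fun_prop) (ae_of_all _ fun y => ?_)
  rw [Real.norm_eq_abs, abs_abs, one_mul]
  linarith [Real.add_one_le_exp |y|]

lemma integrable_log_bound (A₀ A K : ℝ) :
    Integrable (fun y : ℝ => A₀ + A * |y| + K) (gaussianReal 0 1) :=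
  ((integrable_const _).add (integrable_abs_gaussian.const_mul _)).add (integrable_const _)

lemma integrable_log_cpow (h0 : 0 ≤ θ) (h1 : θ ≤ 1) (μ a b : ℝ) :
    Integrable (fun y₁ => Real.log (cpow θ μ a b y₁)) (gaussianReal 0 1) :=
  (integrable_log_bound |μ| |a| _).mono' (measurable_cpow θ μ a b).log.aestronglyMeasurable
    (ae_of_all _ fun y₁ => abs_log_cpow_le h0 h1 le_rfl le_rfl (le_refl |b|) y₁)

lemma tendsto_EG_log_cpow (h0 : 0 ≤ θ) (h1 : θ ≤ 1)
    (hμ : Tendsto μs l (𝓝 μ)) (ha : Tendsto as l (𝓝 a)) (hb : Tendsto bs l (𝓝 b)) :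
    Tendsto (fun t => EG fun y₁ => Real.log (cpow θ (μs t) (as t) (bs t) y₁)) l
      (𝓝 (EG fun y₁ => Real.log (cpow θ μ a b y₁))) := by
  refine tendsto_integral_filter_of_dominated_convergence _
    (Eventually.of_forall fun t => (measurable_cpow θ _ _ _).log.aestronglyMeasurable) ?_
    (integrable_log_bound (|μ| + 1) (|a| + 1)
      (Real.log (EG fun y₂ => Real.exp ((|b| + 1) * |y₂|))))
    (ae_of_all _ fun y₁ => (tendsto_cpow h1 hμ ha hb y₁).log (cpow_pos h0 h1 _ _ _ _).ne')
  filter_upwards [eventually_abs_le hμ, eventually_abs_le ha, eventually_abs_le hb] with t e1 e2 e3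
  exact ae_of_all _ fun y₁ => abs_log_cpow_le h0 h1 e1 e2 e3 y₁

end Continuity

end OneSite

/-! ### The two ends of the interpolation -/

section Ends

variable {D : Model} {N : ℕ} {o : OrderParams} {J : ℝ}

lemma rho_nonneg (hD : D.Admissible) : 0 ≤ D.ρ := by
  have h1 := hD.r_pos
  have h2 : D.r ^ 2 ≤ 1 := pow_le_one₀ h1.le hD.r_le_one
  unfold ρ
  exact div_nonneg (by linarith) (by positivity)

lemma interp_eq (hD : D.Admissible) {u : ℝ} (hs : 0 ≤ Real.sin u) (hc : 0 ≤ Real.cos u) :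
    D.interp o J N u = D.E0 fun d : D.Disorder N => EY fun Y₁ =>
      Real.log (EY fun Y₂ => Z₂ o J (Real.sin u ^ 2) d Y₁ Y₂ ^ D.θ) := by
  refine (E0_EY_eq (G := fun z w => Real.log (avgPow D.θ (D.angleExpo o J z u w)))
    (fun z lam Y₁ => ?_) fun z => ?_).symm
  · simp only [avgPow, pf_angleExpo hs hc]
    rfl
  · obtain ⟨B, hB⟩ := abs_log_avgPow_expo_le hD.θ_pos.le hD.θ_le_one (D.detPart o J z u)
      (D.outCoeff o (Real.sin u) (Real.cos u)) (D.inCoeff o (Real.cos u))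
    exact integrable_of_le_linear
      (regular_angleExpo z u).measurable_avgPow.log.aestronglyMeasurable hB

lemma boltzI_one (hD : D.Admissible) (hN : N ≠ 0) (d : D.Disorder N) (Y₁ Y₂ : Fin N → ℝ)
    (σ : Fin N → Spin) : boltzI o J 1 d Y₁ Y₂ σ = boltz d J σ := by
  have hN' : (N : ℝ) ≠ 0 := by exact_mod_cast hN
  have hr := hD.r_pos
  have hρ : 0 < 1 + D.ρ := by linarith [rho_nonneg hD]
  obtain ⟨P, hP⟩ : ∃ P, D.P = P + 1 := ⟨D.P - 1, by have := hD.two_le_P; omega⟩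
  have hM : (D.M : ℝ) ≠ 0 := by
    have := hD.one_le_M
    exact_mod_cast (by omega : D.M ≠ 0)
  rw [boltzI, boltz]
  congr 1
  have e1 : ∀ a, mattisEx d a σ ^ D.P
      = (D.r / D.R) ^ D.P * (1 / N) ^ D.P * (∑ i, sv (d.η a i) * sv (σ i)) ^ D.P := fun a => by
    rw [mattisEx, mul_pow, mul_pow]
  simp only [e1, ← Finset.mul_sum, sub_self, Real.sqrt_zero, Real.sqrt_one, zero_mul, mul_zero,
    add_zero, one_mul]
  congr 2
  set x := (1 + D.ρ) ^ ((D.P : ℝ) / 2) with hx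
  have hx0 : 0 < x := Real.rpow_pos_of_pos hρ _
  have hx2 : (1 + D.ρ) ^ D.P = x * x := by
    rw [hx, ← Real.rpow_add hρ, add_halves, Real.rpow_natCast]
  have hR : D.R ^ ((D.P : ℝ) / 2) = D.r ^ D.P * x := by
    rw [R, Real.mul_rpow (by positivity) hρ.le, ← Real.rpow_natCast D.r 2, ← Real.rpow_mul hr.le,
      Nat.cast_ofNat, mul_div_cancel₀ _ two_ne_zero, Real.rpow_natCast]
  have hRP : D.R ^ D.P = D.r ^ D.P * D.r ^ D.P * (x * x) := by
    rw [R, mul_pow, hx2]; ring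
  rw [hR, div_pow, hRP, div_pow, one_pow]
  have hrP : D.r ^ D.P ≠ 0 := (pow_pos hr _).ne'
  rw [hP, Nat.add_sub_cancel, pow_succ (N : ℝ)]
  rw [hP] at hrP
  field_simp

/-- At the end `t = 1` the interpolation reaches the model. -/
lemma interp_pi_div_two (hD : D.Admissible) (hN : N ≠ 0) :
    D.interp o J N (Real.pi / 2) = D.θ * D.E0 fun d : D.Disorder N => Real.log (Z d J) := by
  rw [interp_eq hD (by simp) (by simp), Real.sin_pi_div_two, one_pow]
  have e : ∀ (d : D.Disorder N) Y₁ Y₂, Z₂ o J 1 d Y₁ Y₂ = Z d J := fun d Y₁ Y₂ =>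
    Finset.sum_congr rfl fun σ _ => boltzI_one hD hN d Y₁ Y₂ σ
  have hZ : ∀ d : D.Disorder N, 0 < Z d J := fun d =>
    Finset.sum_pos (fun _ _ => Real.exp_pos _) Finset.univ_nonempty
  simp only [e, EY, integral_const, probReal_univ, one_smul, Real.log_rpow (hZ _)]
  simp only [E0_eq, integral_const_mul, Finset.mul_sum]
  exact Finset.sum_congr rfl fun z _ => by ring

/-! #### Factorisation over the sites at `t = 0` -/

variable (D o J) in
/-- The deterministic part of the one-site field, with source `J`. -/
def siteField (x : Spin) (e : Fin D.M → Spin) : ℝ :=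
  J * sv x + D.β' * (D.P / 2) * o.n ^ (D.P - 1) * (1 + D.ρ) ^ ((D.P : ℝ) / 2 - 1) * D.etaHat e

variable (o J) in
/-- The field at site `i` in the one-body system. -/
def fieldAt (d : D.Disorder N) (Y₁ Y₂ : Fin N → ℝ) (i : Fin N) : ℝ :=
  D.siteField o J (d.ξ i) (fun a => d.η a i) + Y₁ i * D.A₁ o + Y₂ i * D.A₂ o

lemma boltzI_zero (hD : D.Admissible) (hN : N ≠ 0) (d : D.Disorder N) (Y₁ Y₂ : Fin N → ℝ)
    (σ : Fin N → Spin) :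
    boltzI o J 0 d Y₁ Y₂ σ = ∏ i, Real.exp (fieldAt o J d Y₁ Y₂ i * sv (σ i)) := by
  have hN' : (N : ℝ) ≠ 0 := by exact_mod_cast hN
  have hr := hD.r_pos
  have hρ : 0 < 1 + D.ρ := by linarith [rho_nonneg hD]
  have hM : (D.M : ℝ) ≠ 0 := by
    have := hD.one_le_M
    exact_mod_cast (by omega : D.M ≠ 0)
  rw [boltzI, ← Real.exp_sum]
  congr 1
  have e1 : D.ψ o * (1 - 0) * N * ∑ a, mattisEx d a σ
      = ∑ i, D.β' * (D.P / 2) * o.n ^ (D.P - 1) * (1 + D.ρ) ^ ((D.P : ℝ) / 2 - 1)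
        * D.etaHat (fun a => d.η a i) * sv (σ i) := by
    have h1 : ∀ a, mattisEx d a σ = ∑ i, D.r / D.R * (1 / N) * (sv (d.η a i) * sv (σ i)) :=
      fun a => by rw [mattisEx, Finset.mul_sum]
    simp only [h1]
    rw [Finset.sum_comm, Finset.mul_sum]
    refine Finset.sum_congr rfl fun i _ => ?_
    rw [etaHat, ← Finset.mul_sum, ← Finset.sum_mul, Real.rpow_sub_one hρ.ne', ψ, R]
    field_simp
    ring
  rw [e1]
  simp only [fieldAt, siteField, Real.sqrt_zero, sub_zero, Real.sqrt_one, zero_mul, zero_div,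
    Finset.sum_const_zero, add_zero, one_mul, Finset.mul_sum, add_mul, ← Finset.sum_add_distrib]
  exact Finset.sum_congr rfl fun i _ => by ring

/-- Sites are independent under a product weight on configurations. -/
lemma sum_prod_spin (f : Fin N → Spin → ℝ) :
    ∑ σ : Fin N → Spin, ∏ i, f i (σ i) = ∏ i, (f i 1 + f i (-1)) := by
  have h := Finset.prod_univ_sum (fun _ : Fin N => (Finset.univ : Finset Spin)) f
  rw [Fintype.piFinset_univ] at h
  rw [← h]
  exact Finset.prod_congr rfl fun i _ => sum_spin _

lemma exp_add_exp_neg (x : ℝ) : Real.exp x + Real.exp (-x) = 2 * Real.cosh x := by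
  rw [Real.cosh_eq]; ring

lemma exp_sub_exp_neg (x : ℝ) : Real.exp x - Real.exp (-x) = 2 * Real.cosh x * Real.tanh x := by
  rw [Real.tanh_eq_sinh_div_cosh, mul_assoc, mul_div_cancel₀ _ (Real.cosh_pos x).ne',
    Real.sinh_eq]; ring

lemma Z₂_zero (hD : D.Admissible) (hN : N ≠ 0) (d : D.Disorder N) (Y₁ Y₂ : Fin N → ℝ) :
    Z₂ o J 0 d Y₁ Y₂ = ∏ i, 2 * Real.cosh (fieldAt o J d Y₁ Y₂ i) := by
  simp only [Z₂, boltzI_zero hD hN,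
    sum_prod_spin fun i s => Real.exp (fieldAt o J d Y₁ Y₂ i * sv s), sv_one, sv_neg_one, mul_one,
    mul_neg, exp_add_exp_neg]

/-- The Gibbs average of one spin in the one-body system. -/
lemma sum_gibbsI_zero (hD : D.Admissible) (hN : N ≠ 0) (d : D.Disorder N) (Y₁ Y₂ : Fin N → ℝ)
    (j : Fin N) :
    ∑ σ, gibbsI o J 0 d Y₁ Y₂ σ * sv (σ j) = Real.tanh (fieldAt o J d Y₁ Y₂ j) := by
  have h1 : ∀ σ, gibbsI o J 0 d Y₁ Y₂ σ * sv (σ j)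
      = ∏ i, Real.exp (fieldAt o J d Y₁ Y₂ i * sv (σ i)) / (2 * Real.cosh (fieldAt o J d Y₁ Y₂ i))
        * if i = j then sv (σ i) else 1 := fun σ => by
    rw [Finset.prod_mul_distrib, Finset.prod_ite_eq' Finset.univ j, if_pos (Finset.mem_univ j),
      Finset.prod_div_distrib, gibbsI, boltzI_zero hD hN, Z₂_zero hD hN]
  have h2 : ∀ i, (2 * Real.cosh (fieldAt o J d Y₁ Y₂ i)) ≠ 0 := fun i =>
    (mul_pos two_pos (Real.cosh_pos _)).ne'
  simp only [h1]
  rw [sum_prod_spin fun i s => Real.exp (fieldAt o J d Y₁ Y₂ i * sv s)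
    / (2 * Real.cosh (fieldAt o J d Y₁ Y₂ i)) * if i = j then sv s else 1]
  rw [Finset.prod_eq_single j]
  · simp only [if_true, sv_one, sv_neg_one, mul_one, mul_neg]
    rw [← sub_eq_add_neg, ← sub_div, exp_sub_exp_neg, mul_div_cancel_left₀ _ (h2 j)]
  · intro i _ hij
    simp only [if_neg hij, sv_one, sv_neg_one, mul_one, mul_neg]
    rw [← add_div, exp_add_exp_neg, div_self (h2 i)]
  · simp

lemma EY_Z₂_zero (hD : D.Admissible) (hN : N ≠ 0) (d : D.Disorder N) (Y₁ : Fin N → ℝ) :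
    (EY fun Y₂ => Z₂ o J 0 d Y₁ Y₂ ^ D.θ) = ∏ i, 2 ^ D.θ *
      cpow D.θ (D.siteField o J (d.ξ i) fun a => d.η a i) (D.A₁ o) (D.A₂ o) (Y₁ i) := by
  have h1 : ∀ Y₂, Z₂ o J 0 d Y₁ Y₂ ^ D.θ
      = ∏ i, 2 ^ D.θ * Real.cosh (D.siteField o J (d.ξ i) (fun a => d.η a i)
        + Y₁ i * D.A₁ o + Y₂ i * D.A₂ o) ^ D.θ := fun Y₂ => by
    rw [Z₂_zero hD hN, ← Real.finsetProd_rpow _ _ fun i _ =>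
      (mul_pos two_pos (Real.cosh_pos _)).le]
    exact Finset.prod_congr rfl fun i _ => Real.mul_rpow two_pos.le (Real.cosh_pos _).le
  simp only [EY, h1]
  rw [integral_fintype_prod_eq_prod (fun i y => (2 : ℝ) ^ D.θ *
    Real.cosh (D.siteField o J (d.ξ i) (fun a => d.η a i) + Y₁ i * D.A₁ o + y * D.A₂ o) ^ D.θ)]
  simp only [integral_const_mul]
  rfl

/-- In the one-body system a function of the field at one site has the one-site tilted average. -/
lemma EY_W₂_zero (hD : D.Admissible) (hN : N ≠ 0) (d : D.Disorder N) (Y₁ : Fin N → ℝ)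
    (j : Fin N) (h : ℝ → ℝ) :
    (EY fun Y₂ => W₂ o J 0 d Y₁ Y₂ * h (fieldAt o J d Y₁ Y₂ j))
      = ctilt D.θ h (D.siteField o J (d.ξ j) fun a => d.η a j) (D.A₁ o) (D.A₂ o) (Y₁ j) := by
  set c : Fin N → ℝ := fun i =>
    cpow D.θ (D.siteField o J (d.ξ i) fun a => d.η a i) (D.A₁ o) (D.A₂ o) (Y₁ i) with hc
  have hc0 : ∀ i, c i ≠ 0 := fun i => (cpow_pos hD.θ_pos.le hD.θ_le_one _ _ _ _).ne'
  have h2 : (0 : ℝ) < 2 ^ D.θ := Real.rpow_pos_of_pos two_pos _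
  have h1 : ∀ Y₂, W₂ o J 0 d Y₁ Y₂ * h (fieldAt o J d Y₁ Y₂ j)
      = ∏ i, (Real.cosh (fieldAt o J d Y₁ Y₂ i) ^ D.θ
        * if i = j then h (fieldAt o J d Y₁ Y₂ i) else 1) / c i := fun Y₂ => by
    have hW : W₂ o J 0 d Y₁ Y₂ = ∏ i, Real.cosh (fieldAt o J d Y₁ Y₂ i) ^ D.θ / c i := by
      rw [W₂, EY_Z₂_zero hD hN, Z₂_zero hD hN, ← Real.finsetProd_rpow _ _ fun i _ =>
        (mul_pos two_pos (Real.cosh_pos _)).le, ← Finset.prod_div_distrib]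
      refine Finset.prod_congr rfl fun i _ => ?_
      rw [Real.mul_rpow two_pos.le (Real.cosh_pos _).le, mul_div_mul_left _ _ h2.ne']
    have hj : ∏ i, (if i = j then h (fieldAt o J d Y₁ Y₂ i) else 1)
        = h (fieldAt o J d Y₁ Y₂ j) := by
      rw [Finset.prod_ite_eq' Finset.univ j, if_pos (Finset.mem_univ j)]
    rw [hW, ← hj, ← Finset.prod_mul_distrib]
    exact Finset.prod_congr rfl fun i _ => div_mul_eq_mul_div _ _ _
  simp only [EY, h1]
  simp only [fieldAt]
  rw [integral_fintype_prod_eq_prod (fun i y =>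
    (Real.cosh (D.siteField o J (d.ξ i) (fun a => d.η a i) + Y₁ i * D.A₁ o + y * D.A₂ o) ^ D.θ
      * if i = j then h (D.siteField o J (d.ξ i) (fun a => d.η a i) + Y₁ i * D.A₁ o + y * D.A₂ o)
        else 1) / c i)]
  rw [Finset.prod_eq_single j]
  · simp only [if_true, integral_div]
    rfl
  · intro i _ hij
    simp only [if_neg hij, mul_one, integral_div]
    exact div_self (hc0 i)
  · simp

lemma E0_const_lam (G : D.Data N → ℝ) :
    (D.E0 fun d : D.Disorder N => G (d.ξ, d.η)) = ∑ z, D.wt z * G z := by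
  simp [E0_eq]

/-- The average of a function of the disorder at one site. -/
lemma E0_EY_site (j : Fin N) {f : Spin → (Fin D.M → Spin) → ℝ → ℝ}
    (hf : ∀ x e, Measurable (f x e)) :
    (D.E0 fun d : D.Disorder N => EY fun Y => f (d.ξ j) (fun a => d.η a j) (Y j))
      = D.Esite fun x e => EG (f x e) := by
  rw [E0_const_lam fun z : D.Data N => EY fun Y => f (z.1 j) (fun a => z.2 a j) (Y j),
    ← sum_wt_mul_site (N := N) j]
  refine Finset.sum_congr rfl fun z _ => ?_
  congr 1
  exact integral_comp_eval (μ := fun _ : Fin N => gaussianReal 0 1) (i := j)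
    (f := f (z.1 j) fun a => z.2 a j) (hf _ _).aestronglyMeasurable

/-- The logarithm of the partition function of the one-body system. -/
lemma interp_zero (hD : D.Admissible) (hN : N ≠ 0) :
    D.interp o J N 0 = N * (D.θ * Real.log 2 + D.Esite fun x e => EG fun y₁ =>
      Real.log (cpow D.θ (D.siteField o J x e) (D.A₁ o) (D.A₂ o) y₁)) := by
  have hθ := hD.θ_pos.le
  have hθ1 := hD.θ_le_one
  rw [interp_eq hD (by simp) (by simp), Real.sin_zero, zero_pow two_ne_zero]
  have h2 : (0 : ℝ) < 2 ^ D.θ := Real.rpow_pos_of_pos two_pos _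
  have h1 : ∀ (d : D.Disorder N) Y₁, Real.log (EY fun Y₂ => Z₂ o J 0 d Y₁ Y₂ ^ D.θ)
      = ∑ i, (D.θ * Real.log 2 + Real.log (cpow D.θ (D.siteField o J (d.ξ i) fun a => d.η a i)
        (D.A₁ o) (D.A₂ o) (Y₁ i))) := fun d Y₁ => by
    rw [EY_Z₂_zero hD hN, Real.log_prod fun i _ =>
      (mul_pos h2 (cpow_pos hθ hθ1 _ _ _ _)).ne']
    refine Finset.sum_congr rfl fun i _ => ?_
    rw [Real.log_mul h2.ne' (cpow_pos hθ hθ1 _ _ _ _).ne', Real.log_rpow two_pos]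
  simp only [h1]
  rw [E0_const_lam fun z : D.Data N => EY fun Y₁ => ∑ i, (D.θ * Real.log 2 + Real.log
    (cpow D.θ (D.siteField o J (z.1 i) fun a => z.2 a i) (D.A₁ o) (D.A₂ o) (Y₁ i)))]
  have h3 : ∀ z : D.Data N, (EY fun Y₁ => ∑ i, (D.θ * Real.log 2 + Real.log
      (cpow D.θ (D.siteField o J (z.1 i) fun a => z.2 a i) (D.A₁ o) (D.A₂ o) (Y₁ i))))
      = ∑ i, (D.θ * Real.log 2 + EG fun y₁ => Real.log
        (cpow D.θ (D.siteField o J (z.1 i) fun a => z.2 a i) (D.A₁ o) (D.A₂ o) y₁)) := fun z => by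
    have hi : ∀ i, Integrable (fun y₁ => D.θ * Real.log 2 + Real.log
      (cpow D.θ (D.siteField o J (z.1 i) fun a => z.2 a i) (D.A₁ o) (D.A₂ o) y₁))
      (gaussianReal 0 1) := fun i => (integrable_const _).add (integrable_log_cpow hθ hθ1 _ _ _)
    refine (integral_finsetSum _ fun i _ => integrable_comp_eval
      (μ := fun _ : Fin N => gaussianReal 0 1) (hi i)).trans ?_
    refine Finset.sum_congr rfl fun i _ => ?_
    rw [integral_comp_eval (μ := fun _ : Fin N => gaussianReal 0 1) (i := i)
      (hi i).aestronglyMeasurable, integral_add (integrable_const _)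
      (integrable_log_cpow hθ hθ1 _ _ _)]
    simp [EG]
  simp only [h3, Finset.mul_sum]
  rw [Finset.sum_comm]
  simp only [mul_add, Finset.sum_add_distrib, ← Finset.sum_mul, sum_wt,
    sum_wt_mul_site _ fun x e => EG fun y₁ => Real.log
      (cpow D.θ (D.siteField o J x e) (D.A₁ o) (D.A₂ o) y₁)]
  simp

end Ends

/-! ### Order parameters of the one-body system -/

section OneBody

variable {D : Model} {N : ℕ} {o : OrderParams} {J : ℝ}

lemma mean_zero_site (hD : D.Admissible) (hN : N ≠ 0) (j : Fin N)
    (c : Spin → (Fin D.M → Spin) → ℝ) :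
    D.mean o J N 0 (fun z σ => c (z.1 j) (fun a => z.2 a j) * sv (σ j))
      = D.Esite fun x e => EG fun y₁ =>
        ctilt D.θ Real.tanh (D.siteField o J x e) (D.A₁ o) (D.A₂ o) y₁ * c x e := by
  rw [← avgI_eq_mean hD.θ_pos.le hD.θ_le_one (by simp) (by simp),
    ← E0_EY_site (N := N) j fun x e =>
      (measurable_ctilt D.θ continuous_real_tanh.measurable _ _ _).mul_const _]
  have h1 : ∀ (d : D.Disorder N) Y₁, (EY fun Y₂ => W₂ o J 0 d Y₁ Y₂
      * ∑ σ, gibbsI o J 0 d Y₁ Y₂ σ * (c (d.ξ j) (fun a => d.η a j) * sv (σ j)))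
      = ctilt D.θ Real.tanh (D.siteField o J (d.ξ j) fun a => d.η a j) (D.A₁ o) (D.A₂ o) (Y₁ j)
        * c (d.ξ j) (fun a => d.η a j) := fun d Y₁ => by
    rw [← EY_W₂_zero hD hN, EY, EY, ← integral_mul_const]
    congr 1; ext Y₂
    rw [← sum_gibbsI_zero hD hN, mul_assoc, Finset.sum_mul]
    congr 1
    exact Finset.sum_congr rfl fun σ _ => by ring
  simp only [avgI, Real.sin_zero, zero_pow two_ne_zero, h1]

lemma mean_zero_linear (hD : D.Admissible) (hN : N ≠ 0) (c : Spin → (Fin D.M → Spin) → ℝ) :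
    D.mean o J N 0 (fun z σ => 1 / N * ∑ j, c (z.1 j) (fun a => z.2 a j) * sv (σ j))
      = D.Esite fun x e => EG fun y₁ =>
        ctilt D.θ Real.tanh (D.siteField o J x e) (D.A₁ o) (D.A₂ o) y₁ * c x e := by
  have hN' : (N : ℝ) ≠ 0 := by exact_mod_cast hN
  have hA := isAverage_mean (N := N) (o := o) (J := J) hD 0
  have h1 := hA.map_const_mul (1 / N) fun q => ∑ j, c (q.1.1 j) (fun a => q.1.2 a j) * sv (q.2 j)
  have h2 := hA.map_sum Finset.univ fun (j : Fin N) q =>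
    c (q.1.1 j) (fun a => q.1.2 a j) * sv (q.2 j)
  simp only at h1 h2
  rw [h1, h2]
  simp only [mean_zero_site hD hN, Finset.sum_const, Finset.card_univ, Fintype.card_fin,
    nsmul_eq_mul]
  field_simp

lemma mean_zero_mattis (hD : D.Admissible) (hN : N ≠ 0) :
    D.mean o J N 0 (fun z σ => mattis (D.base z) σ) = D.Esite fun x e => EG fun y₁ =>
      ctilt D.θ Real.tanh (D.siteField o J x e) (D.A₁ o) (D.A₂ o) y₁ * sv x :=
  mean_zero_linear hD hN fun x _ => sv x

lemma mean_zero_mattisEx (hD : D.Admissible) (hN : N ≠ 0) (a : Fin D.M) :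
    D.mean o J N 0 (fun z σ => mattisEx (D.base z) a σ) = D.Esite fun x e => EG fun y₁ =>
      ctilt D.θ Real.tanh (D.siteField o J x e) (D.A₁ o) (D.A₂ o) y₁ * (D.r / D.R * sv (e a)) := by
  rw [← mean_zero_linear hD hN fun _ e => D.r / D.R * sv (e a)]
  congr 1; ext z σ
  rw [mattisEx, mul_assoc, mul_left_comm, Finset.mul_sum]
  simp only [mul_assoc]

lemma mean₂_zero_site (hD : D.Admissible) (hN : N ≠ 0) (j : Fin N) :
    D.mean₂ o J N 0 (fun σ τ => sv (σ j) * sv (τ j)) = D.Esite fun x e => EG fun y₁ =>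
        ctilt D.θ (fun x => Real.tanh x ^ 2) (D.siteField o J x e) (D.A₁ o) (D.A₂ o) y₁ := by
  rw [← avgI₂_eq_mean₂ hD.θ_pos.le hD.θ_le_one (by simp) (by simp),
    ← E0_EY_site (N := N) j fun x e =>
      (measurable_ctilt D.θ (h := fun x => Real.tanh x ^ 2)
        (continuous_real_tanh.pow 2).measurable _ _ _)]
  have h1 : ∀ (d : D.Disorder N) Y₁, (EY fun Y₂ => W₂ o J 0 d Y₁ Y₂
      * ∑ σ, ∑ τ, gibbsI o J 0 d Y₁ Y₂ σ * gibbsI o J 0 d Y₁ Y₂ τ * (sv (σ j) * sv (τ j)))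
      = ctilt D.θ (fun x => Real.tanh x ^ 2) (D.siteField o J (d.ξ j) fun a => d.η a j) (D.A₁ o)
        (D.A₂ o) (Y₁ j) := fun d Y₁ => by
    rw [← EY_W₂_zero hD hN]
    congr 1; ext Y₂
    rw [← sum_gibbsI_zero hD hN, sq, Finset.sum_mul_sum]
    congr 1
    exact Finset.sum_congr rfl fun σ _ => Finset.sum_congr rfl fun τ _ => by ring
  simp only [avgI₂, Real.sin_zero, zero_pow two_ne_zero, h1]

lemma mean₁_zero_site (hD : D.Admissible) (hN : N ≠ 0) (j : Fin N) :
    D.mean₁ o J N 0 (fun σ τ => sv (σ j) * sv (τ j)) = D.Esite fun x e => EG fun y₁ =>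
        ctilt D.θ Real.tanh (D.siteField o J x e) (D.A₁ o) (D.A₂ o) y₁ ^ 2 := by
  rw [← E0_EY_site (N := N) j fun x e =>
      (measurable_ctilt D.θ continuous_real_tanh.measurable _ _ _).pow_const 2]
  have hc : (0 : ℝ) ≤ Real.cos 0 := by simp
  have hs : (0 : ℝ) ≤ Real.sin 0 := by simp
  refine (E0_EY_eq (G := fun z w => tpair D.θ (D.angleExpo o J z 0 w) fun σ τ =>
    sv (σ j) * sv (τ j)) (fun z lam Y₁ => ?_) fun z => ?_).symm
  · have hg := ((regular_angleExpo (o := o) (J := J) z 0).growth (Sum.elim lam Y₁)).choose_spec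
    rw [tpair_mul hg hD.θ_pos.le hD.θ_le_one fun σ => sv (σ j)]
    have h1 := EY_W₂_zero (o := o) (J := J) hD hN ⟨z.1, z.2, lam⟩ Y₁ j Real.tanh
    have h2 : tavg D.θ (D.angleExpo o J z 0 (Sum.elim lam Y₁)) (fun y =>
        gav (D.angleExpo o J z 0 (Sum.elim lam Y₁) y) fun σ => sv (σ j))
        = EY fun Y₂ => W₂ o J 0 (⟨z.1, z.2, lam⟩ : D.Disorder N) Y₁ Y₂
          * Real.tanh (fieldAt o J (⟨z.1, z.2, lam⟩ : D.Disorder N) Y₁ Y₂ j) := by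
      simp only [tavg, gav, avgPow, pf_angleExpo hs hc, exp_angleExpo hs hc, Real.sin_zero,
        zero_pow two_ne_zero, ← sum_gibbsI_zero hD hN]
      rfl
    simp only [h2, h1, sq]
  · have hX := regular_angleExpo (o := o) (J := J) z 0
    exact integrable_of_bounded (hX.measurable_tpair _).aestronglyMeasurable
      fun w => (isAverage_tpair (hX.growth w).choose_spec hD.θ_pos.le hD.θ_le_one).abs_le
        (f := fun q => sv (q.1 j) * sv (q.2 j))
        fun s => abs_le_sum_abs (fun q : (Fin N → Spin) × (Fin N → Spin) =>
          sv (q.1 j) * sv (q.2 j)) s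

lemma isAverage_overlap_of_site {Φ : ((Fin N → Spin) → (Fin N → Spin) → ℝ) → ℝ} (hN : N ≠ 0)
    (hΦ : IsAverage fun Q : (Fin N → Spin) × (Fin N → Spin) → ℝ => Φ fun s t => Q (s, t)) {c : ℝ}
    (hc : ∀ j, Φ (fun σ τ => sv (σ j) * sv (τ j)) = c) : Φ overlap = c := by
  have hN' : (N : ℝ) ≠ 0 := by exact_mod_cast hN
  have h1 := hΦ.map_const_mul (1 / N) fun q : (Fin N → Spin) × (Fin N → Spin) =>
    ∑ j, sv (q.1 j) * sv (q.2 j)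
  have h2 := hΦ.map_sum Finset.univ fun (j : Fin N) (q : (Fin N → Spin) × (Fin N → Spin)) =>
    sv (q.1 j) * sv (q.2 j)
  simp only at h1 h2
  change Φ (fun σ τ => 1 / N * ∑ j, sv (σ j) * sv (τ j)) = c
  rw [h1, h2]
  simp only [hc, Finset.sum_const, Finset.card_univ, Fintype.card_fin, nsmul_eq_mul]
  field_simp

lemma mean₂_zero_overlap (hD : D.Admissible) (hN : N ≠ 0) :
    D.mean₂ o J N 0 overlap = D.Esite fun x e => EG fun y₁ =>
        ctilt D.θ (fun x => Real.tanh x ^ 2) (D.siteField o J x e) (D.A₁ o) (D.A₂ o) y₁ :=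
  isAverage_overlap_of_site hN (isAverage_mean₂ hD 0) fun j => mean₂_zero_site hD hN j

lemma mean₁_zero_overlap (hD : D.Admissible) (hN : N ≠ 0) :
    D.mean₁ o J N 0 overlap = D.Esite fun x e => EG fun y₁ =>
        ctilt D.θ Real.tanh (D.siteField o J x e) (D.A₁ o) (D.A₂ o) y₁ ^ 2 :=
  isAverage_overlap_of_site hN (isAverage_mean₁ hD 0) fun j => mean₁_zero_site hD hN j

end OneBody
end Model

/-! ### The overlap of `P`-tuples and powers of the overlap -/

section Tuples

variable {n P : ℕ}

/-- The number of enumerations of a set with `P` elements. -/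
lemma card_injective_image_eq {I : Finset (Fin n)} (hI : I.card = P) :
    (Finset.univ.filter fun f : Fin P → Fin n =>
      Function.Injective f ∧ Finset.univ.image f = I).card = P.factorial := by
  have e : Fin P ≃ I := Fintype.equivOfCardEq (by simp [hI])
  have hc := Fintype.card_equiv e
  rw [Fintype.card_fin] at hc
  rw [← hc, ← Finset.card_univ]
  symm
  refine Finset.card_bij (fun σ _ j => (σ j : Fin n)) (fun σ _ => ?_) (fun σ _ τ _ h => ?_)
    fun f hf => ?_
  · simp only [Finset.mem_filter, Finset.mem_univ, true_and]
    refine ⟨Subtype.val_injective.comp σ.injective, ?_⟩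
    ext i
    simp only [Finset.mem_image, Finset.mem_univ, true_and]
    exact ⟨fun ⟨j, hj⟩ => hj ▸ (σ j).2, fun hi => ⟨σ.symm ⟨i, hi⟩, by simp⟩⟩
  · exact Equiv.ext fun j => Subtype.ext (congrFun h j)
  · simp only [Finset.mem_filter, Finset.mem_univ, true_and] at hf
    have hmem : ∀ j, f j ∈ I := fun j => hf.2 ▸ Finset.mem_image_of_mem f (Finset.mem_univ j)
    refine ⟨Equiv.ofBijective (fun j => (⟨f j, hmem j⟩ : I)) ⟨fun a b h => hf.1 ?_, ?_⟩,
      Finset.mem_univ _, rfl⟩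
    · exact congrArg Subtype.val h
    · rintro ⟨i, hi⟩
      rw [← hf.2] at hi
      obtain ⟨j, -, hj⟩ := Finset.mem_image.1 hi
      exact ⟨j, Subtype.ext hj⟩

lemma sum_injective_prod (z : Fin n → ℝ) :
    ∑ f : Fin P → Fin n with Function.Injective f, ∏ j, z (f j)
      = P.factorial * ∑ I ∈ Finset.powersetCard P Finset.univ, ∏ i ∈ I, z i := by
  rw [← Finset.sum_fiberwise_of_maps_to (g := fun f : Fin P → Fin n => Finset.univ.image f)
    (t := Finset.powersetCard P Finset.univ), Finset.mul_sum]
  · refine Finset.sum_congr rfl fun I hI => ?_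
    rw [Finset.filter_filter, Finset.sum_congr rfl (g := fun _ => ∏ i ∈ I, z i),
      Finset.sum_const, card_injective_image_eq (Finset.mem_powersetCard_univ.1 hI), nsmul_eq_mul]
    intro f hf
    simp only [Finset.mem_filter, Finset.mem_univ, true_and] at hf
    rw [← hf.2, Finset.prod_image fun a _ b _ h => hf.1 h]
  · intro f hf
    simp only [Finset.mem_filter, Finset.mem_univ, true_and] at hf
    rw [Finset.mem_powersetCard_univ, Finset.card_image_of_injective _ hf, Finset.card_univ,
      Fintype.card_fin]

/-- Expanding the power of a sum, the terms with repeated indices are bounded by their number. -/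
lemma abs_sum_pow_sub_le {z : Fin n → ℝ} (hz : ∀ i, |z i| ≤ 1) :
    |(∑ i, z i) ^ P - P.factorial * ∑ I ∈ Finset.powersetCard P Finset.univ, ∏ i ∈ I, z i|
      ≤ n ^ P - P.factorial * n.choose P := by
  have expand : ∀ z : Fin n → ℝ, (∑ i, z i) ^ P
      - P.factorial * ∑ I ∈ Finset.powersetCard P Finset.univ, ∏ i ∈ I, z i
      = ∑ f : Fin P → Fin n with ¬ Function.Injective f, ∏ j, z (f j) := fun z => by
    have h := Finset.prod_univ_sum (fun _ : Fin P => (Finset.univ : Finset (Fin n))) fun _ i => z i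
    rw [Fintype.piFinset_univ, Finset.prod_const, Finset.card_univ, Fintype.card_fin] at h
    rw [h, ← sum_injective_prod,
      ← Finset.sum_filter_add_sum_filter_not Finset.univ fun f : Fin P → Fin n =>
        Function.Injective f]
    ring
  have h1 := expand fun _ => 1
  simp only [Finset.sum_const, Finset.prod_const_one, Finset.card_powersetCard, Finset.card_univ,
    Fintype.card_fin, nsmul_eq_mul, mul_one] at h1
  rw [expand, h1]
  refine (Finset.abs_sum_le_sum_abs _ _).trans ((Finset.sum_le_card_nsmul _ _ 1 fun f _ => ?_).trans
    (le_of_eq (by simp)))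
  rw [Finset.abs_prod]
  exact Finset.prod_le_one (fun _ _ => abs_nonneg _) fun _ _ => hz _

lemma tendsto_factorial_mul_choose_div_pow (P : ℕ) :
    Tendsto (fun n : ℕ => (P.factorial * n.choose P : ℝ) / (n : ℝ) ^ P) atTop (𝓝 1) := by
  have h1 : Tendsto (fun n : ℕ => (n : ℝ) * (n : ℝ)⁻¹) atTop (𝓝 1) :=
    tendsto_const_nhds.congr' (by
      filter_upwards [eventually_ne_atTop 0] with n hn
      rw [mul_inv_cancel₀ (by exact_mod_cast hn)])
  have h2 := (tendsto_choose_mul_pow_atTop P h1).const_mul (P.factorial : ℝ)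
  have h3 : (P.factorial : ℝ) ≠ 0 := by exact_mod_cast P.factorial_ne_zero
  rw [one_pow, mul_one_div_cancel h3] at h2
  refine h2.congr fun n => ?_
  rw [inv_pow]
  ring

end Tuples

/-! ### Concentration under averages -/

namespace IsAverage

lemma sq_le {T : Type*} {Φ : (T → ℝ) → ℝ} (h : IsAverage Φ) (f : T → ℝ) :
    Φ f ^ 2 ≤ Φ (fun s => f s ^ 2) := by
  have h1 := h.nonneg (fun s => f s ^ 2 - (2 * Φ f) * f s + Φ f ^ 2) fun s => by
    nlinarith [sq_nonneg (f s - Φ f)]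
  rw [h.map_add, h.map_sub, h.map_const_mul, h.map_const] at h1
  nlinarith

/-- If a bounded observable concentrates at `c` in mean square, so do its powers. -/
lemma tendsto_pow_of_sq {T : ℕ → Type*} {Φ : ∀ N, (T N → ℝ) → ℝ} (h : ∀ N, IsAverage (Φ N))
    {q : ∀ N, T N → ℝ} (hq : ∀ N s, |q N s| ≤ 1) {c : ℝ}
    (hc : Tendsto (fun N => Φ N fun s => (q N s - c) ^ 2) atTop (𝓝 0)) (k : ℕ) :
    Tendsto (fun N => Φ N fun s => q N s ^ k) atTop (𝓝 (c ^ k)) := by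
  set L := (k * max 1 |c| ^ (k - 1)) ^ 2 with hL
  have hb : ∀ N s, (q N s ^ k - c ^ k) ^ 2 ≤ L * (q N s - c) ^ 2 := fun N s => by
    have h1 := abs_pow_sub_pow_le (q N s) c k
    have h2 : max |q N s| |c| ^ (k - 1) ≤ max 1 |c| ^ (k - 1) :=
      pow_le_pow_left₀ (by positivity) (max_le_max (hq N s) le_rfl) _
    have h3 : |q N s ^ k - c ^ k| ≤ (k * max 1 |c| ^ (k - 1)) * |q N s - c| := by
      refine h1.trans ?_
      rw [mul_assoc, mul_comm]
      exact mul_le_mul_of_nonneg_right (mul_le_mul_of_nonneg_left h2 (by positivity))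
        (abs_nonneg _)
    rw [hL, ← sq_abs, ← sq_abs (q N s - c), ← mul_pow]
    exact pow_le_pow_left₀ (abs_nonneg _) h3 2
  have hsq : Tendsto (fun N => ((Φ N fun s => q N s ^ k) - c ^ k) ^ 2) atTop (𝓝 0) := by
    refine squeeze_zero (fun N => sq_nonneg _) (fun N => ?_) (by simpa using hc.const_mul L)
    rw [← (h N).map_const (c ^ k), ← (h N).map_sub, ← (h N).map_const_mul]
    exact ((h N).sq_le _).trans ((h N).mono (hb N))
  have h0 : Tendsto (fun N => (Φ N fun s => q N s ^ k) - c ^ k) atTop (𝓝 0) := by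
    have := hsq.sqrt
    simp only [Real.sqrt_sq_eq_abs, Real.sqrt_zero] at this
    exact (tendsto_zero_iff_abs_tendsto_zero _).2 this
  simpa using h0.add_const (c ^ k)

end IsAverage

namespace Model

section Concentration

variable {D : Model} {N : ℕ} {o : OrderParams} {J : ℝ}

lemma abs_sum_div_le {f : Fin N → ℝ} (hf : ∀ i, |f i| ≤ 1) : |1 / (N : ℝ) * ∑ i, f i| ≤ 1 := by
  rw [abs_mul, abs_of_nonneg (by positivity)]
  have h : |∑ i, f i| ≤ N := by
    refine (Finset.abs_sum_le_sum_abs _ _).trans ((Finset.sum_le_card_nsmul _ _ 1 fun i _ =>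
      hf i).trans ?_)
    simp
  rcases Nat.eq_zero_or_pos N with rfl | hN
  · simp
  · have hN' : (0 : ℝ) < N := by exact_mod_cast hN
    rw [one_div, inv_mul_le_iff₀ hN', mul_one]
    exact h

lemma abs_overlap_le (σ τ : Fin N → Spin) : |overlap σ τ| ≤ 1 :=
  abs_sum_div_le fun i => by rw [abs_mul, abs_sv, abs_sv, one_mul]

lemma abs_mattis_le (d : D.Disorder N) (σ : Fin N → Spin) : |mattis d σ| ≤ 1 :=
  abs_sum_div_le fun i => by rw [abs_mul, abs_sv, abs_sv, one_mul]

lemma abs_mattisEx_le (d : D.Disorder N) (a : Fin D.M) (σ : Fin N → Spin) :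
    |mattisEx d a σ| ≤ |D.r / D.R| := by
  rw [mattisEx, mul_assoc, abs_mul]
  exact mul_le_of_le_one_right (abs_nonneg _)
    (abs_sum_div_le fun i => by rw [abs_mul, abs_sv, abs_sv, one_mul])

lemma abs_noiseCov_sub_le (hN : N ≠ 0) (σ τ : Fin N → Spin) :
    |D.P.factorial / (N : ℝ) ^ D.P * D.noiseCov σ τ - overlap σ τ ^ D.P|
      ≤ 1 - D.P.factorial * N.choose D.P / (N : ℝ) ^ D.P := by
  have hN' : (0 : ℝ) < N := by exact_mod_cast Nat.pos_of_ne_zero hN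
  have hNP := pow_pos hN' D.P
  have h := abs_sum_pow_sub_le (P := D.P) (z := fun i => sv (σ i) * sv (τ i)) fun i => by
    rw [abs_mul, abs_sv, abs_sv, one_mul]
  have e1 : ∑ I ∈ Finset.powersetCard D.P Finset.univ, ∏ i ∈ I, sv (σ i) * sv (τ i)
      = D.noiseCov σ τ := by
    rw [noiseCov, Finset.sum_subtype _ (p := fun I : Finset (Fin N) => I.card = D.P) fun I => by
      rw [Finset.mem_powersetCard_univ]]
    exact Finset.sum_congr rfl fun I _ => Finset.prod_mul_distrib
  rw [e1, ← natCast_mul_overlap hN, mul_pow, abs_sub_comm] at h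
  have e2 : D.P.factorial / (N : ℝ) ^ D.P * D.noiseCov σ τ - overlap σ τ ^ D.P
      = (D.P.factorial * D.noiseCov σ τ - N ^ D.P * overlap σ τ ^ D.P) / (N : ℝ) ^ D.P := by
    field_simp
  rw [e2, abs_div, abs_of_pos hNP, div_le_iff₀ hNP, sub_mul, div_mul_cancel₀ _ hNP.ne', one_mul]
  exact h

lemma card_cpl : Fintype.card (D.Cpl N) = N.choose D.P := by
  rw [Fintype.card_finset_len, Fintype.card_fin]

lemma abs_noiseCov_le (σ τ : Fin N → Spin) : |D.noiseCov σ τ| ≤ N.choose D.P := by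
  refine (Finset.abs_sum_le_sum_abs _ _).trans (le_of_eq ?_)
  simp [abs_mul, abs_spinProd]

/-- If the overlap concentrates at `c`, so does the covariance of the noise, at `c ^ P`. -/
lemma tendsto_noiseCov {Φ : ∀ N, ((Fin N → Spin) → (Fin N → Spin) → ℝ) → ℝ}
    (hΦ : ∀ N, IsAverage fun Q : (Fin N → Spin) × (Fin N → Spin) → ℝ => Φ N fun s t => Q (s, t))
    {c : ℝ} (hc : Tendsto (fun N => Φ N fun σ τ => (overlap σ τ - c) ^ 2) atTop (𝓝 0)) :
    Tendsto (fun N : ℕ => D.P.factorial / (N : ℝ) ^ D.P * Φ N D.noiseCov) atTop (𝓝 (c ^ D.P)) := by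
  have h1 := IsAverage.tendsto_pow_of_sq hΦ (q := fun N p => overlap p.1 p.2)
    (fun N p => abs_overlap_le p.1 p.2) hc D.P
  have h2 : Tendsto (fun N : ℕ => (D.P.factorial / (N : ℝ) ^ D.P * Φ N D.noiseCov)
      - Φ N fun σ τ => overlap σ τ ^ D.P) atTop (𝓝 0) := by
    have hδ := (tendsto_factorial_mul_choose_div_pow D.P).const_sub 1
    rw [sub_self] at hδ
    refine squeeze_zero_norm' ?_ hδ
    filter_upwards [eventually_ne_atTop 0] with N hN
    have e1 := (hΦ N).map_const_mul (D.P.factorial / (N : ℝ) ^ D.P) fun q => D.noiseCov q.1 q.2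
    have e2 := (hΦ N).map_sub (fun q => D.P.factorial / (N : ℝ) ^ D.P * D.noiseCov q.1 q.2)
      fun q => overlap q.1 q.2 ^ D.P
    simp only at e1 e2
    rw [e1] at e2
    rw [← e2, Real.norm_eq_abs]
    exact (hΦ N).abs_le (f := fun q => D.P.factorial / (N : ℝ) ^ D.P * D.noiseCov q.1 q.2
      - overlap q.1 q.2 ^ D.P) fun q => abs_noiseCov_sub_le hN q.1 q.2
  simpa using h2.add h1

lemma tendsto_overlap {Φ : ∀ N, ((Fin N → Spin) → (Fin N → Spin) → ℝ) → ℝ}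
    (hΦ : ∀ N, IsAverage fun Q : (Fin N → Spin) × (Fin N → Spin) → ℝ => Φ N fun s t => Q (s, t))
    {c : ℝ} (hc : Tendsto (fun N => Φ N fun σ τ => (overlap σ τ - c) ^ 2) atTop (𝓝 0)) :
    Tendsto (fun N => Φ N overlap) atTop (𝓝 c) := by
  simpa using IsAverage.tendsto_pow_of_sq hΦ (q := fun N p => overlap p.1 p.2)
    (fun N p => abs_overlap_le p.1 p.2) hc 1

/-- A bounded continuous function that agrees with `x ^ k` for `|x| ≤ B`. -/
lemma exists_bounded_pow (B : ℝ) (k : ℕ) : ∃ φ : ℝ →ᵇ ℝ, ∀ x, |x| ≤ B → φ x = x ^ k := by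
  refine ⟨BoundedContinuousFunction.ofNormedAddCommGroup (fun x => (max (-|B|) (min x |B|)) ^ k)
    (by fun_prop) (|B| ^ k) fun x => ?_, fun x hx => ?_⟩
  · rw [Real.norm_eq_abs, abs_pow]
    refine pow_le_pow_left₀ (abs_nonneg _) ?_ k
    rw [abs_le]
    exact ⟨le_max_left _ _, max_le (by linarith [abs_nonneg B]) (min_le_right _ _)⟩
  · have h1 := abs_le.1 (hx.trans (le_abs_self B))
    simp [BoundedContinuousFunction.coe_ofNormedAddCommGroup, min_eq_left h1.2, max_eq_right h1.1]

end Concentration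

/-! ### The limit of infinite size, at a positive source -/

section Limit

variable {D : Model} {N : ℕ} {o : OrderParams} {J : ℝ}

/-! #### Self-averaging along the interpolation -/

lemma tendsto_mean_mattisEx_pow (hD : D.Admissible) (hR : D.OneRSB o J) {u : ℝ}
    (hs : 0 ≤ Real.sin u) (hc : 0 < Real.cos u) (a : Fin D.M) (k : ℕ) :
    Tendsto (fun N => D.mean o J N u fun z σ => mattisEx (D.base z) a σ ^ k) atTop
      (𝓝 (o.n ^ k)) := by
  obtain ⟨φ, hφ⟩ := exists_bounded_pow (max |D.r / D.R| |o.n|) k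
  have ht : Real.sin u ^ 2 ∈ Set.Ico (0 : ℝ) 1 :=
    ⟨sq_nonneg _, by nlinarith [Real.sin_sq_add_cos_sq u]⟩
  have h := hR.mattisEx_interp _ ht a φ
  rw [hφ _ (le_max_right _ _)] at h
  refine h.congr fun N => ?_
  rw [← avgI_eq_mean hD.θ_pos.le hD.θ_le_one hs hc.le]
  congr 1; ext d σ
  exact hφ _ ((abs_mattisEx_le d a σ).trans (le_max_left _ _))

lemma tendsto_mean_mattis (hD : D.Admissible) (hR : D.OneRSB o J) :
    Tendsto (fun N => D.mean o J N 0 fun z σ => mattis (D.base z) σ) atTop (𝓝 o.m) := by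
  obtain ⟨φ, hφ⟩ := exists_bounded_pow (max 1 |o.m|) 1
  simp only [pow_one] at hφ
  have h := hR.mattis_interp 0 ⟨le_rfl, one_pos⟩ φ
  rw [hφ _ (le_max_right _ _)] at h
  refine h.congr fun N => ?_
  rw [← avgI_eq_mean hD.θ_pos.le hD.θ_le_one (by simp) (by simp), Real.sin_zero,
    zero_pow two_ne_zero]
  congr 1; ext d σ
  exact hφ _ ((abs_mattis_le d σ).trans (le_max_left _ _))

lemma tendsto_mean₁_sq (hD : D.Admissible) (hC : D.OverlapConcentration o J) {u : ℝ}
    (hs : 0 ≤ Real.sin u) (hc : 0 < Real.cos u) :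
    Tendsto (fun N => D.mean₁ o J N u fun σ τ => (overlap σ τ - o.q₁) ^ 2) atTop (𝓝 0) := by
  have ht : Real.sin u ^ 2 ∈ Set.Ico (0 : ℝ) 1 :=
    ⟨sq_nonneg _, by nlinarith [Real.sin_sq_add_cos_sq u]⟩
  simpa only [avgI₁_eq_mean₁ hD.θ_pos.le hD.θ_le_one hs hc.le] using hC.level₁ _ ht 2 le_rfl

lemma tendsto_mean₂_sq (hD : D.Admissible) (hC : D.OverlapConcentration o J) {u : ℝ}
    (hs : 0 ≤ Real.sin u) (hc : 0 < Real.cos u) :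
    Tendsto (fun N => D.mean₂ o J N u fun σ τ => (overlap σ τ - o.q₂) ^ 2) atTop (𝓝 0) := by
  have ht : Real.sin u ^ 2 ∈ Set.Ico (0 : ℝ) 1 :=
    ⟨sq_nonneg _, by nlinarith [Real.sin_sq_add_cos_sq u]⟩
  simpa only [avgI₂_eq_mean₂ hD.θ_pos.le hD.θ_le_one hs hc.le] using hC.level₂ _ ht 2 le_rfl

/-! #### Self-consistency at a positive source -/

variable (D o J) in
/-- The average over one site of an observable of the tilted one-site system. -/
def siteTilt (h : ℝ → ℝ) (k : ℕ) (c : Spin → (Fin D.M → Spin) → ℝ) : ℝ :=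
  D.Esite fun x e => (EG fun y₁ =>
    ctilt D.θ h (D.siteField o J x e) (D.A₁ o) (D.A₂ o) y₁ ^ k) * c x e

lemma siteTilt_one_eq (h : ℝ → ℝ) (c : Spin → (Fin D.M → Spin) → ℝ) :
    D.siteTilt o J h 1 c = D.Esite fun x e => EG fun y₁ =>
      ctilt D.θ h (D.siteField o J x e) (D.A₁ o) (D.A₂ o) y₁ * c x e := by
  simp only [siteTilt, pow_one, EG, integral_mul_const]

lemma Esite_sum {ι : Type*} (I : Finset ι) (f : ι → Spin → (Fin D.M → Spin) → ℝ) :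
    (D.Esite fun x e => ∑ i ∈ I, f i x e) = ∑ i ∈ I, D.Esite (f i) := by
  simp only [Esite_eq, Finset.mul_sum]
  exact Finset.sum_comm

lemma Esite_const_mul (c : ℝ) (f : Spin → (Fin D.M → Spin) → ℝ) :
    (D.Esite fun x e => c * f x e) = c * D.Esite f := by
  simp only [Esite_eq, Finset.mul_sum]
  exact Finset.sum_congr rfl fun _ _ => by ring

lemma siteWt_nonneg (hD : D.Admissible) (q : Spin × (Fin D.M → Spin)) : 0 ≤ siteWt D q :=
  mul_nonneg (by norm_num) (Finset.prod_nonneg fun _ _ =>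
    exampleProb_nonneg hD.r_pos hD.r_le_one _ _)

lemma Esite_mono (hD : D.Admissible) {f h : Spin → (Fin D.M → Spin) → ℝ}
    (hfh : ∀ x e, f x e ≤ h x e) : D.Esite f ≤ D.Esite h := by
  simp only [Esite_eq]
  exact Finset.sum_le_sum fun q _ => mul_le_mul_of_nonneg_left (hfh _ _) (siteWt_nonneg hD q)

lemma m_eq (hD : D.Admissible) (hR : D.OneRSB o J) :
    o.m = D.siteTilt o J Real.tanh 1 fun x _ => sv x := by
  refine tendsto_nhds_unique (tendsto_mean_mattis hD hR) (tendsto_const_nhds.congr' ?_)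
  filter_upwards [eventually_ne_atTop 0] with N hN
  rw [mean_zero_mattis hD hN, siteTilt_one_eq]

lemma n_eq (hD : D.Admissible) (hR : D.OneRSB o J) :
    o.n = 1 / (1 + D.ρ) * D.siteTilt o J Real.tanh 1 fun _ e => D.etaHat e := by
  have hr := hD.r_pos.ne'
  have hρ : 1 + D.ρ ≠ 0 := by linarith [rho_nonneg hD]
  have hM : (D.M : ℝ) ≠ 0 := by
    have := hD.one_le_M
    exact_mod_cast (by omega : D.M ≠ 0)
  have h1 : ∀ a : Fin D.M, o.n
      = D.r / D.R * D.siteTilt o J Real.tanh 1 fun _ e => sv (e a) := fun a => by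
    have h := tendsto_mean_mattisEx_pow hD hR (u := 0) (by simp) (by simp) a 1
    simp only [pow_one] at h
    refine tendsto_nhds_unique h (tendsto_const_nhds.congr' ?_)
    filter_upwards [eventually_ne_atTop 0] with N hN
    rw [mean_zero_mattisEx hD hN, siteTilt, ← Esite_const_mul]
    congr 1; ext x e
    simp only [pow_one, EG, integral_mul_const]
    ring
  have h2 : (D.M : ℝ) * o.n = ∑ a : Fin D.M, D.r / D.R
      * D.siteTilt o J Real.tanh 1 fun _ e => sv (e a) := by
    simp only [← h1, Finset.sum_const, Finset.card_univ, Fintype.card_fin, nsmul_eq_mul]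
  have h3 : (D.siteTilt o J Real.tanh 1 fun _ e => D.etaHat e)
      = 1 / (D.r * D.M) * ∑ a, D.siteTilt o J Real.tanh 1 fun _ e => sv (e a) := by
    simp only [siteTilt]
    rw [← Esite_sum, ← Esite_const_mul]
    congr 1; ext x e
    rw [etaHat, ← Finset.mul_sum]
    ring
  rw [← Finset.mul_sum] at h2
  rw [h3, ← mul_right_inj' hM, h2, R]
  field_simp

lemma q₁_eq (hD : D.Admissible) (hC : D.OverlapConcentration o J) :
    o.q₁ = D.siteTilt o J Real.tanh 2 fun _ _ => 1 := by
  refine tendsto_nhds_unique (tendsto_overlap (fun N => isAverage_mean₁ hD 0)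
    (tendsto_mean₁_sq hD hC (u := 0) (by simp) (by simp))) (tendsto_const_nhds.congr' ?_)
  filter_upwards [eventually_ne_atTop 0] with N hN
  rw [mean₁_zero_overlap hD hN]
  simp only [siteTilt, mul_one]

lemma q₂_eq (hD : D.Admissible) (hC : D.OverlapConcentration o J) :
    o.q₂ = D.siteTilt o J (fun x => Real.tanh x ^ 2) 1 fun _ _ => 1 := by
  refine tendsto_nhds_unique (tendsto_overlap (fun N => isAverage_mean₂ hD 0)
    (tendsto_mean₂_sq hD hC (u := 0) (by simp) (by simp))) (tendsto_const_nhds.congr' ?_)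
  filter_upwards [eventually_ne_atTop 0] with N hN
  rw [mean₂_zero_overlap hD hN]
  simp only [siteTilt, mul_one, pow_one]

lemma q₁_nonneg (hD : D.Admissible) (hC : D.OverlapConcentration o J) : 0 ≤ o.q₁ := by
  rw [q₁_eq hD hC]
  have := Esite_mono hD (f := fun _ _ => 0) (h := fun x e => (EG fun y₁ =>
    ctilt D.θ Real.tanh (D.siteField o J x e) (D.A₁ o) (D.A₂ o) y₁ ^ 2) * 1) fun x e => by
      rw [mul_one]
      exact integral_nonneg fun y => sq_nonneg _
  refine le_trans (le_of_eq ?_) this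
  simp [Esite]

lemma abs_tanh_sq_le_one (x : ℝ) : |Real.tanh x ^ 2| ≤ 1 := by
  rw [abs_pow]; exact pow_le_one₀ (abs_nonneg _) (abs_real_tanh_le_one x)

/-- The overlap of replicas with common fields is at least that of replicas with independent inner
fields, since the difference is a variance. -/
lemma q₁_le_q₂ (hD : D.Admissible) (hC : D.OverlapConcentration o J) : o.q₁ ≤ o.q₂ := by
  rw [q₁_eq hD hC, q₂_eq hD hC]
  refine Esite_mono hD fun x e => ?_
  simp only [mul_one, pow_one]
  refine integral_mono (integrable_of_bounded (C := 1) ((measurable_ctilt D.θ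
      continuous_real_tanh.measurable _ _ _).pow_const 2).aestronglyMeasurable fun y => ?_)
    (integrable_of_bounded (C := 1) (measurable_ctilt D.θ (h := fun x => Real.tanh x ^ 2)
      (continuous_real_tanh.pow 2).measurable _ _ _).aestronglyMeasurable fun y =>
        abs_ctilt_le hD.θ_pos.le hD.θ_le_one abs_tanh_sq_le_one _ _ _ _)
    fun y => ctilt_tanh_sq_le hD.θ_pos.le hD.θ_le_one _ _ _ _
  rw [abs_pow]
  exact pow_le_one₀ (abs_nonneg _)
    (abs_ctilt_le hD.θ_pos.le hD.θ_le_one abs_real_tanh_le_one _ _ _ _)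

/-! #### The constants -/

lemma α_nonneg (hD : D.Admissible) : 0 ≤ D.α :=
  ge_of_tendsto' hD.load fun _ => by positivity

lemma γ_nonneg (hD : D.Admissible) : 0 ≤ D.γ := by
  have := α_nonneg hD
  unfold γ
  positivity

variable (D) in
/-- The variance `κ` of the noise, in units of `γ`. -/
def noiseVar : ℝ := (1 + √D.ρP) ^ 2 / (1 + D.ρ) ^ D.P

lemma noiseVar_nonneg (hD : D.Admissible) : 0 ≤ D.noiseVar := by
  have := rho_nonneg hD
  unfold noiseVar
  positivity

lemma A₁_sq (hD : D.Admissible) (hC : D.OverlapConcentration o J) :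
    D.A₁ o ^ 2 = D.β' ^ 2 * (D.γ * (D.P / 2) * D.noiseVar * o.q₁ ^ (D.P - 1)) := by
  have h1 := γ_nonneg hD
  have h2 := noiseVar_nonneg hD
  have h3 := q₁_nonneg hD hC
  rw [A₁, mul_pow]
  congr 1
  exact Real.sq_sqrt (mul_nonneg (mul_nonneg (mul_nonneg h1 (by positivity)) h2) (by positivity))

lemma A₂_sq (hD : D.Admissible) (hC : D.OverlapConcentration o J) :
    D.A₂ o ^ 2 = D.β' ^ 2 * (D.γ * (D.P / 2) * D.noiseVar
      * (o.q₂ ^ (D.P - 1) - o.q₁ ^ (D.P - 1))) := by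
  have h1 := γ_nonneg hD
  have h2 := noiseVar_nonneg hD
  have h3 := pow_le_pow_left₀ (q₁_nonneg hD hC) (q₁_le_q₂ hD hC) (D.P - 1)
  rw [A₂, mul_pow]
  congr 1
  exact Real.sq_sqrt (mul_nonneg (mul_nonneg (mul_nonneg h1 (by positivity)) h2) (by linarith))

variable (D) in
/-- The variance of the noise term, per site. -/
def noiseScale (N : ℕ) : ℝ := D.noiseCoeff N ^ 2 * ((N : ℝ) ^ (D.P - 1) / D.P.factorial)

/-- The load `K / N^(P-1) → α` fixes the variance of the noise. -/
lemma tendsto_noiseScale (hD : D.Admissible) :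
    Tendsto D.noiseScale atTop (𝓝 (D.β' ^ 2 / 2 * D.γ * D.noiseVar)) := by
  have hρ : 0 < 1 + D.ρ := by linarith [rho_nonneg hD]
  have hf : (D.P.factorial : ℝ) ≠ 0 := by exact_mod_cast D.P.factorial_ne_zero
  set x := (1 + D.ρ) ^ ((D.P : ℝ) / 2) with hx
  have hx0 : x ≠ 0 := (Real.rpow_pos_of_pos hρ _).ne'
  have hx2 : (1 + D.ρ) ^ D.P = x * x := by
    rw [hx, ← Real.rpow_add hρ, add_halves, Real.rpow_natCast]
  set b := D.β' * D.P.factorial * (1 + √D.ρP) / (2 * x) with hb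
  have e1 : ∀ N, D.noiseScale N
      = D.α ^ 2 / ((D.K N : ℝ) / (N : ℝ) ^ (D.P - 1)) * (b ^ 2 / D.P.factorial) := fun N => by
    rw [noiseScale, noiseCoeff, ← hx, ← hb, mul_pow, div_pow,
      Real.sq_sqrt (Nat.cast_nonneg _), div_div_eq_mul_div]
    ring
  have e2 : D.β' ^ 2 / 2 * D.γ * D.noiseVar = D.α * (b ^ 2 / D.P.factorial) := by
    rw [noiseVar, hx2, γ, hb]
    field_simp
  rw [e2]
  simp only [funext e1]
  refine Tendsto.mul_const _ ?_
  rcases eq_or_ne D.α 0 with h0 | h0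
  · simp [h0]
  · have h := (tendsto_const_nhds (x := D.α ^ 2)).div hD.load h0
    rwa [show D.α ^ 2 / D.α = D.α by field_simp] at h

/-! #### The rate of change of the interpolating free energy -/

variable (D o J) in
/-- The derivative of the interpolating free energy per site, up to the factor
`sin u cos u = (t (1 - t)) ^ (1/2)`. -/
def rate (N : ℕ) (u : ℝ) : ℝ :=
  2 * (D.β' / (2 * D.M) * (1 + D.ρ) ^ ((D.P : ℝ) / 2)
        * ∑ a, D.mean o J N u (fun z σ => mattisEx (D.base z) a σ ^ D.P)
      - D.ψ o * ∑ a, D.mean o J N u (fun z σ => mattisEx (D.base z) a σ))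
    + D.noiseScale N * (D.P.factorial * N.choose D.P / (N : ℝ) ^ D.P
      - (1 - D.θ) * (D.P.factorial / (N : ℝ) ^ D.P * D.mean₂ o J N u D.noiseCov)
      - D.θ * (D.P.factorial / (N : ℝ) ^ D.P * D.mean₁ o J N u D.noiseCov))
    - D.A₁ o ^ 2 * (1 - (1 - D.θ) * D.mean₂ o J N u overlap - D.θ * D.mean₁ o J N u overlap)
    - D.A₂ o ^ 2 * (1 - (1 - D.θ) * D.mean₂ o J N u overlap)

lemma hasDerivAt_interp_div (hD : D.Admissible) (hN : N ≠ 0) (u : ℝ) :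
    HasDerivAt (fun v => D.interp o J N v / (N * D.θ))
      (Real.sin u * Real.cos u * D.rate o J N u) u := by
  have hN' : (N : ℝ) ≠ 0 := by exact_mod_cast hN
  have hθ := hD.θ_pos.ne'
  have hf : (D.P.factorial : ℝ) ≠ 0 := by exact_mod_cast D.P.factorial_ne_zero
  have hA := isAverage_mean (N := N) (o := o) (J := J) hD u
  have h1 : D.mean o J N u D.signal = D.β' * N / (2 * D.M) * (1 + D.ρ) ^ ((D.P : ℝ) / 2)
      * ∑ a, D.mean o J N u (fun z σ => mattisEx (D.base z) a σ ^ D.P) := by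
    have e1 := hA.map_const_mul (D.β' * N / (2 * D.M) * (1 + D.ρ) ^ ((D.P : ℝ) / 2)) fun q =>
      ∑ a, mattisEx (D.base q.1) a q.2 ^ D.P
    have e2 := hA.map_sum Finset.univ fun (a : Fin D.M) q => mattisEx (D.base q.1) a q.2 ^ D.P
    simp only at e1 e2
    rw [← e2, ← e1]
    rfl
  have h2 : D.mean o J N u (D.signal₀ o) = D.ψ o * N
      * ∑ a, D.mean o J N u (fun z σ => mattisEx (D.base z) a σ) := by
    have e1 := hA.map_const_mul (D.ψ o * N) fun q => ∑ a, mattisEx (D.base q.1) a q.2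
    have e2 := hA.map_sum Finset.univ fun (a : Fin D.M) q => mattisEx (D.base q.1) a q.2
    simp only at e1 e2
    rw [← e2, ← e1]
    rfl
  refine ((hasDerivAt_interp hD hN u).div_const (N * D.θ)).congr_deriv ?_
  obtain ⟨P, hP⟩ : ∃ P, D.P = P + 1 := ⟨D.P - 1, by have := hD.two_le_P; omega⟩
  have e3 : (N : ℝ) ^ D.P = N ^ (D.P - 1) * N := by
    rw [hP, Nat.add_sub_cancel, pow_succ]
  have hp : (N : ℝ) ^ (D.P - 1) ≠ 0 := pow_ne_zero _ hN'
  rw [h1, h2, card_cpl, rate, noiseScale, e3]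
  field_simp

variable (D o) in
/-- The contribution of the interpolation to the limiting free energy. -/
def correction : ℝ :=
  -(D.β' * (1 / 2) * ((D.P : ℝ) - 1) * (1 + D.ρ) ^ ((D.P : ℝ) / 2) * o.n ^ D.P)
    + D.β' ^ 2 / 4 * D.γ * D.noiseVar
      * (1 - D.P * o.q₂ ^ (D.P - 1) + ((D.P : ℝ) - 1) * o.q₂ ^ D.P)
    - D.β' ^ 2 / 4 * D.γ * D.noiseVar * ((D.P : ℝ) - 1) * D.θ * (o.q₂ ^ D.P - o.q₁ ^ D.P)

lemma tendsto_rate (hD : D.Admissible) (hR : D.OneRSB o J) (hC : D.OverlapConcentration o J)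
    {u : ℝ} (hs : 0 ≤ Real.sin u) (hc : 0 < Real.cos u) :
    Tendsto (fun N => D.rate o J N u) atTop (𝓝 (2 * D.correction o)) := by
  have hM : (D.M : ℝ) ≠ 0 := by
    have := hD.one_le_M
    exact_mod_cast (by omega : D.M ≠ 0)
  have s1 : Tendsto (fun N => ∑ a, D.mean o J N u (fun z σ => mattisEx (D.base z) a σ ^ D.P)) atTop
      (𝓝 (∑ _a : Fin D.M, o.n ^ D.P)) :=
    tendsto_finsetSum _ fun a _ => tendsto_mean_mattisEx_pow hD hR hs hc a D.P
  have s2 : Tendsto (fun N => ∑ a, D.mean o J N u (fun z σ => mattisEx (D.base z) a σ)) atTop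
      (𝓝 (∑ _a : Fin D.M, o.n)) :=
    tendsto_finsetSum _ fun a _ => by
      simpa using tendsto_mean_mattisEx_pow hD hR hs hc a 1
  have c1 := tendsto_mean₁_sq hD hC hs hc
  have c2 := tendsto_mean₂_sq hD hC hs hc
  have a1 : ∀ N, _ := fun N => isAverage_mean₁ (N := N) (o := o) (J := J) hD u
  have a2 : ∀ N, _ := fun N => isAverage_mean₂ (N := N) (o := o) (J := J) hD u
  have n1 := (tendsto_noiseCov (D := D) a1 c1).const_mul D.θ
  have n2 := (tendsto_noiseCov (D := D) a2 c2).const_mul (1 - D.θ)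
  have o1 := (tendsto_overlap a1 c1).const_mul D.θ
  have o2 := (tendsto_overlap a2 c2).const_mul (1 - D.θ)
  have hl := (((((s1.const_mul (D.β' / (2 * D.M) * (1 + D.ρ) ^ ((D.P : ℝ) / 2))).sub
    (s2.const_mul (D.ψ o))).const_mul 2).add ((tendsto_noiseScale hD).mul
      (((tendsto_factorial_mul_choose_div_pow D.P).sub n2).sub n1))).sub
        (((o2.const_sub 1).sub o1).const_mul (D.A₁ o ^ 2))).sub
          ((o2.const_sub 1).const_mul (D.A₂ o ^ 2))
  unfold rate
  convert hl using 2
  obtain ⟨P, hP⟩ : ∃ P, D.P = P + 1 := ⟨D.P - 1, by have := hD.two_le_P; omega⟩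
  rw [A₁_sq hD hC, A₂_sq hD hC, correction, ψ]
  simp only [Finset.sum_const, Finset.card_univ, Fintype.card_fin, nsmul_eq_mul]
  have e : ∀ x : ℝ, x ^ D.P = x ^ (D.P - 1) * x := fun x => by
    rw [hP, Nat.add_sub_cancel, pow_succ]
  rw [e o.n, e o.q₁, e o.q₂]
  field_simp
  ring

lemma exists_rate_bound (hD : D.Admissible) :
    ∃ B, ∀ᶠ N in atTop, ∀ u, |D.rate o J N u| ≤ B := by
  set c₁ := D.β' / (2 * D.M) * (1 + D.ρ) ^ ((D.P : ℝ) / 2)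
  set S := ∑ _a : Fin D.M, |D.r / D.R| ^ D.P
  set S' := ∑ _a : Fin D.M, |D.r / D.R|
  set V := D.β' ^ 2 / 2 * D.γ * D.noiseVar
  have hV : ∀ᶠ N in atTop, D.noiseScale N < V + 1 :=
    (tendsto_noiseScale hD).eventually_lt_const (lt_add_one V)
  refine ⟨2 * (|c₁| * S + |D.ψ o| * S') + (V + 1) * 2 + D.A₁ o ^ 2 * 2 + D.A₂ o ^ 2 * 2, ?_⟩
  filter_upwards [hV, eventually_ne_atTop 0] with N hN hN0 u
  have hN' : (0 : ℝ) < N := by exact_mod_cast Nat.pos_of_ne_zero hN0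
  have hA := isAverage_mean (N := N) (o := o) (J := J) hD u
  have a1 := isAverage_mean₁ (N := N) (o := o) (J := J) hD u
  have a2 := isAverage_mean₂ (N := N) (o := o) (J := J) hD u
  have b1 : |∑ a, D.mean o J N u (fun z σ => mattisEx (D.base z) a σ ^ D.P)| ≤ S :=
    (Finset.abs_sum_le_sum_abs _ _).trans (Finset.sum_le_sum fun a _ =>
      hA.abs_le (f := fun q => mattisEx (D.base q.1) a q.2 ^ D.P) fun q => by
        rw [abs_pow]; exact pow_le_pow_left₀ (abs_nonneg _) (abs_mattisEx_le _ _ _) _)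
  have b2 : |∑ a, D.mean o J N u (fun z σ => mattisEx (D.base z) a σ)| ≤ S' :=
    (Finset.abs_sum_le_sum_abs _ _).trans (Finset.sum_le_sum fun a _ =>
      hA.abs_le (f := fun q => mattisEx (D.base q.1) a q.2) fun q => abs_mattisEx_le _ _ _)
  have hθ := hD.θ_pos
  have hθ1 := hD.θ_le_one
  -- convex combinations of quantities bounded by `1` differ from such a quantity by at most `2`
  have conv : ∀ x y z : ℝ, |x| ≤ 1 → |y| ≤ 1 → |z| ≤ 1 →
      |x - (1 - D.θ) * y - D.θ * z| ≤ 2 := fun x y z hx hy hz => by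
    rw [abs_le] at *
    constructor <;> nlinarith
  have q1 : |D.mean₁ o J N u overlap| ≤ 1 :=
    a1.abs_le (f := fun q => overlap q.1 q.2) fun q => abs_overlap_le _ _
  have q2 : |D.mean₂ o J N u overlap| ≤ 1 :=
    a2.abs_le (f := fun q => overlap q.1 q.2) fun q => abs_overlap_le _ _
  have k0 : (D.P.factorial * N.choose D.P : ℝ) ≤ (N : ℝ) ^ D.P := by
    exact_mod_cast (Nat.descFactorial_eq_factorial_mul_choose N D.P ▸
      Nat.descFactorial_le_pow N D.P : D.P.factorial * N.choose D.P ≤ N ^ D.P)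
  have hp := pow_pos hN' D.P
  have k1 : ∀ x : ℝ, |x| ≤ N.choose D.P → |D.P.factorial / (N : ℝ) ^ D.P * x| ≤ 1 := fun x hx => by
    rw [abs_mul, abs_of_nonneg (by positivity), div_mul_eq_mul_div, div_le_one hp]
    exact (mul_le_mul_of_nonneg_left hx (by positivity)).trans k0
  have k2 : |D.P.factorial * N.choose D.P / (N : ℝ) ^ D.P| ≤ 1 := by
    rw [abs_of_nonneg (by positivity), div_le_one hp]; exact k0
  have k3 := k1 _ (a1.abs_le (f := fun q => D.noiseCov q.1 q.2) fun q => abs_noiseCov_le _ _)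
  have k4 := k1 _ (a2.abs_le (f := fun q => D.noiseCov q.1 q.2) fun q => abs_noiseCov_le _ _)
  have f1 := conv _ _ _ k2 k4 k3
  have f2 := conv 1 _ _ (by simp) q2 q1
  have f3 := conv 1 _ 0 (by simp) q2 (by simp)
  rw [mul_zero, sub_zero] at f3
  have hv0 : 0 ≤ D.noiseScale N := by unfold noiseScale; positivity
  unfold rate
  refine (abs_sub _ _).trans (add_le_add ((abs_sub _ _).trans (add_le_add ((abs_add_le _ _).trans
    (add_le_add ?_ ?_)) ?_)) ?_)
  · rw [abs_mul, abs_two]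
    refine mul_le_mul_of_nonneg_left ((abs_sub _ _).trans (add_le_add ?_ ?_)) zero_le_two
    · rw [abs_mul]; exact mul_le_mul_of_nonneg_left b1 (abs_nonneg _)
    · rw [abs_mul]; exact mul_le_mul_of_nonneg_left b2 (abs_nonneg _)
  · rw [abs_mul, abs_of_nonneg hv0]
    exact mul_le_mul hN.le f1 (abs_nonneg _) (hv0.trans hN.le)
  · rw [abs_mul, abs_of_nonneg (sq_nonneg _)]
    exact mul_le_mul_of_nonneg_left f2 (sq_nonneg _)
  · rw [abs_mul, abs_of_nonneg (sq_nonneg _)]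
    exact mul_le_mul_of_nonneg_left f3 (sq_nonneg _)

/-! #### The limiting free energy -/

variable (D o J) in
/-- The limit of `N⁻¹ 𝔼₀ ln Z_N(J)`. -/
def pressure : ℝ :=
  Real.log 2 + 1 / D.θ * (D.Esite fun x e => EG fun y₁ =>
      Real.log (cpow D.θ (D.siteField o J x e) (D.A₁ o) (D.A₂ o) y₁)) + D.correction o

variable (D J) in
/-- `N⁻¹ 𝔼₀ ln Z_N(J)`. -/
def pressureN (N : ℕ) : ℝ := 1 / N * D.E0 fun d : D.Disorder N => Real.log (Z d J)

theorem tendsto_pressureN (hD : D.Admissible) (hR : D.OneRSB o J)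
    (hC : D.OverlapConcentration o J) :
    Tendsto (fun N => D.pressureN J N) atTop (𝓝 (D.pressure o J)) := by
  obtain ⟨B, hB⟩ := exists_rate_bound (o := o) (J := J) hD
  have hπ : 0 ≤ Real.pi / 2 := by positivity
  have hθ := hD.θ_pos.ne'
  have hder : ∀ {N : ℕ}, N ≠ 0 → deriv (fun v => D.interp o J N v / (N * D.θ))
      = fun u => Real.sin u * Real.cos u * D.rate o J N u := fun hN =>
    funext fun u => (hasDerivAt_interp_div hD hN u).deriv
  have hbd : ∀ᶠ N in atTop, ∀ u, ‖Real.sin u * Real.cos u * D.rate o J N u‖ ≤ B := by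
    filter_upwards [hB] with N hN u
    rw [Real.norm_eq_abs, abs_mul, abs_mul]
    have h1 := Real.abs_sin_le_one u
    have h2 := Real.abs_cos_le_one u
    refine (mul_le_of_le_one_left (abs_nonneg _) ?_).trans (hN u)
    exact mul_le_one₀ h1 (abs_nonneg _) h2
  have hmeas : ∀ {N : ℕ}, N ≠ 0 →
      Measurable fun u => Real.sin u * Real.cos u * D.rate o J N u := fun hN => by
    rw [← hder hN]; exact measurable_deriv _
  have hint : Tendsto (fun N => ∫ u in (0 : ℝ)..(Real.pi / 2),
      Real.sin u * Real.cos u * D.rate o J N u) atTop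
      (𝓝 (∫ u in (0 : ℝ)..(Real.pi / 2), Real.sin u * Real.cos u * (2 * D.correction o))) := by
    refine intervalIntegral.tendsto_integral_filter_of_dominated_convergence (fun _ => B) ?_ ?_
      intervalIntegrable_const (ae_of_all _ fun u hu => ?_)
    · filter_upwards [eventually_ne_atTop 0] with N hN
      exact (hmeas hN).aestronglyMeasurable
    · filter_upwards [hbd] with N hN
      exact ae_of_all _ fun u _ => hN u
    · rw [Set.uIoc_of_le hπ] at hu
      rcases hu.2.eq_or_lt with h | h
      · simp [h]
      · have hs : 0 ≤ Real.sin u := Real.sin_nonneg_of_nonneg_of_le_pi hu.1.le (by linarith)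
        have hc : 0 < Real.cos u := Real.cos_pos_of_mem_Ioo ⟨by linarith [hu.1], h⟩
        exact (tendsto_rate hD hR hC hs hc).const_mul _
  have hval : ∫ u in (0 : ℝ)..(Real.pi / 2), Real.sin u * Real.cos u * (2 * D.correction o)
      = D.correction o := by
    rw [intervalIntegral.integral_mul_const, integral_sin_mul_cos₁]
    simp
  rw [hval] at hint
  have hfin := hint.const_add (Real.log 2 + 1 / D.θ * (D.Esite fun x e => EG fun y₁ =>
      Real.log (cpow D.θ (D.siteField o J x e) (D.A₁ o) (D.A₂ o) y₁)))
  refine hfin.congr' ?_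
  filter_upwards [hbd, eventually_ne_atTop 0] with N hN hN0
  have hN' : (N : ℝ) ≠ 0 := by exact_mod_cast hN0
  have hii : IntervalIntegrable (fun u => Real.sin u * Real.cos u * D.rate o J N u) volume 0
      (Real.pi / 2) :=
    (intervalIntegrable_const (c := B)).mono_fun' (hmeas hN0).aestronglyMeasurable
      (ae_of_all _ fun u => hN u)
  rw [intervalIntegral.integral_eq_sub_of_hasDerivAt
    (fun u _ => hasDerivAt_interp_div hD hN0 u) hii, interp_pi_div_two hD hN0,
    interp_zero hD hN0, pressureN]
  field_simp
  ring

end Limit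
end Model

/-! ### Convexity in the source -/

/-- Jensen's inequality: `log ∑ exp` lies above its tangents. -/
lemma gav_sub_le_log_pf_sub {S : Type*} [Fintype S] [Nonempty S] (x y : S → ℝ) :
    gav x (fun s => y s - x s) ≤ Real.log (pf y) - Real.log (pf x) := by
  set c := gav x fun s => y s - x s with hc
  have hp := pf_pos x
  have h1 : pf y = pf x * gav x fun s => Real.exp (y s - x s) := by
    rw [gav_eq_div, mul_div_cancel₀ _ hp.ne', pf]
    exact Finset.sum_congr rfl fun s _ => by rw [← Real.exp_add]; ring_nf
  have h2 : Real.exp c ≤ gav x fun s => Real.exp (y s - x s) := by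
    have h3 : Real.exp c = gav x fun s => Real.exp c * (1 - c) + Real.exp c * (y s - x s) := by
      rw [gav_add, gav_const, gav_const_mul, ← hc]; ring
    rw [h3]
    refine gav_mono x fun s => ?_
    have h4 := mul_le_mul_of_nonneg_left (Real.add_one_le_exp (y s - x s - c)) (Real.exp_pos c).le
    rw [← Real.exp_add] at h4
    calc _ = Real.exp c * (y s - x s - c + 1) := by ring
      _ ≤ _ := h4
      _ = _ := by ring_nf
  rw [h1, Real.log_mul hp.ne' ((Real.exp_pos c).trans_le h2).ne', add_sub_cancel_left]
  exact (Real.le_log_iff_exp_le ((Real.exp_pos c).trans_le h2)).2 h2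

lemma abs_log_pf_sub_le {S : Type*} [Fintype S] [Nonempty S] (x : S → ℝ) :
    |Real.log (pf x) - Real.log (pf fun _ : S => 0)| ≤ ∑ s, |x s| := by
  have h1 := gav_sub_le_log_pf_sub (fun _ => 0) x
  have h2 := gav_sub_le_log_pf_sub x fun _ => 0
  have h3 := fun s => abs_le_sum_abs x s
  have h4 := abs_le.1 (abs_gav_le (fun _ : S => (0 : ℝ)) (f := fun s => x s - 0)
    (by simpa using h3))
  have h5 := abs_le.1 (abs_gav_le x (f := fun s => 0 - x s) (by simpa using h3))
  rw [abs_le]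
  constructor <;> linarith [h4.1, h5.1]

namespace Model

section Source

variable {D : Model} {N : ℕ} {o : OrderParams} {J J' : ℝ}

/-- The exponent of the Boltzmann factor. -/
def energy (d : D.Disorder N) (J : ℝ) (σ : Fin N → Spin) : ℝ :=
  J * ∑ i, sv (d.ξ i) * sv (σ i)
    + D.β' / (2 * D.R ^ ((D.P : ℝ) / 2) * D.M * (N : ℝ) ^ (D.P - 1))
        * ∑ a, (∑ i, sv (d.η a i) * sv (σ i)) ^ D.P
    + D.noiseCoeff N * noise d σ

lemma integrable_coord {ι : Type*} [Fintype ι] (i : ι) :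
    Integrable (fun y : ι → ℝ => y i) (stdG ι) := by
  refine integrable_one_add_sum_abs.mono' (measurable_pi_apply i).aestronglyMeasurable
    (ae_of_all _ fun y => ?_)
  have := Finset.single_le_sum (f := fun i => |y i|) (fun _ _ => abs_nonneg _) (Finset.mem_univ i)
  rw [Real.norm_eq_abs]
  linarith

lemma energy_eq (z : D.Data N) (J : ℝ) (σ : Fin N → Spin) :
    (fun lam => energy (D := D) ⟨z.1, z.2, lam⟩ J σ)
      = fun lam => energy (D.base z) J σ + D.noiseCoeff N * ∑ I, lam I * spinProd I.1 σ := by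
  ext lam
  simp [energy, noise, spinProd]

lemma integrable_energy (z : D.Data N) (J : ℝ) (σ : Fin N → Spin) :
    Integrable (fun lam => energy (D := D) ⟨z.1, z.2, lam⟩ J σ) (stdG (D.Cpl N)) := by
  rw [energy_eq]
  exact (integrable_const _).add ((integrable_finsetSum _ fun I _ =>
    (integrable_coord I).mul_const _).const_mul _)

lemma measurable_energy (z : D.Data N) (J : ℝ) :
    Measurable fun lam => energy (D := D) ⟨z.1, z.2, lam⟩ J := by
  refine measurable_pi_lambda _ fun σ => ?_
  rw [energy_eq]
  fun_prop

lemma integrable_log_Z (z : D.Data N) (J : ℝ) :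
    Integrable (fun lam => Real.log (Z (D := D) ⟨z.1, z.2, lam⟩ J)) (stdG (D.Cpl N)) := by
  have h1 : Integrable (fun lam => ∑ σ, |energy (D := D) ⟨z.1, z.2, lam⟩ J σ|) (stdG (D.Cpl N)) :=
    integrable_finsetSum _ fun σ _ => (integrable_energy z J σ).abs
  have h2 : Integrable (fun lam => Real.log (Z (D := D) ⟨z.1, z.2, lam⟩ J)
      - Real.log (pf fun _ : Fin N → Spin => 0)) (stdG (D.Cpl N)) :=
    h1.mono' ((measurable_pf (measurable_energy z J)).log.sub_const _).aestronglyMeasurable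
      (ae_of_all _ fun lam => abs_log_pf_sub_le (energy (D := D) ⟨z.1, z.2, lam⟩ J))
  refine (h2.add (integrable_const (Real.log (pf fun _ : Fin N → Spin => 0)))).congr
    (ae_of_all _ fun lam => ?_)
  simp

lemma integrable_gav_mattis (z : D.Data N) (J : ℝ) :
    Integrable (fun lam => gav (energy (D := D) ⟨z.1, z.2, lam⟩ J) (mattis (D.base z)))
      (stdG (D.Cpl N)) :=
  integrable_of_bounded (C := 1)
    (measurable_gav (measurable_energy z J) measurable_const).aestronglyMeasurable
    fun _ => abs_gav_le _ (abs_mattis_le (D.base z))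

lemma avg_mattis_eq (J : ℝ) : D.avg N J mattis = ∑ z : D.Data N, D.wt z *
    ∫ lam, gav (energy (D := D) ⟨z.1, z.2, lam⟩ J) (mattis (D.base z)) ∂(stdG (D.Cpl N)) := by
  rw [avg, E0_eq]
  rfl

lemma abs_avg_mattis_le (hD : D.Admissible) (J : ℝ) : |D.avg N J mattis| ≤ 1 := by
  rw [avg_mattis_eq, ← sum_wt (D := D) (N := N)]
  refine (Finset.abs_sum_le_sum_abs _ _).trans (Finset.sum_le_sum fun z _ => ?_)
  rw [abs_mul, abs_of_nonneg (wt_nonneg hD.r_pos hD.r_le_one z)]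
  refine mul_le_of_le_one_right (wt_nonneg hD.r_pos hD.r_le_one z) ?_
  have := norm_integral_le_of_norm_le_const (μ := stdG (D.Cpl N)) (C := 1)
    (f := fun lam => gav (energy (D := D) ⟨z.1, z.2, lam⟩ J) (mattis (D.base z)))
    (ae_of_all _ fun lam => abs_gav_le (energy (D := D) ⟨z.1, z.2, lam⟩ J)
      (abs_mattis_le (D.base z)))
  simpa using this

/-- The free energy is convex in the source, with slope the magnetization. -/
lemma mul_avg_mattis_le (hD : D.Admissible) (hN : N ≠ 0) (J J' : ℝ) :
    (J' - J) * D.avg N J mattis ≤ D.pressureN J' N - D.pressureN J N := by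
  have hN' : (0 : ℝ) < N := by exact_mod_cast Nat.pos_of_ne_zero hN
  have key : ∀ d : D.Disorder N, (J' - J) * N * gav (energy d J) (mattis d)
      ≤ Real.log (Z d J') - Real.log (Z d J) := fun d => by
    rw [← gav_const_mul]
    refine le_trans (le_of_eq ?_) (gav_sub_le_log_pf_sub (energy d J) (energy d J'))
    congr 1; ext σ
    rw [mattis, energy, energy]
    field_simp
    ring
  have h : (J' - J) * N * D.avg N J mattis ≤ (D.E0 fun d : D.Disorder N => Real.log (Z d J'))
      - D.E0 fun d : D.Disorder N => Real.log (Z d J) := by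
    rw [avg_mattis_eq, E0_eq, E0_eq, ← Finset.sum_sub_distrib, Finset.mul_sum]
    refine Finset.sum_le_sum fun z _ => ?_
    rw [← mul_sub, mul_left_comm, ← integral_sub (integrable_log_Z z J') (integrable_log_Z z J),
      ← integral_const_mul]
    exact mul_le_mul_of_nonneg_left (integral_mono ((integrable_gav_mattis z J).const_mul _)
      ((integrable_log_Z z J').sub (integrable_log_Z z J)) fun lam => key _)
      (wt_nonneg hD.r_pos hD.r_le_one z)
  rw [pressureN, pressureN, ← mul_sub, one_div, ← div_eq_inv_mul, le_div_iff₀ hN']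
  linarith

lemma abs_pressureN_sub_le (hD : D.Admissible) (hN : N ≠ 0) (J J' : ℝ) :
    |D.pressureN J' N - D.pressureN J N| ≤ |J' - J| := by
  have bd : ∀ K K' : ℝ, -|K' - K| ≤ (K' - K) * D.avg N K mattis := fun K K' => by
    refine neg_le_of_abs_le ?_
    rw [abs_mul]
    exact mul_le_of_le_one_right (abs_nonneg _) (abs_avg_mattis_le hD K)
  have h1 := (bd J J').trans (mul_avg_mattis_le hD hN J J')
  have h2 := (bd J' J).trans (mul_avg_mattis_le hD hN J' J)
  rw [abs_sub_comm] at h2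
  exact abs_le.2 ⟨h1, by linarith⟩

lemma tendsto_avg_mattis (hR : D.OneRSB o J) :
    Tendsto (fun N => D.avg N J mattis) atTop (𝓝 o.m) := by
  obtain ⟨φ, hφ⟩ := exists_bounded_pow (max 1 |o.m|) 1
  simp only [pow_one] at hφ
  have h := hR.mattis φ
  rw [hφ _ (le_max_right _ _)] at h
  refine h.congr fun N => ?_
  congr 1; ext d σ
  exact hφ _ ((abs_mattis_le d σ).trans (le_max_left _ _))

lemma β'_pos (hD : D.Admissible) : 0 < D.β' := by
  have := hD.β_pos
  unfold β'
  positivity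

/-! ### The limit of vanishing source -/

variable {o : ℝ → OrderParams} {J₀ : ℝ}

lemma tendsto_A₁ (hq₁ : Tendsto (fun J => (o J).q₁) (𝓝[>] 0) (𝓝 (o 0).q₁)) :
    Tendsto (fun J => D.A₁ (o J)) (𝓝[>] 0) (𝓝 (D.A₁ (o 0))) :=
  (((hq₁.pow _).const_mul _).sqrt).const_mul _

lemma tendsto_A₂ (hq₁ : Tendsto (fun J => (o J).q₁) (𝓝[>] 0) (𝓝 (o 0).q₁))
    (hq₂ : Tendsto (fun J => (o J).q₂) (𝓝[>] 0) (𝓝 (o 0).q₂)) :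
    Tendsto (fun J => D.A₂ (o J)) (𝓝[>] 0) (𝓝 (D.A₂ (o 0))) :=
  ((((hq₂.pow _).sub (hq₁.pow _)).const_mul _).sqrt).const_mul _

lemma tendsto_siteField (hn : Tendsto (fun J => (o J).n) (𝓝[>] 0) (𝓝 (o 0).n)) (x : Spin)
    (e : Fin D.M → Spin) :
    Tendsto (fun J => D.siteField (o J) J x e) (𝓝[>] 0) (𝓝 (D.siteField (o 0) 0 x e)) := by
  have hJ : Tendsto (fun J : ℝ => J) (𝓝[>] 0) (𝓝 0) := tendsto_nhdsWithin_of_tendsto_nhds tendsto_id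
  exact (hJ.mul_const _).add ((((hn.pow _).const_mul _).mul_const _).mul_const _)

lemma tendsto_siteTilt (hD : D.Admissible) (hn : Tendsto (fun J => (o J).n) (𝓝[>] 0) (𝓝 (o 0).n))
    (hq₁ : Tendsto (fun J => (o J).q₁) (𝓝[>] 0) (𝓝 (o 0).q₁))
    (hq₂ : Tendsto (fun J => (o J).q₂) (𝓝[>] 0) (𝓝 (o 0).q₂))
    {h : ℝ → ℝ} (hh : Continuous h) (hB : ∀ x, |h x| ≤ 1) (k : ℕ)
    (c : Spin → (Fin D.M → Spin) → ℝ) :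
    Tendsto (fun J => D.siteTilt (o J) J h k c) (𝓝[>] 0) (𝓝 (D.siteTilt (o 0) 0 h k c)) := by
  simp only [siteTilt, Esite_eq]
  exact tendsto_finsetSum _ fun q _ => ((tendsto_EG_ctilt_pow hD.θ_pos.le hD.θ_le_one hh hB
    (tendsto_siteField hn _ _) (tendsto_A₁ hq₁) (tendsto_A₂ hq₁ hq₂) k).mul_const _).const_mul _

lemma tendsto_pressure (hD : D.Admissible) (hn : Tendsto (fun J => (o J).n) (𝓝[>] 0) (𝓝 (o 0).n))
    (hq₁ : Tendsto (fun J => (o J).q₁) (𝓝[>] 0) (𝓝 (o 0).q₁))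
    (hq₂ : Tendsto (fun J => (o J).q₂) (𝓝[>] 0) (𝓝 (o 0).q₂)) :
    Tendsto (fun J => D.pressure (o J) J) (𝓝[>] 0) (𝓝 (D.pressure (o 0) 0)) := by
  simp only [pressure, correction, Esite_eq]
  exact ((((tendsto_finsetSum _ fun q _ => (tendsto_EG_log_cpow hD.θ_pos.le hD.θ_le_one
    (tendsto_siteField hn _ _) (tendsto_A₁ hq₁) (tendsto_A₂ hq₁ hq₂)).const_mul _).const_mul
      _).const_add _).add (((((hn.pow _).const_mul _).neg).add
        ((((hq₂.pow _).const_mul _).const_sub _ |>.add ((hq₂.pow _).const_mul _)).const_mul _)).sub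
          (((hq₂.pow _).sub (hq₁.pow _)).const_mul _)))

/-- Since the magnetization is bounded, the limit of infinite size is uniform in the source, and
it exists also at a vanishing source. -/
lemma tendsto_pressureN_zero (hD : D.Admissible) (hJ₀ : 0 < J₀)
    (hlim : ∀ J ∈ Set.Ioo 0 J₀, Tendsto (fun N => D.pressureN J N) atTop (𝓝 (D.pressure (o J) J)))
    (hp : Tendsto (fun J => D.pressure (o J) J) (𝓝[>] 0) (𝓝 (D.pressure (o 0) 0))) :
    Tendsto (fun N => D.pressureN 0 N) atTop (𝓝 (D.pressure (o 0) 0)) := by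
  rw [Metric.tendsto_nhds]
  intro ε hε
  have h3 : 0 < ε / 3 := by positivity
  obtain ⟨J, h1, hJ⟩ := ((Metric.tendsto_nhds.1 hp _ h3).and
    (Ioo_mem_nhdsGT (lt_min hJ₀ h3))).exists
  have hJ1 : J < J₀ := hJ.2.trans_le (min_le_left _ _)
  have hJ2 : J < ε / 3 := hJ.2.trans_le (min_le_right _ _)
  filter_upwards [Metric.tendsto_nhds.1 (hlim J ⟨hJ.1, hJ1⟩) _ h3, eventually_ne_atTop 0]
    with N h2 hN
  have h4 := abs_pressureN_sub_le hD hN J 0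
  rw [zero_sub, abs_neg, abs_of_pos hJ.1] at h4
  rw [Real.dist_eq] at *
  calc _ = |(D.pressureN 0 N - D.pressureN J N) + (D.pressureN J N - D.pressure (o J) J)
        + (D.pressure (o J) J - D.pressure (o 0) 0)| := by ring_nf
    _ ≤ _ := abs_add_three _ _ _
    _ < ε := by linarith

/-- The slope of the limiting free energy at a vanishing source lies between the magnetizations at
the two ends, by convexity. -/
lemma hasDerivWithinAt_pressure (hD : D.Admissible) (hJ₀ : 0 < J₀)
    (hR : ∀ J ∈ Set.Ioo 0 J₀, D.OneRSB (o J) J)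
    (hlim : ∀ J ∈ Set.Ico 0 J₀, Tendsto (fun N => D.pressureN J N) atTop (𝓝 (D.pressure (o J) J)))
    (hp : Tendsto (fun J => D.pressure (o J) J) (𝓝[>] 0) (𝓝 (D.pressure (o 0) 0)))
    (hm : Tendsto (fun J => (o J).m) (𝓝[>] 0) (𝓝 (o 0).m)) :
    HasDerivWithinAt (fun J => D.pressure (o J) J) (o 0).m (Set.Ici 0) 0 := by
  have tangent : ∀ J ∈ Set.Ioo 0 J₀, ∀ J' ∈ Set.Ico 0 J₀,
      (J' - J) * (o J).m ≤ D.pressure (o J') J' - D.pressure (o J) J := fun J hJ J' hJ' => by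
    refine le_of_tendsto_of_tendsto ((tendsto_avg_mattis (hR J hJ)).const_mul (J' - J))
      ((hlim J' hJ').sub (hlim J ⟨hJ.1.le, hJ.2⟩)) ?_
    filter_upwards [eventually_ne_atTop 0] with N hN
    exact mul_avg_mattis_le hD hN J J'
  have tangent₀ : ∀ J ∈ Set.Ioo 0 J₀,
      J * (o 0).m ≤ D.pressure (o J) J - D.pressure (o 0) 0 := fun J hJ => by
    have hid : Tendsto (fun s : ℝ => s) (𝓝[>] 0) (𝓝 0) :=
      tendsto_nhdsWithin_of_tendsto_nhds tendsto_id
    have h1 := (hid.const_sub J).mul hm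
    rw [sub_zero] at h1
    refine le_of_tendsto_of_tendsto h1 (hp.const_sub _) ?_
    filter_upwards [Ioo_mem_nhdsGT hJ₀] with s hs
    exact tangent s hs J ⟨hJ.1.le, hJ.2⟩
  rw [hasDerivWithinAt_iff_tendsto_slope, Set.Ici_sdiff_left]
  refine tendsto_of_tendsto_of_tendsto_of_le_of_le' tendsto_const_nhds hm ?_ ?_
  all_goals
    filter_upwards [Ioo_mem_nhdsGT hJ₀] with J hJ
    rw [slope_def_field, sub_zero]
  · rw [le_div_iff₀ hJ.1, mul_comm]
    exact tangent₀ J hJ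
  · rw [div_le_iff₀ hJ.1]
    linarith [tangent J hJ 0 ⟨le_rfl, hJ₀⟩]

/-! ### The one-site system at a vanishing source -/

lemma g_eq_siteField {o : OrderParams} (x : Spin) (e : Fin D.M → Spin) (y₁ y₂ : ℝ) :
    D.g o e y₁ y₂ = D.siteField o 0 x e + y₁ * D.A₁ o + y₂ * D.A₂ o := by
  rw [siteField, zero_mul, zero_add]
  rfl

lemma tilt_eq_ctilt {o : OrderParams} (h : ℝ → ℝ) (x : Spin) (e : Fin D.M → Spin) (y₁ : ℝ) :
    D.tilt o h e y₁ = ctilt D.θ h (D.siteField o 0 x e) (D.A₁ o) (D.A₂ o) y₁ := by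
  simp only [tilt, g_eq_siteField x]
  rfl

end Source
end Model
end
end UnsupDAM

theorem proposition1 (D : UnsupDAM.Model) (hD : D.Admissible)
    (o : ℝ → UnsupDAM.OrderParams) (J₀ : ℝ) (hJ₀ : 0 < J₀)
    (hRSB : ∀ J ∈ Set.Ioo 0 J₀, D.OneRSB (o J) J)
    (hconc : ∀ J ∈ Set.Ioo 0 J₀, D.OverlapConcentration (o J) J)
    (hm : Tendsto (fun J => (o J).m) (𝓝[>] 0) (𝓝 (o 0).m))
    (hn : Tendsto (fun J => (o J).n) (𝓝[>] 0) (𝓝 (o 0).n))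
    (hq₁ : Tendsto (fun J => (o J).q₁) (𝓝[>] 0) (𝓝 (o 0).q₁))
    (hq₂ : Tendsto (fun J => (o J).q₂) (𝓝[>] 0) (𝓝 (o 0).q₂)) :
    ∃ F : ℝ → ℝ,
      (∀ J ∈ Set.Ico 0 J₀, Tendsto (fun N => D.freeEnergy N J) atTop (𝓝 (F J))) ∧
      -D.β' * F 0 =
        1 / D.θ * (D.Esite fun _ e => UnsupDAM.Model.EG fun y₁ =>
            Real.log (UnsupDAM.Model.EG fun y₂ => Real.cosh (D.g (o 0) e y₁ y₂) ^ D.θ))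
          - D.β' * (1 / 2) * ((D.P : ℝ) - 1) * (1 + D.ρ) ^ ((D.P : ℝ) / 2) * (o 0).n ^ D.P
          + D.β' ^ 2 / 4 * D.γ * ((1 + √D.ρP) ^ 2 / (1 + D.ρ) ^ D.P)
            * (1 - D.P * (o 0).q₂ ^ (D.P - 1) + ((D.P : ℝ) - 1) * (o 0).q₂ ^ D.P)
          - D.β' ^ 2 / 4 * D.γ * ((1 + √D.ρP) ^ 2 / (1 + D.ρ) ^ D.P)
            * ((D.P : ℝ) - 1) * D.θ * ((o 0).q₂ ^ D.P - (o 0).q₁ ^ D.P)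
          + Real.log 2 ∧
      (o 0).n = 1 / (1 + D.ρ) * (D.Esite fun _ e => UnsupDAM.Model.EG fun y₁ =>
          D.tilt (o 0) Real.tanh e y₁ * D.etaHat e) ∧
      (o 0).q₁ = (D.Esite fun _ e => UnsupDAM.Model.EG fun y₁ =>
          D.tilt (o 0) Real.tanh e y₁ ^ 2) ∧
      (o 0).q₂ = (D.Esite fun _ e => UnsupDAM.Model.EG fun y₁ =>
          D.tilt (o 0) (fun x => Real.tanh x ^ 2) e y₁) ∧
      HasDerivWithinAt (fun J => -D.β' * F J) (o 0).m (Set.Ici 0) 0 ∧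
      (o 0).m = (D.Esite fun x e => UnsupDAM.Model.EG fun y₁ =>
          D.tilt (o 0) Real.tanh e y₁ * UnsupDAM.sv x) := by
  have hβ := (UnsupDAM.Model.β'_pos hD).ne'
  have hnear : ∀ᶠ J in 𝓝[>] (0 : ℝ), J ∈ Set.Ioo 0 J₀ := Ioo_mem_nhdsGT hJ₀
  have htanh := UnsupDAM.Model.continuous_real_tanh
  have hp := UnsupDAM.Model.tendsto_pressure hD hn hq₁ hq₂
  have hpos : ∀ J ∈ Set.Ioo 0 J₀,
      Tendsto (fun N => D.pressureN J N) atTop (𝓝 (D.pressure (o J) J)) := fun J hJ =>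
    UnsupDAM.Model.tendsto_pressureN hD (hRSB J hJ) (hconc J hJ)
  have hlim : ∀ J ∈ Set.Ico 0 J₀,
      Tendsto (fun N => D.pressureN J N) atTop (𝓝 (D.pressure (o J) J)) := fun J hJ => by
    rcases hJ.1.eq_or_lt with rfl | h
    · exact UnsupDAM.Model.tendsto_pressureN_zero hD hJ₀ hpos hp
    · exact hpos J ⟨h, hJ.2⟩
  have hF : ∀ p : ℝ, -D.β' * (-(1 / D.β') * p) = p := fun p => by field_simp
  refine ⟨fun J => -(1 / D.β') * D.pressure (o J) J, fun J hJ => (hlim J hJ).const_mul _,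
    ?_, ?_, ?_, ?_, ?_, ?_⟩
  · rw [hF]
    have e : (D.Esite fun x e => UnsupDAM.Model.EG fun y₁ => Real.log (UnsupDAM.Model.cpow D.θ
        (D.siteField (o 0) 0 x e) (D.A₁ (o 0)) (D.A₂ (o 0)) y₁))
        = D.Esite fun _ e => UnsupDAM.Model.EG fun y₁ =>
          Real.log (UnsupDAM.Model.EG fun y₂ => Real.cosh (D.g (o 0) e y₁ y₂) ^ D.θ) := by
      congr 1; ext x e
      simp only [UnsupDAM.Model.g_eq_siteField x]
      rfl
    rw [UnsupDAM.Model.pressure, e, UnsupDAM.Model.correction, UnsupDAM.Model.noiseVar]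
    ring
  · refine (tendsto_nhds_unique hn (((UnsupDAM.Model.tendsto_siteTilt hD hn hq₁ hq₂ htanh
      UnsupDAM.Model.abs_real_tanh_le_one 1 fun _ e => D.etaHat e).const_mul
        (1 / (1 + D.ρ))).congr' ?_)).trans ?_
    · filter_upwards [hnear] with J hJ
      exact (UnsupDAM.Model.n_eq hD (hRSB J hJ)).symm
    · rw [UnsupDAM.Model.siteTilt_one_eq]
      congr 2; ext x e
      simp only [UnsupDAM.Model.tilt_eq_ctilt _ x]
  · refine (tendsto_nhds_unique hq₁ ((UnsupDAM.Model.tendsto_siteTilt hD hn hq₁ hq₂ htanh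
      UnsupDAM.Model.abs_real_tanh_le_one 2 fun _ _ => 1).congr' ?_)).trans ?_
    · filter_upwards [hnear] with J hJ
      exact (UnsupDAM.Model.q₁_eq hD (hconc J hJ)).symm
    · rw [UnsupDAM.Model.siteTilt]
      congr 1; ext x e
      simp only [UnsupDAM.Model.tilt_eq_ctilt _ x, mul_one]
  · refine (tendsto_nhds_unique hq₂ ((UnsupDAM.Model.tendsto_siteTilt hD hn hq₁ hq₂ (htanh.pow 2)
      UnsupDAM.Model.abs_tanh_sq_le_one 1 fun _ _ => 1).congr' ?_)).trans ?_
    · filter_upwards [hnear] with J hJ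
      exact (UnsupDAM.Model.q₂_eq hD (hconc J hJ)).symm
    · rw [UnsupDAM.Model.siteTilt_one_eq]
      congr 1; ext x e
      simp only [UnsupDAM.Model.tilt_eq_ctilt _ x, mul_one]
      rfl
  · simp only [hF]
    exact UnsupDAM.Model.hasDerivWithinAt_pressure hD hJ₀ hRSB hlim hp hm
  · refine (tendsto_nhds_unique hm ((UnsupDAM.Model.tendsto_siteTilt hD hn hq₁ hq₂ htanh
      UnsupDAM.Model.abs_real_tanh_le_one 1 fun x _ => UnsupDAM.sv x).congr' ?_)).trans ?_
    · filter_upwards [hnear] with J hJ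
      exact (UnsupDAM.Model.m_eq hD (hRSB J hJ)).symm
    · rw [UnsupDAM.Model.siteTilt_one_eq]
      congr 1; ext x e
      simp only [UnsupDAM.Model.tilt_eq_ctilt _ x]
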